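/- **Setting.** Fix node names, channels, data values and process definitions $A(\tilde x)\Leftarrow s$. Processes and states of the calculus are $p::=s\mid p\oplus_w q$ (probabilistic choice) and $s::=c!\langle e\rangle.p\mid c?(x).p\mid\omega\mid s+t\mid \mathsf{if}\ b\ \mathsf{then}\ s\ \mathsf{else}\ t\mid\tau.p\mid A(\tilde e)\mid 0$; a closed process denotes a finitely supported distribution $[\![p]\!]$ of closed states. A system term $M$ is a parallel composition of nodes $n[\![s]\!]$ with closed code $s$ and pairwise different names; $\mathrm{nodes}(M)$ is the set of these names. A network $\mathcal M=\Gamma\triangleright M$ places $M$ on a finite irreflexive digraph $\Gamma$ whose vertex set $\Gamma_V$ contains $\mathrm{nodes}(M)$; an edge $m\to n$ means that $n$ hears $m$. The nodes in $\Gamma_V\setminus\mathrm{nodes}(M)$ are external. Networks are assumed well-formed: no edge joins two external nodes, and no external node is isolated. $\mathrm{In}(\mathcal M)$ and $\mathrm{Out}(\mathcal M)$ are the sets of external nodes with an outgoing, respectively incoming, edge. A network is successful if $\omega$ is enabled at some node (up to structural congruence $\equiv$: commutative monoid laws for $+$ and for parallel composition, evaluation of conditionals, unfolding of definitions). The intensional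 transitions are $m.\tau$ (internal step of node $m$), $m.c!v$ (node $m$ broadcasts, and every node of $M$ that hears $m$ and can receive on $c$ receives $v$) and $m.c?v$ (the nodes of $M$ that hear $m$ and can receive on $c$ receive $v$, all others are unchanged); each leads to a distribution $\Gamma\triangleright\Delta$. A *reduction* is an $m.\tau$ or $m.c!v$ transition. A non-successful network has the strong *extensional* actions: $\tau$ ($m.\tau$, or a broadcast heard by no external node); $n.c?v$ with $n\in\mathrm{In}(\mathcal M)$; and $c!v\triangleright\eta$ (a broadcast $m.c!v$, where $\eta\ne\emptyset$ is the set of external nodes that hear $m$). A network is *finitary* if, up to $\equiv$, finitely many networks are reachable from it by extensional actions and each of these has finitely many extensional derivatives. **Weak actions and results.** A sub-distribution has mass at most $1$; $\bar s$ is the point distribution at $s$. A relation $\mathcal R$ from states to sub-distributions is lifted to $\overline{\mathcal R}$, the least relation on sub-distributions with $\bar s\,\overline{\mathcal R}\,\Delta$ whenever $s\,\mathcal R\,\Delta$, closed under finite combinations $\sum_i p_i\,\cdot$ with $\sum_i p_i\le1$. For a step relation, $\Delta\Rightarrow\Delta'$ (hyper-derivation) means $\Delta=\Delta_0^{\to}+\Delta_0^{\times}$,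 $\Delta_k^{\to}\to\Delta_{k+1}^{\to}+\Delta_{k+1}^{\times}$ (lifted step) for all $k$, no successful state in the support of any $\Delta_k^{\to}$, and $\Delta'=\sum_k\Delta_k^{\times}$; it is *extreme* if every state in the support of $\Delta'$ that has a step is successful. $\mathrm{Results}(\mathcal M)$ is the set of probabilities of being successful in $\Delta'$, over all extreme $\overline{\mathcal M}\Rightarrow\Delta'$ for the reduction relation. With $\Rightarrow$ for strong extensional $\tau$-steps, the weak extensional actions are: $\stackrel{\tau}{\Longrightarrow}$ is $\Rightarrow$; $\stackrel{n.c?v}{\Longrightarrow}$ is $\Rightarrow\stackrel{n.c?v}{\longrightarrow}\Rightarrow$; and $\stackrel{c!v\triangleright\eta}{\Longrightarrow}$ is least containing $\Rightarrow\stackrel{c!v\triangleright\eta}{\longrightarrow}\Rightarrow$ and such that $\mathcal M\stackrel{c!v\triangleright\eta_1}{\Longrightarrow}\Delta'\stackrel{c!v\triangleright\eta_2}{\Longrightarrow}\Delta$ with $\eta_1\cap\eta_2=\emptyset$ gives $\mathcal M\stackrel{c!v\triangleright(\eta_1\cup\eta_2)}{\Longrightarrow}\Delta$ (the action of the sub-distribution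 $\Delta'$ being the lifted one). **Must-testing.** If $\mathrm{nodes}(\mathcal M)\cap(\mathcal T)_V=\emptyset$, then $\mathcal M\,\|\!\rangle\,\mathcal T$ is defined; it is the union of the graphs running the parallel composition of the systems. For networks with the same input and output nodes, $\mathcal M\sqsubseteq_{\mathrm{must}}\mathcal N$ means: for every network $\mathcal T$ such that $\mathcal M\,\|\!\rangle\,\mathcal T$ and $\mathcal N\,\|\!\rangle\,\mathcal T$ are defined, every $p_2\in\mathrm{Results}(\mathcal N\,\|\!\rangle\,\mathcal T)$ has some $p_1\in\mathrm{Results}(\mathcal M\,\|\!\rangle\,\mathcal T)$ with $p_1\le p_2$. **Deadlock simulation.** A network is deadlocked if it is not successful and has no strong extensional $\tau$ and no strong extensional output. $\sqsubseteq_{DS}$ is the largest relation from networks to sub-distributions of networks such that $\mathcal M\sqsubseteq_{DS}\Theta$ implies: (i) if $\mathcal M$ is deadlocked, then $\Theta\stackrel{\tau}{\Longrightarrow}\Theta'$ for some $\Theta'$ all of whose support is deadlocked; (ii) whenever $\mathcal M\stackrel{\lambda}{\Longrightarrow}\Delta$ for an extensional action $\lambda$ and a sub-distribution $\Delta$, then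 $\Theta\stackrel{\lambda}{\Longrightarrow}\Theta'$ for some $\Theta'$ with $\Delta\,\overline{\sqsubseteq_{DS}}\,\Theta'$. **Theorem (Soundness for must-testing).** Let $\mathcal M,\mathcal N$ be finitary networks with $\mathrm{In}(\mathcal M)=\mathrm{In}(\mathcal N)$ and $\mathrm{Out}(\mathcal M)=\mathrm{Out}(\mathcal N)$, and suppose that no network reachable from $\mathcal M$ by strong extensional actions is successful (for instance because the success clause $\omega$, which is meant for tests, does not occur in the code of $\mathcal M$). If $\mathcal N\sqsubseteq_{DS}\overline{\mathcal M}$, then $\mathcal M\sqsubseteq_{\mathrm{must}}\mathcal N$. -/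

import Mathlib

open scoped ENNReal

universe u v

noncomputable section

/-! ## Sub-distributions -/

/-- A (probability) sub-distribution over `X`: a function with total mass at most `1`. -/
def SubDist (X : Type u) : Type u := {f : X → ℝ≥0∞ // ∑' x, f x ≤ 1}

namespace SubDist

variable {X : Type u} {Y : Type v}

instance : CoeFun (SubDist X) (fun _ => X → ℝ≥0∞) := ⟨Subtype.val⟩

/-- The support of a sub-distribution. -/
def support (Δ : SubDist X) : Set X := {x | Δ x ≠ 0}

open Classical in
/-- The point distribution at `x`. -/
def point (x : X) : SubDist X :=
  ⟨fun y => if y = x then 1 else 0, by rw [tsum_ite_eq]⟩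

/-- The finite weighted sum `∑ i, p i • Δ i`, for weights of total mass at most `1`. -/
def comb {n : ℕ} (p : Fin n → ℝ≥0∞) (hp : ∑ i, p i ≤ 1) (Δ : Fin n → SubDist X) : SubDist X :=
  ⟨fun x => ∑ i, p i * Δ i x, by
    rw [Summable.tsum_finsetSum (fun _ _ => ENNReal.summable)]
    calc ∑ i, ∑' x, p i * Δ i x = ∑ i, p i * ∑' x, Δ i x := by simp_rw [ENNReal.tsum_mul_left]
      _ ≤ ∑ i, p i * 1 := Finset.sum_le_sum fun i _ => mul_le_mul_right (Δ i).2 (p i)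
      _ ≤ 1 := by simpa using hp⟩

/-- The binary probabilistic choice `w • Δ + (1 - w) • Θ`. -/
def mix (w : unitInterval) (Δ Θ : SubDist X) : SubDist X :=
  comb ![ENNReal.ofReal w, ENNReal.ofReal (1 - w)]
    (by
      simp only [Fin.sum_univ_two, Matrix.cons_val_zero, Matrix.cons_val_one]
      rw [← ENNReal.ofReal_add w.2.1 (by linarith [w.2.2])]
      simp)
    ![Δ, Θ]

open Classical in
/-- The image `f(Δ)` of a sub-distribution: `f(Δ)(y) = ∑ {Δ x | f x = y}`. -/
def map (f : X → Y) (Δ : SubDist X) : SubDist Y :=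
  ⟨fun y => ∑' x, if f x = y then Δ x else 0, by
    rw [ENNReal.tsum_comm]
    simpa [tsum_ite_eq] using Δ.2⟩

open Classical in
/-- The image `f(Δ, Θ)` of two sub-distributions under a function of two arguments:
`f(Δ, Θ)(y) = ∑ {Δ x₁ * Θ x₂ | f x₁ x₂ = y}`. -/
def map₂ {Z : Type*} (f : X → Y → Z) (Δ : SubDist X) (Θ : SubDist Y) : SubDist Z :=
  ⟨fun z => ∑' x₁, ∑' x₂, if f x₁ x₂ = z then Δ x₁ * Θ x₂ else 0, by
    rw [ENNReal.tsum_comm]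
    have h : ∀ x₁, (∑' z, ∑' x₂, if f x₁ x₂ = z then Δ x₁ * Θ x₂ else 0) =
        Δ x₁ * ∑' x₂, Θ x₂ := by
      intro x₁
      rw [ENNReal.tsum_comm]
      simp [ENNReal.tsum_mul_left]
    simp_rw [h, ENNReal.tsum_mul_right]
    exact mul_le_one' Δ.2 Θ.2⟩

end SubDist

/-! ## Lifted relations, hyper-derivations and testing outcomes -/

/-- The lifting of a relation from states to sub-distributions to a relation between
sub-distributions. -/
inductive Lift {X : Type u} (R : X → SubDist X → Prop) : SubDist X → SubDist X → Prop
  | point {x : X} {Θ : SubDist X} : R x Θ → Lift R (SubDist.point x) Θ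
  | sum {n : ℕ} (p : Fin n → ℝ≥0∞) (hp : ∑ i, p i ≤ 1) (Δ Θ : Fin n → SubDist X) :
      (∀ i, Lift R (Δ i) (Θ i)) → Lift R (SubDist.comb p hp Δ) (SubDist.comb p hp Θ)

/-- The relation `xRᵉΘ` iff `Θ` is the point distribution of some `y` with `x R y`. -/
def pointRel {X : Type u} (R : X → X → Prop) (x : X) (Θ : SubDist X) : Prop :=
  ∃ y, Θ = SubDist.point y ∧ R x y

/-- Hyper-derivations `Δ ⟹ Δ'` for the reduction relation `red` and the success predicate
`succ`. Here `go k` is the part of the `k`-th stage that moves on, and `halt k` the part that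
stops there; no successful state may move on. -/
def HyperDer {X : Type u} (red : X → SubDist X → Prop) (succ : X → Prop)
    (Δ Δ' : SubDist X) : Prop :=
  ∃ go halt : ℕ → SubDist X,
    (∀ x, Δ x = go 0 x + halt 0 x) ∧
    (∀ k, ∃ Ξ : SubDist X, Lift red (go k) Ξ ∧ ∀ x, Ξ x = go (k + 1) x + halt (k + 1) x) ∧
    (∀ k, ∀ x ∈ (go k).support, ¬ succ x) ∧
    (∀ x, Δ' x = ∑' k, halt k x)

/-- Extreme derivatives: hyper-derivatives in which every state that can still reduce is
successful. -/
def ExtremeDer {X : Type u} (red : X → SubDist X → Prop) (succ : X → Prop)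
    (Δ Δ' : SubDist X) : Prop :=
  HyperDer red succ Δ Δ' ∧ ∀ x ∈ Δ'.support, (∃ Θ, red x Θ) → succ x

open Classical in
/-- The value of a sub-distribution: the probability of being in a successful state. -/
def val {X : Type u} (succ : X → Prop) (Δ : SubDist X) : ℝ≥0∞ :=
  ∑' x, if succ x then Δ x else 0

/-- The set of possible results: the values of the extreme derivatives. -/
def results {X : Type u} (red : X → SubDist X → Prop) (succ : X → Prop) (Δ : SubDist X) :
    Set ℝ≥0∞ :=
  {p | ∃ Δ', ExtremeDer red succ Δ Δ' ∧ p = val succ Δ'}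

/-- The Smyth preorder on sets of outcomes. -/
def SmythLe (O₁ O₂ : Set ℝ≥0∞) : Prop :=
  ∀ p₂ ∈ O₂, ∃ p₁ ∈ O₁, p₁ ≤ p₂

/-! ## The calculus: terms -/

/-- The parameters of the calculus: node names, channels, data values, and names of process
definitions together with their numbers of arguments. -/
structure Signature where
  Node : Type u
  Chan : Type u
  Val : Type u
  Ident : Type u
  arity : Ident → ℕ

/-- An assignment of values to `n` variables. -/
abbrev Env (S : Signature.{u}) (n : ℕ) : Type u := Fin n → S.Val

/-- Data expressions in `n` variables, given by their evaluation function. -/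
abbrev Expr (S : Signature.{u}) (n : ℕ) : Type u := Env S n → S.Val

/-- Boolean expressions in `n` variables, given by their evaluation function. -/
abbrev BExpr (S : Signature.{u}) (n : ℕ) : Type u := Env S n → Bool

mutual

/-- Probabilistic processes with free variables among `n` variables (de Bruijn indices, so terms
are identified up to alpha-conversion). -/
inductive Proc (S : Signature.{u}) : ℕ → Type u
  | state {n : ℕ} (s : State S n) : Proc S n
  | choice {n : ℕ} (w : unitInterval) (p q : Proc S n) : Proc S n

/-- States with free variables among `n` variables. In `recv c p` the received value is
variable `0` of `p`. -/
inductive State (S : Signature.{u}) : ℕ → Type u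
  | bcast {n : ℕ} (c : S.Chan) (e : Expr S n) (p : Proc S n) : State S n
  | recv {n : ℕ} (c : S.Chan) (p : Proc S (n + 1)) : State S n
  | omega {n : ℕ} : State S n
  | sum {n : ℕ} (s t : State S n) : State S n
  | ite {n : ℕ} (b : BExpr S n) (s t : State S n) : State S n
  | tau {n : ℕ} (p : Proc S n) : State S n
  | call {n : ℕ} (A : S.Ident) (args : Fin (S.arity A) → Expr S n) : State S n
  | nil {n : ℕ} : State S n

end

/-- Extension of a substitution under one binder. -/
def liftSubst {S : Signature.{u}} {m n : ℕ} (σ : Env S m → Env S n) :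
    Env S (m + 1) → Env S (n + 1) :=
  fun ρ => Fin.cons (ρ 0) (σ (Fin.tail ρ))

mutual

/-- Simultaneous substitution of expressions in `m` variables for the `n` free variables; the
tuple of `n` expressions is given as the function `σ : Env S m → Env S n`. -/
def Proc.subst {S : Signature.{u}} : {m n : ℕ} → (Env S m → Env S n) → Proc S n → Proc S m
  | _, _, σ, .state s => .state (s.subst σ)
  | _, _, σ, .choice w p q => .choice w (p.subst σ) (q.subst σ)

/-- Simultaneous substitution in states. -/
def State.subst {S : Signature.{u}} : {m n : ℕ} → (Env S m → Env S n) → State S n → State S m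
  | _, _, σ, .bcast c e p => .bcast c (fun ρ => e (σ ρ)) (p.subst σ)
  | _, _, σ, .recv c p => .recv c (p.subst (liftSubst σ))
  | _, _, _, .omega => .omega
  | _, _, σ, .sum s t => .sum (s.subst σ) (t.subst σ)
  | _, _, σ, .ite b s t => .ite (fun ρ => b (σ ρ)) (s.subst σ) (t.subst σ)
  | _, _, σ, .tau p => .tau (p.subst σ)
  | _, _, σ, .call A args => .call A (fun i ρ => args i (σ ρ))
  | _, _, _, .nil => .nil

end

/-- A family of process definitions `A(x₁, …, xₖ) ⇐ s`, where `k` is the arity of `A`. -/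
abbrev Defns (S : Signature.{u}) : Type u := (A : S.Ident) → State S (S.arity A)

/-- The process `p{v/x}`. -/
def Proc.inst {S : Signature.{u}} (p : Proc S 1) (v : S.Val) : Proc S 0 :=
  p.subst (fun ρ => Fin.cons v ρ)

/-- The state `s{e₁/x₁, …, eₖ/xₖ}` for the definition `A(x₁, …, xₖ) ⇐ s`. -/
def unfoldCall {S : Signature.{u}} (D : Defns S) (A : S.Ident)
    (args : Fin (S.arity A) → Expr S 0) : State S 0 :=
  (D A).subst (fun ρ i => args i ρ)

/-- The value of a closed expression. -/
def evalClosed {S : Signature.{u}} {α : Type*} (e : Env S 0 → α) : α := e Fin.elim0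

/-- The interpretation of a process as a distribution of states. -/
def Proc.interp {S : Signature.{u}} : {n : ℕ} → Proc S n → SubDist (State S n)
  | _, .state s => SubDist.point s
  | _, .choice w p q => SubDist.mix w p.interp q.interp

/-- System terms: parallel compositions of nodes running closed states. -/
inductive Sys (S : Signature.{u}) : Type u
  | node (s : State S 0) (n : S.Node) : Sys S
  | par (M N : Sys S) : Sys S
  | nil : Sys S

namespace Sys

variable {S : Signature.{u}}

/-- The node names occurring in a system term. -/
def nodes : Sys S → Set S.Node
  | .node _ n => {n}
  | .par M N => M.nodes ∪ N.nodes
  | .nil => ∅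

/-- Well-formed system terms: every node name occurs at most once. -/
def WellFormed : Sys S → Prop
  | .node _ _ => True
  | .par M N => M.WellFormed ∧ N.WellFormed ∧ Disjoint M.nodes N.nodes
  | .nil => True

end Sys

/-! ## Structural congruence and success -/

/-- Structural congruence of closed states. -/
inductive StateEquiv {S : Signature.{u}} (D : Defns S) : State S 0 → State S 0 → Prop
  | refl (s) : StateEquiv D s s
  | symm {s t} : StateEquiv D s t → StateEquiv D t s
  | trans {s t r} : StateEquiv D s t → StateEquiv D t r → StateEquiv D s r
  | sum_congr {s s' t t'} :
      StateEquiv D s s' → StateEquiv D t t' → StateEquiv D (.sum s t) (.sum s' t')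
  | sum_comm (s t) : StateEquiv D (.sum s t) (.sum t s)
  | sum_assoc (s t r) : StateEquiv D (.sum (.sum s t) r) (.sum s (.sum t r))
  | sum_nil (s) : StateEquiv D (.sum s .nil) s
  | ite_true {b} (s t) : evalClosed b = true → StateEquiv D (.ite b s t) s
  | ite_false {b} (s t) : evalClosed b = false → StateEquiv D (.ite b s t) t
  | call (A args) : StateEquiv D (.call A args) (unfoldCall D A args)

/-- Structural congruence of system terms. -/
inductive SysEquiv {S : Signature.{u}} (D : Defns S) : Sys S → Sys S → Prop
  | refl (M) : SysEquiv D M M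
  | symm {M N} : SysEquiv D M N → SysEquiv D N M
  | trans {M N L} : SysEquiv D M N → SysEquiv D N L → SysEquiv D M L
  | par_congr {M M' N N'} :
      SysEquiv D M M' → SysEquiv D N N' → SysEquiv D (.par M N) (.par M' N')
  | par_comm (M N) : SysEquiv D (.par M N) (.par N M)
  | par_assoc (M N L) : SysEquiv D (.par (.par M N) L) (.par M (.par N L))
  | par_nil (M) : SysEquiv D (.par M .nil) M
  | node {s t} (n) : StateEquiv D s t → SysEquiv D (.node s n) (.node t n)

/-- `M` is successful: the success clause `ω` is enabled at one of its nodes. -/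
def Sys.Success {S : Signature.{u}} (D : Defns S) (M : Sys S) : Prop :=
  ∃ (M' : Sys S) (s : State S 0) (n : S.Node), SysEquiv D M (.par M' (.node (.sum .omega s) n))

/-! ## Intensional semantics -/

/-- Actions of states. -/
inductive StateAct (S : Signature.{u}) : Type u
  | send (c : S.Chan) (v : S.Val) : StateAct S
  | recv (c : S.Chan) (v : S.Val) : StateAct S
  | tau : StateAct S

/-- The pre-semantics of states. -/
inductive StateStep {S : Signature.{u}} (D : Defns S) :
    State S 0 → StateAct S → SubDist (State S 0) → Prop
  | snd (c e p) : StateStep D (.bcast c e p) (.send c (evalClosed e)) p.interp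
  | rcv (c p v) : StateStep D (.recv c p) (.recv c v) (p.inst v).interp
  | tau (p) : StateStep D (.tau p) .tau p.interp
  | suml {s α Δ} (t) : StateStep D s α Δ → StateStep D (.sum s t) α Δ
  | sumr {t α Δ} (s) : StateStep D t α Δ → StateStep D (.sum s t) α Δ
  | then {b s α Δ} (t) : evalClosed b = true → StateStep D s α Δ → StateStep D (.ite b s t) α Δ
  | else {b t α Δ} (s) : evalClosed b = false → StateStep D t α Δ → StateStep D (.ite b s t) α Δ
  | call {A args α Δ} : StateStep D (unfoldCall D A args) α Δ → StateStep D (.call A args) α Δ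

/-- Connectivity graphs: a finite set of nodes with an irreflexive connection relation;
`E m n` means that `n` can detect the broadcasts of `m`. -/
structure ConnGraph (S : Signature.{u}) : Type u where
  V : Set S.Node
  E : S.Node → S.Node → Prop
  finite : V.Finite
  left_mem : ∀ m n, E m n → m ∈ V
  right_mem : ∀ m n, E m n → n ∈ V
  irrefl : ∀ m, ¬ E m m

/-- The union of two connectivity graphs. -/
def ConnGraph.union {S : Signature.{u}} (G H : ConnGraph S) : ConnGraph S where
  V := G.V ∪ H.V
  E m n := G.E m n ∨ H.E m n
  finite := G.finite.union H.finite
  left_mem m n h := h.imp (G.left_mem m n) (H.left_mem m n)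
  right_mem m n h := h.imp (G.right_mem m n) (H.right_mem m n)
  irrefl m h := h.elim (G.irrefl m) (H.irrefl m)

/-- Intensional actions: `m.c?v`, `m.c!v` and `m.τ`. -/
inductive SysAct (S : Signature.{u}) : Type u
  | recv (m : S.Node) (c : S.Chan) (v : S.Val) : SysAct S
  | send (m : S.Node) (c : S.Chan) (v : S.Val) : SysAct S
  | tau (m : S.Node) : SysAct S

/-- The intensional semantics of systems relative to a connectivity graph. -/
inductive SysStep {S : Signature.{u}} (D : Defns S) (G : ConnGraph S) :
    Sys S → SysAct S → SubDist (Sys S) → Prop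
  | broad {s c v Δ} (n) : StateStep D s (.send c v) Δ →
      SysStep D G (.node s n) (.send n c v) (Δ.map fun t => .node t n)
  | recv {s c v Δ m n} : G.E m n → StateStep D s (.recv c v) Δ →
      SysStep D G (.node s n) (.recv m c v) (Δ.map fun t => .node t n)
  | deaf {s c v} (m n) : (¬ ∃ Δ, StateStep D s (.recv c v) Δ) →
      SysStep D G (.node s n) (.recv m c v) (SubDist.point (.node s n))
  | disc {m n} (s c v) : ¬ G.E m n →
      SysStep D G (.node s n) (.recv m c v) (SubDist.point (.node s n))
  | nil (m c v) : SysStep D G .nil (.recv m c v) (SubDist.point .nil)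
  | tau {s Δ} (n) : StateStep D s .tau Δ →
      SysStep D G (.node s n) (.tau n) (Δ.map fun t => .node t n)
  | tau_left {M Δ n} (N) : SysStep D G M (.tau n) Δ →
      SysStep D G (.par M N) (.tau n) (SubDist.map₂ .par Δ (SubDist.point N))
  | tau_right {N Θ n} (M) : SysStep D G N (.tau n) Θ →
      SysStep D G (.par M N) (.tau n) (SubDist.map₂ .par (SubDist.point M) Θ)
  | prop {M N m c v Δ Θ} : SysStep D G M (.recv m c v) Δ → SysStep D G N (.recv m c v) Θ →
      SysStep D G (.par M N) (.recv m c v) (SubDist.map₂ .par Δ Θ)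
  | sync_left {M N m c v Δ Θ} : SysStep D G M (.send m c v) Δ → SysStep D G N (.recv m c v) Θ →
      SysStep D G (.par M N) (.send m c v) (SubDist.map₂ .par Δ Θ)
  | sync_right {M N m c v Δ Θ} : SysStep D G M (.recv m c v) Δ → SysStep D G N (.send m c v) Θ →
      SysStep D G (.par M N) (.send m c v) (SubDist.map₂ .par Δ Θ)

/-! ## Networks -/

/-- A network: a system term placed on a connectivity graph. -/
structure Network (S : Signature.{u}) : Type u where
  graph : ConnGraph S
  sys : Sys S

/-- The distribution `Γ ▷ Δ` of networks, for a distribution `Δ` of system terms. -/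
def ConnGraph.place {S : Signature.{u}} (G : ConnGraph S) (Δ : SubDist (Sys S)) :
    SubDist (Network S) :=
  Δ.map fun M => ⟨G, M⟩

namespace Network

variable {S : Signature.{u}}

/-- The internal nodes of a network, those running code. -/
def nodes (M : Network S) : Set S.Node := M.sys.nodes

/-- The interface of a network: its external nodes. -/
def interface (M : Network S) : Set S.Node := M.graph.V \ M.nodes

/-- The input nodes: external nodes whose broadcasts are detected by some node. -/
def inputs (M : Network S) : Set S.Node := {i | i ∈ M.interface ∧ ∃ m, M.graph.E i m}

/-- The output nodes: external nodes that detect the broadcasts of some node. -/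
def outputs (M : Network S) : Set S.Node := {o | o ∈ M.interface ∧ ∃ m, M.graph.E m o}

/-- Well-formed networks: the system term is well-formed and runs on nodes of the graph, there
are no connections between external nodes, and every unconnected node is internal. -/
def WellFormed (M : Network S) : Prop :=
  M.sys.WellFormed ∧ M.nodes ⊆ M.graph.V ∧
  (∀ m n, M.graph.E m n → m ∈ M.nodes ∨ n ∈ M.nodes) ∧
  (∀ m ∈ M.graph.V, (∀ n ∈ M.graph.V, ¬ M.graph.E m n ∧ ¬ M.graph.E n m) → m ∈ M.nodes)

/-- A network is successful when its system term is. -/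
def Success (D : Defns S) (M : Network S) : Prop := M.sys.Success D

/-- Structural congruence of networks. -/
def Equiv (D : Defns S) (M N : Network S) : Prop := M.graph = N.graph ∧ SysEquiv D M.sys N.sys

/-- The composition of the network `M` with the testing network `T` is defined. -/
def Composable (M T : Network S) : Prop := M.nodes ∩ T.graph.V = ∅

/-- The composition of two networks. -/
def compose (M T : Network S) : Network S := ⟨M.graph.union T.graph, .par M.sys T.sys⟩

/-- The reduction relation: internal moves and broadcasts. -/
def Red (D : Defns S) (M : Network S) (Δ : SubDist (Network S)) : Prop :=
  ∃ Δ₀, Δ = M.graph.place Δ₀ ∧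
    ((∃ m ∈ M.nodes, SysStep D M.graph M.sys (.tau m) Δ₀) ∨
      ∃ m c v, SysStep D M.graph M.sys (.send m c v) Δ₀)

/-- The possible results of running the network `M`. -/
def outcomes (D : Defns S) (M : Network S) : Set ℝ≥0∞ :=
  results (Red D) (Success D) (SubDist.point M)

/-- The must-testing preorder between well-formed networks with the same input and output
nodes. -/
def MustLe (D : Defns S) (M N : Network S) : Prop :=
  M.inputs = N.inputs ∧ M.outputs = N.outputs ∧
  ∀ T : Network S, T.WellFormed → M.Composable T → N.Composable T →
    SmythLe ((M.compose T).outcomes D) ((N.compose T).outcomes D)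

end Network

/-! ## Extensional semantics -/

/-- Extensional actions: `τ`, `n.c?v` and `c!v ▷ η`. -/
inductive ExtAct (S : Signature.{u}) : Type u
  | tau : ExtAct S
  | input (n : S.Node) (c : S.Chan) (v : S.Val) : ExtAct S
  | output (c : S.Chan) (v : S.Val) (η : Set S.Node) : ExtAct S

namespace Network

variable {S : Signature.{u}}

/-- Strong extensional actions; they are performed only by networks that are not successful. -/
def ExtStep (D : Defns S) (M : Network S) : ExtAct S → SubDist (Network S) → Prop
  | .tau, Δ => ¬ M.Success D ∧ ∃ Δ₀, Δ = M.graph.place Δ₀ ∧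
      ((∃ m, SysStep D M.graph M.sys (.tau m) Δ₀) ∨
        ∃ n c v, SysStep D M.graph M.sys (.send n c v) Δ₀ ∧
          ∀ m, M.graph.E n m → m ∈ M.nodes)
  | .input n c v, Δ => ¬ M.Success D ∧ ∃ Δ₀, Δ = M.graph.place Δ₀ ∧
      SysStep D M.graph M.sys (.recv n c v) Δ₀ ∧ n ∈ M.inputs
  | .output c v η, Δ => ¬ M.Success D ∧ ∃ Δ₀, Δ = M.graph.place Δ₀ ∧
      ∃ m, SysStep D M.graph M.sys (.send m c v) Δ₀ ∧
        η = {o | o ∈ M.outputs ∧ M.graph.E m o} ∧ η.Nonempty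

/-- Hyper-derivations in the extensional semantics. -/
def ExtHyper (D : Defns S) : SubDist (Network S) → SubDist (Network S) → Prop :=
  HyperDer (fun M Δ => M.ExtStep D .tau Δ) (Success D)

/-- `Δ ⟹ (strong l) ⟹ Δ'`, for the extensional action `l`. -/
def ExtAround (D : Defns S) (l : ExtAct S) (Δ Δ' : SubDist (Network S)) : Prop :=
  ∃ Δ₁ Δ₂, ExtHyper D Δ Δ₁ ∧ Lift (fun M Θ => M.ExtStep D l Θ) Δ₁ Δ₂ ∧ ExtHyper D Δ₂ Δ'

/-- Weak output actions of networks: the least family of relations, indexed by the set of target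
nodes, that contains `⟹ (strong output) ⟹` and is closed under sequencing of outputs of the same
value on the same channel with disjoint sets of targets. -/
def WeakOutput (D : Defns S) (c : S.Chan) (v : S.Val) (η : Set S.Node) (M : Network S)
    (Δ : SubDist (Network S)) : Prop :=
  ∀ W : Set S.Node → Network S → SubDist (Network S) → Prop,
    (∀ η M Δ, ExtAround D (.output c v η) (SubDist.point M) Δ → W η M Δ) →
    (∀ η₁ η₂ M Δ' Δ, W η₁ M Δ' → Lift (W η₂) Δ' Δ → η₁ ∩ η₂ = ∅ → W (η₁ ∪ η₂) M Δ) →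
    W η M Δ

/-- Weak extensional actions of networks. -/
def Weak (D : Defns S) : ExtAct S → Network S → SubDist (Network S) → Prop
  | .tau, M, Δ => ExtHyper D (SubDist.point M) Δ
  | .input n c v, M, Δ => ExtAround D (.input n c v) (SubDist.point M) Δ
  | .output c v η, M, Δ => WeakOutput D c v η M Δ

/-- Weak extensional actions of sub-distributions of networks. -/
def WeakDist (D : Defns S) : ExtAct S → SubDist (Network S) → SubDist (Network S) → Prop
  | .tau, Θ, Θ' => ExtHyper D Θ Θ'
  | .input n c v, Θ, Θ' => ExtAround D (.input n c v) Θ Θ'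
  | .output c v η, Θ, Θ' => Lift (WeakOutput D c v η) Θ Θ'

/-- `N` is reachable from `M` by extensional actions. -/
def Reachable (D : Defns S) (M N : Network S) : Prop :=
  Relation.ReflTransGen (fun A B => ∃ l Δ, A.ExtStep D l Δ ∧ B ∈ Δ.support) M N

/-- Structural congruence of sub-distributions of networks. -/
def DistEquiv (D : Defns S) : SubDist (Network S) → SubDist (Network S) → Prop :=
  Lift (pointRel (Equiv D))

/-- Finitary networks: up to structural congruence, finitely many networks are reachable, and
each of them has finitely many extensional derivatives. -/
def Finitary (D : Defns S) (M : Network S) : Prop :=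
  (∃ F : Set (Network S), F.Finite ∧ ∀ N, M.Reachable D N → ∃ N' ∈ F, N.Equiv D N') ∧
  ∀ N, M.Reachable D N → ∃ F : Set (SubDist (Network S)), F.Finite ∧
    ∀ l Δ, N.ExtStep D l Δ → ∃ Δ' ∈ F, DistEquiv D Δ Δ'

/-- No network reachable from `M` is successful. -/
def NeverSuccessful (D : Defns S) (M : Network S) : Prop :=
  ∀ N, M.Reachable D N → ¬ N.Success D

/-- Deadlocked networks. -/
def Deadlocked (D : Defns S) (M : Network S) : Prop :=
  ¬ M.Success D ∧ (¬ ∃ Δ, M.ExtStep D .tau Δ) ∧ ∀ c v η, ¬ ∃ Δ, M.ExtStep D (.output c v η) Δ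

/-- The defining conditions of deadlock simulations, for a relation between well-formed networks
and sub-distributions of well-formed networks. -/
def IsDeadlockSim (D : Defns S) (R : Network S → SubDist (Network S) → Prop) : Prop :=
  ∀ M Θ, R M Θ →
    (M.WellFormed ∧ ∀ N ∈ Θ.support, N.WellFormed) ∧
    (M.Deadlocked D → ∃ Θ', WeakDist D .tau Θ Θ' ∧ ∀ N ∈ Θ'.support, N.Deadlocked D) ∧
    (∀ l Δ, M.Weak D l Δ → ∃ Θ', WeakDist D l Θ Θ' ∧ Lift R Δ Θ')

/-- The deadlock simulation: the largest relation that satisfies the defining conditions. -/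
def DeadlockSim (D : Defns S) (M : Network S) (Θ : SubDist (Network S)) : Prop :=
  ∃ R, IsDeadlockSim D R ∧ R M Θ

end Network

end

noncomputable section

/-! ## Averages and integrals in `ℝ≥0∞` -/

-- Fix a test `T` and a result `p` of `N` running with `T`. Results are compared through prices: a
-- run may end anywhere at price 1, it ends for free at an unsuccessful state without reductions,
-- and divergence is free. `Secures x w` says that some complete run from `x` has expected price at
-- most `w`. Every result is a secured price (`secures_of_mem_outcomes`), and below every secured
-- price there is a result (`exists_outcome_le_of_secures`). Hence it is enough that `M` running
-- with `T` secures `p`.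
--
-- Prices are treated coinductively, state by state (`Attains`), instead of through infinite
-- sequences of sub-distributions. The passage between the two views rests on averaging
-- (`exists_le_average`): where a hyper-derivation randomizes, or treats one state in several ways,
-- some single way costs at most the average.
--
-- An obligation is a network `n` simulated by a sub-distribution `Θ`, a test state `t`, and a price
-- `w` secured by `n` with `t`; it is met when `Θ` with `t` can be run at the price `w`. Cut the
-- secured run before the first reduction in which the test takes part. The moves of `n` up to there
-- form one hyper-derivation (`exists_silent_hyperDer`), which `Θ` matches by one weak internal
-- move; mass that `n` loses by divergence is lost by `Θ` too, free of charge. At each end of this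
-- derivation either price 1 is paid, or the composition is stuck and clause (i) of the simulation
-- applies, or network and test communicate and clause (ii) applies, or the test moves unheard and
-- `Θ` just lets it move, which is possible because no state reachable from `M` is successful. What
-- remains are new obligations whose prices fit into `w` (`Obligation.reduces`).
--
-- Every such round contains a reduction or ends by paying, so infinitely many rounds concatenate to
-- a genuine run (`secures_of_reduces`).
--
-- The delicate case is a weak output that consists of several broadcasts to disjoint sets of
-- listeners, so that the test hears the value in instalments. Reception is local to each node and
-- therefore splits (`Hears.split`). If an instalment already makes the test successful, the run
-- must stop there at price 1; but such a success survives the later instalments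
-- (`Hears.success_of_success`), so the single broadcast of `n` leads to success as well and its
-- price covers this.

theorem exists_le_average {ι : Type*} (a v : ι → ℝ≥0∞) (h0 : ∑' i, a i ≠ 0)
    (ht : ∑' i, a i ≠ ⊤) : ∃ i, a i ≠ 0 ∧ v i * ∑' i, a i ≤ ∑' i, a i * v i := by
  by_contra hcon
  push Not at hcon
  obtain ⟨i₀, hi₀⟩ : ∃ i, a i ≠ 0 := by
    by_contra h
    push Not at h
    exact h0 (by simp [h])
  set s := ∑' i, a i with hs
  set t := ∑' i, a i * v i with htdef
  -- If every value of positive weight exceeded the average `t / s`, summing would make the average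
  -- exceed itself; strictness at `i₀` needs `t` finite.
  have hlt : ∀ i, a i ≠ 0 → t / s < v i := fun i hi =>
    (ENNReal.div_lt_iff (Or.inl h0) (Or.inl ht)).2 (hcon i hi)
  have hle : ∀ i, a i * (t / s) ≤ a i * v i := by
    intro i
    by_cases hi : a i = 0
    · simp [hi]
    · exact mul_le_mul_right (hlt i hi).le _
  have hsum : ∑' i, a i * (t / s) = t := by
    rw [ENNReal.tsum_mul_right, ← hs, ENNReal.mul_div_cancel h0 ht]
  have htop : t ≠ ⊤ := by
    intro h
    have := hlt i₀ hi₀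
    rw [h, ENNReal.top_div_of_ne_top ht] at this
    exact not_top_lt this
  have hai : a i₀ ≠ ⊤ := ENNReal.ne_top_of_tsum_ne_top ht i₀
  have := ENNReal.tsum_lt_tsum (i := i₀) (by rw [hsum]; exact htop) hle
    ((ENNReal.mul_lt_mul_iff_right hi₀ hai).2 (hlt i₀ hi₀))
  rw [hsum] at this
  exact lt_irrefl _ this

/-- For a state that halts with probability `r` and moves on with probability `s`: doing only one of
the two is no dearer than the mixture. -/
theorem le_or_le_of_weights {r s a b w : ℝ≥0∞} (hrs : r + s = 1) (h : r * a + s * b ≤ w) :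
    (r ≠ 0 ∧ a ≤ w) ∨ (s ≠ 0 ∧ b ≤ w) := by
  have e : ∀ f : Bool → ℝ≥0∞, ∑' i, f i = f false + f true := fun f => by
    rw [tsum_fintype, Fintype.sum_bool, add_comm]
  obtain ⟨i, hi, hle⟩ := exists_le_average (fun i : Bool => cond i s r) (fun i => cond i b a)
    (by rw [e]; simp [hrs]) (by rw [e]; simp [hrs])
  rw [e, e] at hle
  simp only [cond_false, cond_true, hrs, mul_one] at hle
  cases i
  · exact Or.inl ⟨hi, hle.trans h⟩
  · exact Or.inr ⟨hi, hle.trans h⟩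

/-- Here `e n` is what is available before stage `n` and `h n` is what is spent at that stage. -/
theorem tsum_le_of_telescoping {h e : ℕ → ℝ≥0∞} (H : ∀ n, h n + e (n + 1) ≤ e n) :
    ∑' n, h n ≤ e 0 := by
  refine ENNReal.tsum_le_of_sum_range_le fun n => ?_
  have : ∀ n, ∑ i ∈ Finset.range n, h i + e n ≤ e 0 := by
    intro n
    induction n with
    | zero => simp
    | succ n ih =>
      rw [Finset.sum_range_succ, add_assoc]
      exact (add_le_add le_rfl (H n)).trans ih
  exact le_self_add.trans (this n)

open Classical in
theorem tsum_ite_mul {X : Type*} (a : X) (g : X → ℝ≥0∞) :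
    ∑' x, (if x = a then 1 else 0) * g x = g a := by
  simp [ite_mul, tsum_ite_eq]

-- Integration against sub-distributions

namespace SubDist

variable {X : Type u} {Y : Type v}

theorem tsum_ne_top (Δ : SubDist X) : ∑' x, Δ x ≠ ⊤ := ne_top_of_le_ne_top ENNReal.one_ne_top Δ.2

theorem ne_top (Δ : SubDist X) (x : X) : Δ x ≠ ⊤ := ENNReal.ne_top_of_tsum_ne_top Δ.tsum_ne_top x

theorem ext_apply {Δ Θ : SubDist X} (h : ∀ x, Δ x = Θ x) : Δ = Θ := Subtype.ext (funext h)

/-- Testing against all functions turns identities between images, products and averages into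
interchanges of sums. -/
theorem ext_tsum {Δ Θ : SubDist X} (h : ∀ g : X → ℝ≥0∞, ∑' x, Δ x * g x = ∑' x, Θ x * g x) :
    Δ = Θ := by
  classical
  refine ext_apply fun x => ?_
  have := h fun y => if y = x then 1 else 0
  simpa [mul_ite, tsum_ite_eq] using this

theorem tsum_point (x : X) (g : X → ℝ≥0∞) : ∑' y, point x y * g y = g x :=
  tsum_ite_mul x g

theorem tsum_map (f : X → Y) (Δ : SubDist X) (g : Y → ℝ≥0∞) :
    ∑' y, Δ.map f y * g y = ∑' x, Δ x * g (f x) := by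
  classical
  have h : ∀ y, Δ.map f y * g y = ∑' x, if f x = y then Δ x * g y else 0 := by
    intro y
    change (∑' x, if f x = y then Δ x else 0) * g y = _
    rw [← ENNReal.tsum_mul_right]
    simp [ite_mul]
  simp_rw [h]
  rw [ENNReal.tsum_comm]
  refine tsum_congr fun x => ?_
  simp_rw [eq_comm (a := f x)]
  rw [tsum_ite_eq]

theorem tsum_map₂ {Z : Type*} (f : X → Y → Z) (Δ : SubDist X) (Θ : SubDist Y) (g : Z → ℝ≥0∞) :
    ∑' z, map₂ f Δ Θ z * g z = ∑' x, ∑' y, Δ x * Θ y * g (f x y) := by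
  classical
  have h : ∀ z, map₂ f Δ Θ z * g z =
      ∑' x, ∑' y, if f x y = z then Δ x * Θ y * g z else 0 := by
    intro z
    change (∑' x, ∑' y, if f x y = z then Δ x * Θ y else 0) * g z = _
    simp_rw [← ENNReal.tsum_mul_right, ite_mul, zero_mul]
  simp_rw [h]
  rw [ENNReal.tsum_comm]
  refine tsum_congr fun x => ?_
  rw [ENNReal.tsum_comm]
  refine tsum_congr fun y => ?_
  simp_rw [eq_comm (a := f x y)]
  rw [tsum_ite_eq]

theorem tsum_comb {n : ℕ} (p : Fin n → ℝ≥0∞) (hp : ∑ i, p i ≤ 1) (Δ : Fin n → SubDist X)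
    (g : X → ℝ≥0∞) : ∑' x, comb p hp Δ x * g x = ∑ i, p i * ∑' x, Δ i x * g x := by
  change ∑' x, (∑ i, p i * Δ i x) * g x = _
  simp_rw [Finset.sum_mul, ← ENNReal.tsum_mul_left]
  rw [Summable.tsum_finsetSum (fun _ _ => ENNReal.summable)]
  simp_rw [mul_assoc]

theorem tsum_map_mass (f : X → Y) (Δ : SubDist X) : ∑' y, Δ.map f y = ∑' x, Δ x := by
  simpa using tsum_map f Δ fun _ => 1

theorem tsum_map₂_mass {Z : Type*} (f : X → Y → Z) (Δ : SubDist X) (Θ : SubDist Y) :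
    ∑' z, map₂ f Δ Θ z = (∑' x, Δ x) * ∑' y, Θ y := by
  have := tsum_map₂ f Δ Θ fun _ => 1
  simp only [mul_one, ENNReal.tsum_mul_left, ENNReal.tsum_mul_right] at this
  exact this

theorem tsum_point_mass (x : X) : ∑' y, point x y = 1 := by
  simpa using tsum_point x fun _ => 1

theorem point_ne_zero {x y : X} : point x y ≠ 0 ↔ y = x := by
  classical
  change (if y = x then (1 : ℝ≥0∞) else 0) ≠ 0 ↔ _
  split_ifs <;> simp_all

theorem map_ne_zero {f : X → Y} {Δ : SubDist X} {y : Y} :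
    Δ.map f y ≠ 0 ↔ ∃ x, Δ x ≠ 0 ∧ f x = y := by
  classical
  change (∑' x, if f x = y then Δ x else 0) ≠ 0 ↔ _
  simp only [ne_eq, ENNReal.tsum_eq_zero, ite_eq_right_iff, not_forall, exists_prop, and_comm]

theorem map₂_ne_zero {Z : Type*} {f : X → Y → Z} {Δ : SubDist X} {Θ : SubDist Y} {z : Z} :
    map₂ f Δ Θ z ≠ 0 ↔ ∃ x y, Δ x ≠ 0 ∧ Θ y ≠ 0 ∧ f x y = z := by
  classical
  change (∑' x, ∑' y, if f x y = z then Δ x * Θ y else 0) ≠ 0 ↔ _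
  simp only [ne_eq, ENNReal.tsum_eq_zero, ite_eq_right_iff, not_forall, exists_prop, mul_eq_zero,
    not_or]
  exact ⟨fun ⟨x, y, h, h1, h2⟩ => ⟨x, y, h1, h2, h⟩, fun ⟨x, y, h1, h2, h⟩ => ⟨x, y, h, h1, h2⟩⟩

theorem map_point (f : X → Y) (x : X) : (point x).map f = point (f x) :=
  ext_tsum fun g => by rw [tsum_map, tsum_point, tsum_point]

theorem map₂_point_left {Z : Type*} (f : X → Y → Z) (x : X) (Θ : SubDist Y) :
    map₂ f (point x) Θ = Θ.map (f x) :=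
  ext_tsum fun g => by
    rw [tsum_map₂, tsum_map]
    simp_rw [mul_assoc, ENNReal.tsum_mul_left]
    exact tsum_point x _

theorem map₂_point_right {Z : Type*} (f : X → Y → Z) (Δ : SubDist X) (y : Y) :
    map₂ f Δ (point y) = Δ.map (f · y) :=
  ext_tsum fun g => by
    rw [tsum_map₂, tsum_map]
    simp_rw [mul_assoc, ENNReal.tsum_mul_left]
    exact tsum_congr fun x => congrArg _ (tsum_point y _)

theorem support_map_finite {f : X → Y} {Δ : SubDist X} (h : Δ.support.Finite) :
    (Δ.map f).support.Finite :=
  (h.image f).subset fun _ hy => by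
    obtain ⟨x, hx, rfl⟩ := map_ne_zero.1 hy
    exact ⟨x, hx, rfl⟩

theorem support_map₂_finite {Z : Type*} {f : X → Y → Z} {Δ : SubDist X} {Θ : SubDist Y}
    (h : Δ.support.Finite) (h' : Θ.support.Finite) : (map₂ f Δ Θ).support.Finite :=
  (h.image2 f h').subset fun _ hz => by
    obtain ⟨x, y, hx, hy, rfl⟩ := map₂_ne_zero.1 hz
    exact ⟨x, hx, y, hy, rfl⟩

theorem support_point_finite (x : X) : (point x).support.Finite :=
  (Set.finite_singleton x).subset fun _ hy => point_ne_zero.1 hy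

theorem comb_ne_zero {n : ℕ} {p : Fin n → ℝ≥0∞} {hp : ∑ i, p i ≤ 1} {Δ : Fin n → SubDist X}
    {x : X} : comb p hp Δ x ≠ 0 ↔ ∃ i, p i ≠ 0 ∧ Δ i x ≠ 0 := by
  change (∑ i, p i * Δ i x) ≠ 0 ↔ _
  simp [Finset.sum_eq_zero_iff]

theorem support_comb_finite {n : ℕ} {p : Fin n → ℝ≥0∞} {hp : ∑ i, p i ≤ 1}
    {Δ : Fin n → SubDist X} (h : ∀ i, (Δ i).support.Finite) : (comb p hp Δ).support.Finite :=
  (Set.finite_iUnion h).subset fun _ hx => by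
    obtain ⟨i, -, hi⟩ := comb_ne_zero.1 hx
    exact Set.mem_iUnion.2 ⟨i, hi⟩

/-- The average of the sub-distributions `Ξ x`, weighted by `Δ`. -/
def bind (Δ : SubDist X) (Ξ : X → SubDist Y) : SubDist Y :=
  ⟨fun y => ∑' x, Δ x * Ξ x y, by
    rw [ENNReal.tsum_comm]
    simp_rw [ENNReal.tsum_mul_left]
    exact (ENNReal.tsum_le_tsum fun x => mul_le_of_le_one_right' (Ξ x).2).trans Δ.2⟩

theorem bind_apply (Δ : SubDist X) (Ξ : X → SubDist Y) (y : Y) :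
    Δ.bind Ξ y = ∑' x, Δ x * Ξ x y := rfl

theorem tsum_bind (Δ : SubDist X) (Ξ : X → SubDist Y) (g : Y → ℝ≥0∞) :
    ∑' y, Δ.bind Ξ y * g y = ∑' x, Δ x * ∑' y, Ξ x y * g y := by
  simp_rw [bind_apply, ← ENNReal.tsum_mul_right, ← ENNReal.tsum_mul_left]
  rw [ENNReal.tsum_comm]
  simp_rw [mul_assoc]

theorem bind_ne_zero {Δ : SubDist X} {Ξ : X → SubDist Y} {y : Y} :
    Δ.bind Ξ y ≠ 0 ↔ ∃ x, Δ x ≠ 0 ∧ Ξ x y ≠ 0 := by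
  simp [bind_apply, ENNReal.tsum_eq_zero]

open Classical in
/-- The part of a sub-distribution that lies in a set. -/
def restrict (Δ : SubDist X) (P : X → Prop) : SubDist X :=
  ⟨fun x => if P x then Δ x else 0,
    (ENNReal.tsum_le_tsum fun x => by split_ifs <;> simp).trans Δ.2⟩

theorem restrict_ne_zero {Δ : SubDist X} {P : X → Prop} {x : X} :
    Δ.restrict P x ≠ 0 ↔ P x ∧ Δ x ≠ 0 := by
  classical
  change (if P x then Δ x else 0) ≠ 0 ↔ _
  split_ifs with h <;> simp [h]

theorem restrict_add_restrict_not (Δ : SubDist X) (P : X → Prop) (x : X) :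
    Δ x = Δ.restrict (fun x => ¬ P x) x + Δ.restrict P x := by
  classical
  by_cases h : P x <;> simp [restrict, h]

end SubDist

/-! ## Lifted relations -/

section LiftLemmas

variable {X : Type u} {R : X → SubDist X → Prop}

/-- The indices are lifted to the universe of the states, and those of weight zero are dropped, so
that flattened families have only nonzero weights. -/
theorem sum_fin_eq_tsum_support {n : ℕ} (p F : Fin n → ℝ≥0∞) :
    ∑ i, p i * F i = ∑' i : {i : ULift.{u} (Fin n) // p i.down ≠ 0}, p i.1.down * F i.1.down := by
  rw [← tsum_fintype (L := SummationFilter.unconditional _),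
    ← (Equiv.ulift.{u} : ULift (Fin n) ≃ Fin n).tsum_eq]
  symm
  refine tsum_subtype_eq_of_support_subset (s := {i : ULift.{u} (Fin n) | p i.down ≠ 0})
    (f := fun i : ULift.{u} (Fin n) => p i.down * F i.down) ?_
  intro i hi h0
  exact hi (by simp [h0])

/-- Nested finite combinations collapse into one weighted family of related pairs. Since no weight
vanishes, each `x i` lies in the support of `Δ`, and the support of each `Ξ i` in that of `Θ`. -/
theorem Lift.flatten {Δ Θ : SubDist X} (h : Lift R Δ Θ) :
    ∃ (ι : Type u) (p : ι → ℝ≥0∞) (x : ι → X) (Ξ : ι → SubDist X),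
      (∀ i, p i ≠ 0) ∧ (∀ i, R (x i) (Ξ i)) ∧
      (∀ g : X → ℝ≥0∞, ∑' a, Δ a * g a = ∑' i, p i * g (x i)) ∧
      (∀ g : X → ℝ≥0∞, ∑' a, Θ a * g a = ∑' i, p i * ∑' a, Ξ i a * g a) := by
  induction h with
  | @point x Θ h =>
    refine ⟨PUnit, fun _ => 1, fun _ => x, fun _ => Θ, by simp, fun _ => h, fun g => ?_,
      fun g => ?_⟩
    · rw [SubDist.tsum_point]; simp
    · simp
  | @sum n p hp Δ Θ h ih =>
    choose ι q x Ξ hq hR hΔ hΘ using ih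
    refine ⟨Σ i : {i : ULift.{u} (Fin n) // p i.down ≠ 0}, ι i.1.down,
      fun j => p j.1.1.down * q _ j.2, fun j => x _ j.2, fun j => Ξ _ j.2,
      fun j => mul_ne_zero j.1.2 (hq _ _), fun j => hR _ _, fun g => ?_, fun g => ?_⟩
    all_goals
      rw [SubDist.tsum_comb, ENNReal.tsum_sigma']
      simp only [hΔ, hΘ, mul_assoc, ENNReal.tsum_mul_left]
      exact sum_fin_eq_tsum_support p _

theorem tsum_single_right {Y : Type*} (f : Y → ℝ≥0∞) (y : Y) [DecidableEq Y] :
    ∑' a, f a * (if a = y then 1 else 0) = f y := by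
  simp [mul_ite, tsum_ite_eq]

/-- A lifted step is given by a kernel, each of whose values is an average of steps. -/
theorem Lift.exists_kernel {Δ Θ : SubDist X} (h : Lift R Δ Θ) :
    ∃ k : X → X → ℝ≥0∞, (∀ y, Θ y = ∑' x, Δ x * k x y) ∧
      ∀ x, Δ x ≠ 0 → ∀ w : X → ℝ≥0∞, ∃ Ξ, R x Ξ ∧ Ξ.support ⊆ Θ.support ∧
        ∑' y, Ξ y * w y ≤ ∑' y, k x y * w y := by
  classical
  obtain ⟨ι, p, x, Ξ, hp, hR, hΔ, hΘ⟩ := h.flatten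
  have hΔ' : ∀ a, Δ a = ∑' i, p i * if x i = a then 1 else 0 := fun a => by
    rw [← hΔ fun b => if b = a then 1 else 0, tsum_single_right]
  have hΘ' : ∀ a, Θ a = ∑' i, p i * Ξ i a := fun a => by
    have := hΘ fun b => if b = a then 1 else 0
    simpa only [tsum_single_right] using this
  -- The kernel at `a` averages the steps made by the various occurrences of `a`. It need not be a
  -- step itself, as steps are not assumed closed under averages, but for each price function one
  -- occurrence is no dearer.
  refine ⟨fun a b => (∑' i, (p i * if x i = a then 1 else 0) * Ξ i b) / Δ a, fun b => ?_,
    fun a ha w => ?_⟩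
  · have : ∀ a, Δ a * ((∑' i, (p i * if x i = a then 1 else 0) * Ξ i b) / Δ a) =
        ∑' i, (p i * if x i = a then 1 else 0) * Ξ i b := by
      intro a
      by_cases h0 : Δ a = 0
      · have : ∀ i, (p i * if x i = a then 1 else 0) = 0 :=
          ENNReal.tsum_eq_zero.1 ((hΔ' a).symm.trans h0)
        simp [this, h0]
      · exact ENNReal.mul_div_cancel h0 (Δ.ne_top a)
    simp_rw [this]
    rw [ENNReal.tsum_comm, hΘ' b]
    refine tsum_congr fun i => ?_
    simp
  · obtain ⟨i, hi, hle⟩ := exists_le_average (fun i => p i * if x i = a then 1 else 0)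
      (fun i => ∑' y, Ξ i y * w y) (by rwa [← hΔ']) (by rw [← hΔ']; exact Δ.ne_top a)
    have hxi : x i = a := by
      by_contra hne
      simp [hne] at hi
    refine ⟨Ξ i, hxi ▸ hR i, fun y hy => ?_, ?_⟩
    · change Θ y ≠ 0
      rw [hΘ' y]
      intro h0
      exact mul_ne_zero (hp i) hy (ENNReal.tsum_eq_zero.1 h0 i)
    · rw [← hΔ'] at hle
      have hle' := (ENNReal.le_div_iff_mul_le (Or.inl ha) (Or.inl (Δ.ne_top a))).2 hle
      refine hle'.trans (le_of_eq ?_)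
      simp_rw [div_eq_mul_inv, mul_right_comm _ (Δ a)⁻¹, ENNReal.tsum_mul_right,
        ← ENNReal.tsum_mul_right (a := w _), ← ENNReal.tsum_mul_left]
      rw [ENNReal.tsum_comm]
      simp_rw [mul_assoc]

/-- `Lift` admits finite combinations only, whence the condition on the support. -/
theorem Lift.bind_of_finite {Δ : SubDist X} (hΔ : Δ.support.Finite) (Ξ : X → SubDist X)
    (h : ∀ x, Δ x ≠ 0 → R x (Ξ x)) : Lift R Δ (Δ.bind Ξ) := by
  classical
  have := hΔ.fintype
  let e := Fintype.equivFin Δ.support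
  have key : ∀ g : X → ℝ≥0∞, ∑ i, Δ (e.symm i).1 * g (e.symm i).1 = ∑' x, Δ x * g x := by
    intro g
    rw [← tsum_fintype (L := SummationFilter.unconditional _),
      e.symm.tsum_eq (fun x : Δ.support => Δ x.1 * g x.1)]
    refine tsum_subtype_eq_of_support_subset (f := fun x => Δ x * g x) ?_
    intro x hx h0
    exact hx (by simp [h0])
  have hp : ∑ i, Δ (e.symm i).1 ≤ 1 := by
    have := key fun _ => 1
    simp only [mul_one] at this
    rw [this]; exact Δ.2
  have h1 : Δ = SubDist.comb (fun i => Δ (e.symm i).1) hp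
      (fun i => SubDist.point (e.symm i).1) := by
    refine SubDist.ext_tsum fun g => ?_
    rw [SubDist.tsum_comb]
    simp_rw [SubDist.tsum_point]
    exact (key g).symm
  have h2 : Δ.bind Ξ = SubDist.comb (fun i => Δ (e.symm i).1) hp
      (fun i => Ξ (e.symm i).1) := by
    refine SubDist.ext_tsum fun g => ?_
    rw [SubDist.tsum_comb, SubDist.tsum_bind]
    exact (key _).symm
  rw [h2]
  nth_rw 1 [h1]
  exact Lift.sum _ hp _ _ fun i => Lift.point (h _ (e.symm i).2)

theorem Lift.mem_support_left {Δ Θ : SubDist X} (h : Lift R Δ Θ) {y : X} (hy : Θ y ≠ 0) :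
    ∃ x Ξ, Δ x ≠ 0 ∧ R x Ξ ∧ Ξ y ≠ 0 := by
  induction h with
  | @point x Θ h => exact ⟨x, Θ, SubDist.point_ne_zero.2 rfl, h, hy⟩
  | sum p hp Δ Θ _ ih =>
    obtain ⟨i, hi, hy⟩ := SubDist.comb_ne_zero.1 hy
    obtain ⟨x, Ξ, hx, hR, hy⟩ := ih i hy
    exact ⟨x, Ξ, SubDist.comb_ne_zero.2 ⟨i, hi, hx⟩, hR, hy⟩

end LiftLemmas

/-! ## Attainable costs -/

section Attains

variable {X : Type u}

/-- `Attains red succ C x w`: there is a scheduler that moves from `x` along reductions of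
unsuccessful states, diverging or leaving at states `y` at a price `v` with `C y v`, so that the
expected price is at most `w`. -/
def Attains (red : X → SubDist X → Prop) (succ : X → Prop) (C : X → ℝ≥0∞ → Prop)
    (x : X) (w : ℝ≥0∞) : Prop :=
  ∃ D : X → ℝ≥0∞ → Prop, D x w ∧ ∀ x w, D x w → (∃ w₀ ≤ w, C x w₀) ∨
    (¬ succ x ∧ ∃ Ξ, red x Ξ ∧ ∃ w' : X → ℝ≥0∞, ∑' y, Ξ y * w' y ≤ w ∧
      ∀ y ∈ Ξ.support, D y (w' y))

variable {red : X → SubDist X → Prop} {succ : X → Prop} {C C' : X → ℝ≥0∞ → Prop}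
  {x : X} {w w' : ℝ≥0∞}

theorem Attains.cases (h : Attains red succ C x w) : (∃ w₀ ≤ w, C x w₀) ∨
    (¬ succ x ∧ ∃ Ξ, red x Ξ ∧ ∃ w' : X → ℝ≥0∞, ∑' y, Ξ y * w' y ≤ w ∧
      ∀ y ∈ Ξ.support, Attains red succ C y (w' y)) := by
  obtain ⟨D, hD, hstep⟩ := h
  refine (hstep x w hD).imp id ?_
  rintro ⟨hs, Ξ, hr, w', hw, hy⟩
  exact ⟨hs, Ξ, hr, w', hw, fun y hy' => ⟨D, hy y hy', hstep⟩⟩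

theorem Attains.exit (h : C x w) : Attains red succ C x w :=
  ⟨C, h, fun _ w h => Or.inl ⟨w, le_rfl, h⟩⟩

theorem Attains.mono_right (h : Attains red succ C x w) (hw : w ≤ w') :
    Attains red succ C x w' := by
  refine ⟨fun x w => ∃ w₀ ≤ w, Attains red succ C x w₀, ⟨w, hw, h⟩, ?_⟩
  rintro x w ⟨w₀, hle, h⟩
  rcases h.cases with ⟨w₁, h1, h2⟩ | ⟨hs, Ξ, hr, w', hw, hy⟩
  · exact Or.inl ⟨w₁, h1.trans hle, h2⟩
  · exact Or.inr ⟨hs, Ξ, hr, w', hw.trans hle, fun y hy' => ⟨w' y, le_rfl, hy y hy'⟩⟩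

/-- The union of the two invariants is again an invariant: a run that leaves through `C` continues
as the run supplied there, which leaves through `C'`. -/
theorem Attains.trans (h : Attains red succ C x w)
    (hC : ∀ y v, C y v → Attains red succ C' y v) : Attains red succ C' x w := by
  refine ⟨fun x w => Attains red succ C x w ∨ Attains red succ C' x w, Or.inl h, ?_⟩
  have key : ∀ x w, Attains red succ C' x w → (∃ w₀ ≤ w, C' x w₀) ∨
      (¬ succ x ∧ ∃ Ξ, red x Ξ ∧ ∃ w' : X → ℝ≥0∞, ∑' y, Ξ y * w' y ≤ w ∧
        ∀ y ∈ Ξ.support, Attains red succ C y (w' y) ∨ Attains red succ C' y (w' y)) := by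
    intro x w h
    refine h.cases.imp id ?_
    rintro ⟨hs, Ξ, hr, w', hw, hy⟩
    exact ⟨hs, Ξ, hr, w', hw, fun y hy' => Or.inr (hy y hy')⟩
  rintro x w (h | h)
  · rcases h.cases with ⟨w₀, hle, h0⟩ | ⟨hs, Ξ, hr, w', hw, hy⟩
    · exact key x w ((hC x w₀ h0).mono_right hle)
    · exact Or.inr ⟨hs, Ξ, hr, w', hw, fun y hy' => Or.inl (hy y hy')⟩
  · exact key x w h

theorem Attains.mono (h : Attains red succ C x w) (hC : ∀ y v, C y v → C' y v) :
    Attains red succ C' x w :=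
  h.trans fun y v hv => Attains.exit (hC y v hv)

theorem Attains.step (hs : ¬ succ x) {Ξ : SubDist X} (hr : red x Ξ) {w' : X → ℝ≥0∞}
    (hw : ∑' y, Ξ y * w' y ≤ w) (hy : ∀ y ∈ Ξ.support, Attains red succ C y (w' y)) :
    Attains red succ C x w := by
  refine ⟨fun z v => Attains red succ C z v ∨ (z = x ∧ v = w), Or.inr ⟨rfl, rfl⟩, ?_⟩
  rintro z v (h | ⟨rfl, rfl⟩)
  · refine h.cases.imp id ?_
    rintro ⟨hs, Ξ, hr, w', hw, hy⟩
    exact ⟨hs, Ξ, hr, w', hw, fun y hy' => Or.inl (hy y hy')⟩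
  · exact Or.inr ⟨hs, Ξ, hr, w', hw, fun y hy' => Or.inl (hy y hy')⟩

/-- A hyper-derivation decomposes into a kernel, and prices of its end states yield attainable
prices of its start states. -/
theorem HyperDer.exists_kernel {Δ Δ' : SubDist X} (h : HyperDer red succ Δ Δ') :
    ∃ κ : X → X → ℝ≥0∞, (∀ y, ∑' x, Δ x * κ x y = Δ' y) ∧
      ∀ x, Δ x ≠ 0 → ∀ (C : X → ℝ≥0∞ → Prop) (f : X → ℝ≥0∞), (∀ y, Δ' y ≠ 0 → C y (f y)) →
        Attains red succ C x (∑' y, κ x y * f y) := by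
  classical
  obtain ⟨go, halt, h0, hstep, hns, hΔ'⟩ := h
  choose Ξ hL hΞ using hstep
  choose k hk hbest using fun n => (hL n).exists_kernel
  set m : ℕ → X → ℝ≥0∞ := fun n x => go n x + halt n x with hm
  have hmtop : ∀ n x, m n x ≠ ⊤ := fun n x =>
    ENNReal.add_ne_top.2 ⟨(go n).ne_top x, (halt n).ne_top x⟩
  -- With `m n x` the mass of `x` at stage `n`, these are the conditional probabilities of halting
  -- and of moving on.
  let r : ℕ → X → ℝ≥0∞ := fun n x => halt n x / m n x
  let s : ℕ → X → ℝ≥0∞ := fun n x => go n x / m n x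
  have hmr : ∀ n x, m n x * r n x = halt n x := by
    intro n x
    by_cases h : m n x = 0
    · rw [h, zero_mul]
      exact (add_eq_zero.1 h).2.symm
    · exact ENNReal.mul_div_cancel h (hmtop n x)
  have hms : ∀ n x, m n x * s n x = go n x := by
    intro n x
    by_cases h : m n x = 0
    · rw [h, zero_mul]
      exact (add_eq_zero.1 h).1.symm
    · exact ENNReal.mul_div_cancel h (hmtop n x)
  have hrs : ∀ n x, m n x ≠ 0 → r n x + s n x = 1 := by
    intro n x h
    change halt n x / m n x + go n x / m n x = 1
    rw [← ENNReal.add_div, add_comm]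
    exact ENNReal.div_self h (hmtop n x)
  have hm_succ : ∀ n y, m (n + 1) y = ∑' x, go n x * k n x y := fun n y => by
    rw [← hk n y, hΞ n y]
  -- `K j n x z` is the probability of halting at `z` exactly `j` stages later, given `x` at stage
  -- `n`. The stage matters because a hyper-derivation may treat a state differently each time it
  -- occurs.
  let K : ℕ → ℕ → X → X → ℝ≥0∞ := fun j => Nat.rec
    (fun n x y => r n x * if y = x then 1 else 0)
    (fun _ Kj n x z => s n x * ∑' y, k n x y * Kj (n + 1) y z) j
  have hK0 : ∀ n x y, K 0 n x y = r n x * if y = x then 1 else 0 := fun _ _ _ => rfl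
  have hKs : ∀ j n x z, K (j + 1) n x z = s n x * ∑' y, k n x y * K j (n + 1) y z :=
    fun _ _ _ _ => rfl
  have hflow : ∀ j n z, ∑' x, m n x * K j n x z = halt (n + j) z := by
    intro j
    induction j with
    | zero =>
      intro n z
      simp_rw [hK0, ← mul_assoc, hmr, eq_comm (a := z)]
      simp [mul_ite, tsum_ite_eq]
    | succ j ih =>
      intro n z
      simp_rw [hKs, ← mul_assoc, hms, ← ENNReal.tsum_mul_left]
      rw [ENNReal.tsum_comm]
      simp_rw [← mul_assoc, ENNReal.tsum_mul_right, ← hm_succ]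
      rw [ih (n + 1) z, show n + 1 + j = n + (j + 1) by ring]
  refine ⟨fun x y => ∑' j, K j 0 x y, fun y => ?_, fun x hx C f hf => ?_⟩
  · simp_rw [← ENNReal.tsum_mul_left]
    rw [ENNReal.tsum_comm, hΔ' y]
    refine tsum_congr fun j => ?_
    have := hflow j 0 y
    rw [zero_add] at this
    rw [← this]
    exact tsum_congr fun x => by rw [h0 x]
  -- `V n x` is the expected price of the rest of the run from `x` at stage `n`.
  · let V : ℕ → X → ℝ≥0∞ := fun n x => ∑' z, (∑' j, K j n x z) * f z
    have hV : ∀ n x, V n x = r n x * f x + s n x * ∑' y, k n x y * V (n + 1) y := by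
      intro n x
      have e1 : ∀ n x, V n x = ∑' j, ∑' z, K j n x z * f z := by
        intro n x
        simp only [V, ← ENNReal.tsum_mul_right]
        rw [ENNReal.tsum_comm]
      rw [e1, tsum_eq_zero_add' ENNReal.summable]
      congr 1
      · simp_rw [hK0, mul_assoc, ENNReal.tsum_mul_left, tsum_ite_mul]
      · simp_rw [hKs, mul_assoc, ENNReal.tsum_mul_left]
        congr 1
        simp_rw [← ENNReal.tsum_mul_right, e1]
        have : ∀ j, ∑' z, ∑' y, k n x y * K j (n + 1) y z * f z =
            ∑' y, k n x y * ∑' z, K j (n + 1) y z * f z := by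
          intro j
          rw [ENNReal.tsum_comm]
          simp_rw [mul_assoc, ENNReal.tsum_mul_left]
        simp_rw [this]
        rw [ENNReal.tsum_comm]
        simp_rw [ENNReal.tsum_mul_left]
    have hx0 : m 0 x ≠ 0 := by rw [hm]; simpa only [← h0] using hx
    -- The invariant forgets the stage: some stage where `x` has positive mass must have value at
    -- most `w`. There, halting or moving on is no dearer than the mixture, and in the second case
    -- one actual step is no dearer than the kernel.
    refine ⟨fun x w => ∃ n, m n x ≠ 0 ∧ V n x ≤ w, ⟨0, hx0, le_rfl⟩, ?_⟩
    rintro x w ⟨n, hmx, hVw⟩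
    rw [hV] at hVw
    rcases le_or_le_of_weights (hrs n x hmx) hVw with ⟨hr, hle⟩ | ⟨hs, hle⟩
    · refine Or.inl ⟨f x, hle, hf x ?_⟩
      rw [hΔ' x]
      intro h
      have := ENNReal.tsum_eq_zero.1 h n
      rw [← hmr] at this
      exact mul_ne_zero hmx hr this
    · have hgo : go n x ≠ 0 := by
        rw [← hms]; exact mul_ne_zero hmx hs
      obtain ⟨Ξ', hred, hsupp, hle'⟩ := hbest n x hgo (V (n + 1))
      refine Or.inr ⟨hns n x hgo, Ξ', hred, V (n + 1), hle'.trans hle, fun y hy => ?_⟩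
      refine ⟨n + 1, ?_, le_rfl⟩
      have := hsupp hy
      change Ξ n y ≠ 0 at this
      rwa [hΞ n y] at this

/-- An attainable price is realized by a hyper-derivation, if reductions have finite support. -/
theorem Attains.exists_hyperDer (hfin : ∀ x Ξ, red x Ξ → Ξ.support.Finite)
    (h : Attains red succ C x w) : ∃ (Δ' : SubDist X) (v : X → ℝ≥0∞),
      HyperDer red succ (SubDist.point x) Δ' ∧ (∀ y, Δ' y ≠ 0 → C y (v y)) ∧
      ∑' y, Δ' y * v y ≤ w := by
  classical
  let exits : (X → ℝ≥0∞) → X → Prop := fun v y => ∃ w₀ ≤ v y, C y w₀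
  -- A stage of the construction: a finitely supported sub-distribution with an attainable budget at
  -- each state of its support.
  let St := {s : SubDist X × (X → ℝ≥0∞) // s.1.support.Finite ∧
    ∀ y, s.1 y ≠ 0 → Attains red succ C y (s.2 y)}
  let go : St → SubDist X := fun s => s.1.1.restrict fun y => ¬ exits s.1.2 y
  let halt : St → SubDist X := fun s => s.1.1.restrict (exits s.1.2)
  have hsplit : ∀ s : St, ∀ y, s.1.1 y = go s y + halt s y := fun s y =>
    s.1.1.restrict_add_restrict_not _ y
  have hgo_of : ∀ s : St, ∀ y, go s y ≠ 0 → ¬ exits s.1.2 y ∧ s.1.1 y ≠ 0 := fun s y hy =>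
    SubDist.restrict_ne_zero.1 hy
  have hgo : ∀ s : St, ∀ y, go s y ≠ 0 → ¬ succ y ∧ ∃ Ξ, red y Ξ ∧ ∃ w' : X → ℝ≥0∞,
      ∑' z, Ξ z * w' z ≤ s.1.2 y ∧ ∀ z ∈ Ξ.support, Attains red succ C z (w' z) := by
    intro s y hy
    obtain ⟨h1, h2⟩ := hgo_of s y hy
    exact (s.2.2 y h2).cases.resolve_left h1
  have hnext : ∀ s : St, ∃ s' : St, Lift red (go s) s'.1.1 ∧
      ∑' y, s'.1.1 y * s'.1.2 y ≤ ∑' y, go s y * s.1.2 y ∧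
      ∑' y, s'.1.1 y ≤ ∑' y, go s y := by
    intro s
    have hch : ∀ y, ∃ (Ξ : SubDist X) (w' : X → ℝ≥0∞), go s y ≠ 0 → red y Ξ ∧
        ∑' z, Ξ z * w' z ≤ s.1.2 y ∧ ∀ z ∈ Ξ.support, Attains red succ C z (w' z) := by
      intro y
      by_cases hy : go s y = 0
      · exact ⟨SubDist.point y, fun _ => 0, fun h => absurd hy h⟩
      · obtain ⟨-, Ξ, h1, w', h2⟩ := hgo s y hy
        exact ⟨Ξ, w', fun _ => ⟨h1, h2⟩⟩
    choose Ξ w' hΞ using hch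
    set G := (go s).bind Ξ with hG
    have hfinG : G.support.Finite := by
      refine (Set.Finite.biUnion (s := (go s).support) (t := fun y => (Ξ y).support) ?_ ?_).subset
        fun z hz => ?_
      · exact s.2.1.subset fun y hy => (hgo_of s y hy).2
      · exact fun y hy => hfin y _ (hΞ y hy).1
      · obtain ⟨y, h1, h2⟩ := SubDist.bind_ne_zero.1 hz
        exact Set.mem_biUnion h1 h2
    -- Several predecessors may reach `z` with different budgets, while a stage keeps one budget per
    -- state. It is taken from a predecessor whose budget is at most the average.
    have hch : ∀ z, ∃ y, G z ≠ 0 → (go s y * Ξ y z ≠ 0 ∧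
        w' y z * G z ≤ ∑' y, go s y * Ξ y z * w' y z) := by
      intro z
      by_cases hz : G z = 0
      · exact ⟨z, fun h => absurd hz h⟩
      · obtain ⟨y, hy⟩ := exists_le_average (fun y => go s y * Ξ y z) (fun y => w' y z) hz
          (G.ne_top z)
        exact ⟨y, fun _ => hy⟩
    choose o ho using hch
    refine ⟨⟨(G, fun z => w' (o z) z), hfinG, fun z hz => ?_⟩, ?_, ?_, ?_⟩
    · have := (ho z hz).1
      exact (hΞ _ (left_ne_zero_of_mul this)).2.2 z (right_ne_zero_of_mul this)
    · exact Lift.bind_of_finite (s.2.1.subset fun y hy => (hgo_of s y hy).2) Ξ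
        fun y hy => (hΞ y hy).1
    · calc ∑' z, G z * w' (o z) z ≤ ∑' z, ∑' y, go s y * Ξ y z * w' y z := by
            refine ENNReal.tsum_le_tsum fun z => ?_
            by_cases hz : G z = 0
            · simp [hz]
            · rw [mul_comm]
              exact (ho z hz).2
        _ = ∑' y, go s y * ∑' z, Ξ y z * w' y z := by
            rw [ENNReal.tsum_comm]
            simp_rw [mul_assoc, ENNReal.tsum_mul_left]
        _ ≤ _ := by
            refine ENNReal.tsum_le_tsum fun y => ?_
            by_cases hy : go s y = 0
            · simp [hy]
            · exact mul_le_mul_right (hΞ y hy).2.1 _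
    · have := SubDist.tsum_bind (go s) Ξ fun _ => 1
      simp only [mul_one] at this
      change ∑' y, G y ≤ _
      rw [hG, this]
      exact ENNReal.tsum_le_tsum fun y => mul_le_of_le_one_right' (Ξ y).2
  choose next hnextL hnextC hnextM using hnext
  let s₀ : St := ⟨(SubDist.point x, fun _ => w), SubDist.support_point_finite x, fun y hy => by
    rw [SubDist.point_ne_zero.1 hy]; exact h⟩
  let s : ℕ → St := fun n => next^[n] s₀
  have hs : ∀ n, s (n + 1) = next (s n) := fun n => Function.iterate_succ_apply' _ _ _
  have hmass : ∑' y, ∑' n, halt (s n) y ≤ 1 := by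
    rw [ENNReal.tsum_comm]
    refine (tsum_le_of_telescoping (h := fun n => ∑' y, halt (s n) y)
      (e := fun n => ∑' y, (s n).1.1 y) fun n => ?_).trans (s 0).1.1.2
    rw [hs]
    refine (add_le_add le_rfl (hnextM (s n))).trans (le_of_eq ?_)
    rw [← ENNReal.tsum_add]
    exact tsum_congr fun y => by rw [hsplit, add_comm]
  have hcost : ∑' n, ∑' y, halt (s n) y * (s n).1.2 y ≤ w := by
    refine (tsum_le_of_telescoping (h := fun n => ∑' y, halt (s n) y * (s n).1.2 y)
      (e := fun n => ∑' y, (s n).1.1 y * (s n).1.2 y) fun n => ?_).trans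
        (le_of_eq (SubDist.tsum_point x fun _ => w))
    rw [hs]
    refine (add_le_add le_rfl (hnextC (s n))).trans (le_of_eq ?_)
    rw [← ENNReal.tsum_add]
    exact tsum_congr fun y => by rw [hsplit, add_mul, add_comm]
  let Δ' : SubDist X := ⟨fun y => ∑' n, halt (s n) y, hmass⟩
  -- In the same way, `y` may be left at several stages, and one exit price at most the average
  -- budget is selected.
  have hbest : ∀ y, ∃ v, Δ' y ≠ 0 → C y v ∧ Δ' y * v ≤ ∑' n, halt (s n) y * (s n).1.2 y := by
    intro y
    by_cases hy : Δ' y = 0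
    · exact ⟨0, fun h => absurd hy h⟩
    · obtain ⟨n, hn, hle⟩ := exists_le_average (fun n => halt (s n) y) (fun n => (s n).1.2 y) hy
        (Δ'.ne_top y)
      obtain ⟨v, hv, hC⟩ := (SubDist.restrict_ne_zero.1 hn).1
      refine ⟨v, fun _ => ⟨hC, le_trans ?_ hle⟩⟩
      rw [mul_comm]
      exact mul_le_mul_left hv _
  choose v hv using hbest
  refine ⟨Δ', v, ⟨fun n => go (s n), fun n => halt (s n), hsplit (s 0), fun n => ?_, ?_,
    fun y => rfl⟩, fun y hy => (hv y hy).1, ?_⟩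
  · refine ⟨_, hnextL (s n), fun y => ?_⟩
    rw [← hs]
    exact hsplit (s (n + 1)) y
  · exact fun n y hy => (hgo (s n) y hy).1
  · calc ∑' y, Δ' y * v y ≤ ∑' y, ∑' n, halt (s n) y * (s n).1.2 y := by
          refine ENNReal.tsum_le_tsum fun y => ?_
          by_cases hy : Δ' y = 0
          · simp [hy]
          · exact (hv y hy).2
      _ ≤ w := by rwa [ENNReal.tsum_comm]

theorem HyperDer.refl (red : X → SubDist X → Prop) (succ : X → Prop) (Δ : SubDist X) :
    HyperDer red succ Δ Δ := by
  classical
  have hz : (∑' x : X, (0 : ℝ≥0∞)) ≤ 1 := by simp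
  let z : SubDist X := ⟨fun _ => 0, hz⟩
  have hzl : Lift red z z := by
    have := Lift.sum (R := red) (n := 0) Fin.elim0 (by simp) Fin.elim0 Fin.elim0 (fun i => i.elim0)
    convert this using 1 <;>
    · refine SubDist.ext_apply fun x => ?_
      simp [SubDist.comb, z]
  refine ⟨fun _ => z, fun n => if n = 0 then Δ else z, fun x => by simp [z], fun n => ?_, ?_, ?_⟩
  · exact ⟨z, hzl, fun x => by simp [z]⟩
  · exact fun n x hx => absurd rfl hx
  · intro x
    rw [tsum_eq_single 0 (by intro n hn; simp [hn, z])]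
    simp

theorem HyperDer.support_subset {I : X → Prop} (hI : ∀ x Ξ, I x → red x Ξ → ∀ y, Ξ y ≠ 0 → I y)
    {Δ Δ' : SubDist X} (h : HyperDer red succ Δ Δ') (hΔ : ∀ x, Δ x ≠ 0 → I x) :
    ∀ x, Δ' x ≠ 0 → I x := by
  obtain ⟨go, halt, h0, hstep, -, hΔ'⟩ := h
  have key : ∀ n x, go n x + halt n x ≠ 0 → I x := by
    intro n
    induction n with
    | zero => exact fun x hx => hΔ x (by rwa [h0])
    | succ n ih =>
      intro x hx
      obtain ⟨Ξ, hL, hΞ⟩ := hstep n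
      rw [← hΞ] at hx
      obtain ⟨y, Ξ', hy, hr, hx⟩ := hL.mem_support_left hx
      exact hI y Ξ' (ih y fun h => hy (add_eq_zero.1 h).1) hr x hx
  intro x hx
  rw [hΔ' x] at hx
  obtain ⟨n, hn⟩ : ∃ n, halt n x ≠ 0 := by
    by_contra hcon
    push Not at hcon
    exact hx (by simp [hcon])
  exact key n x fun h => hn (add_eq_zero.1 h).2

end Attains

/-! ## Weak steps between weighted families of states -/

section WeakSteps

variable {X : Type u} (red : X → SubDist X → Prop) (succ : X → Prop)

/-- Prices that may always be paid: `1` anywhere, and `0` at unsuccessful states that cannot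
reduce. -/
def Payable (x : X) (w : ℝ≥0∞) : Prop :=
  1 ≤ w ∨ (¬ succ x ∧ ¬ ∃ Ξ, red x Ξ)

/-- `x` attains the price `w` when leaving through `C` or paying a payable price. -/
def Can (C : X → ℝ≥0∞ → Prop) : X → ℝ≥0∞ → Prop :=
  Attains red succ fun x w => C x w ∨ Payable red succ x w

/-- `x` attains the price `w` by making exactly one step into `C`, or by paying. -/
def CanStep (C : X → ℝ≥0∞ → Prop) (x : X) (w : ℝ≥0∞) : Prop :=
  Payable red succ x w ∨ (¬ succ x ∧ ∃ Ξ, red x Ξ ∧ ∃ w' : X → ℝ≥0∞, ∑' y, Ξ y * w' y ≤ w ∧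
    ∀ y ∈ Ξ.support, C y (w' y))

/-- At least one step. -/
def CanPlus (C : X → ℝ≥0∞ → Prop) : X → ℝ≥0∞ → Prop :=
  CanStep red succ (Can red succ C)

variable {red succ} {C C' : X → ℝ≥0∞ → Prop} {x : X} {w w' : ℝ≥0∞}

theorem Payable.mono (h : Payable red succ x w) (hw : w ≤ w') : Payable red succ x w' :=
  h.imp (fun h => h.trans hw) id

theorem Can.of_payable (h : Payable red succ x w) : Can red succ C x w :=
  Attains.exit (Or.inr h)

theorem Can.of_mem (h : C x w) : Can red succ C x w :=
  Attains.exit (Or.inl h)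

theorem Can.mono_right (h : Can red succ C x w) (hw : w ≤ w') : Can red succ C x w' :=
  Attains.mono_right h hw

theorem Can.trans (h : Can red succ C x w) (hC : ∀ y v, C y v → Can red succ C' y v) :
    Can red succ C' x w :=
  Attains.trans h fun y v hv => hv.elim (hC y v) Can.of_payable

theorem CanStep.mono (h : CanStep red succ C x w) (hC : ∀ y v, C y v → C' y v) :
    CanStep red succ C' x w := by
  refine h.imp id ?_
  rintro ⟨hs, Ξ, hr, w', hw, hy⟩
  exact ⟨hs, Ξ, hr, w', hw, fun y hy' => hC _ _ (hy y hy')⟩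

theorem CanStep.mono_right (h : CanStep red succ C x w) (hw : w ≤ w') :
    CanStep red succ C x w' := by
  refine h.imp (fun h => h.mono hw) ?_
  rintro ⟨hs, Ξ, hr, w₁, hw₁, hy⟩
  exact ⟨hs, Ξ, hr, w₁, hw₁.trans hw, hy⟩

theorem CanStep.can (h : CanStep red succ (Can red succ C) x w) : Can red succ C x w := by
  rcases h with h | ⟨hs, Ξ, hr, w', hw, hy⟩
  · exact Can.of_payable h
  · exact Attains.step hs hr hw hy

/-- If the initial run is empty, the first step is the one made by `CanStep`; otherwise the run
itself begins with a step. Payments are admitted on both sides. -/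
theorem Can.canPlus (h : Can red succ (CanStep red succ C) x w) : CanPlus red succ C x w := by
  have hsub : ∀ y v, CanStep red succ C y v → Can red succ C y v := fun y v hv =>
    CanStep.can (hv.mono fun _ _ => Can.of_mem)
  rcases Attains.cases h with ⟨w₀, hle, h0⟩ | ⟨hs, Ξ, hr, w', hw, hy⟩
  · refine CanStep.mono_right ?_ hle
    exact h0.elim (fun h => h.mono fun _ _ => Can.of_mem) Or.inl
  · exact Or.inr ⟨hs, Ξ, hr, w', hw, fun y hy' => Can.trans (hy y hy') hsub⟩

/-- `x` attains the price `w` by a complete run: the only way to end is to pay. -/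
abbrev Secures (red : X → SubDist X → Prop) (succ : X → Prop) : X → ℝ≥0∞ → Prop :=
  Can red succ fun _ _ => False

/-- Guarded coinduction: each round makes a step or pays, so rounds concatenate to a run. With `Can`
in place of `CanPlus` the hypothesis would hold for every `W`, by runs without steps. -/
theorem secures_of_le_canPlus {W : X → ℝ≥0∞ → Prop}
    (hW : ∀ x w, W x w → CanPlus red succ W x w) (h : W x w) : Secures red succ x w := by
  refine ⟨fun x w => CanPlus red succ W x w ∨ Can red succ W x w, Or.inl (hW x w h), ?_⟩
  have key : ∀ x w, CanPlus red succ W x w → (∃ w₀ ≤ w, False ∨ Payable red succ x w₀) ∨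
      (¬ succ x ∧ ∃ Ξ, red x Ξ ∧ ∃ w' : X → ℝ≥0∞, ∑' y, Ξ y * w' y ≤ w ∧
        ∀ y ∈ Ξ.support, CanPlus red succ W y (w' y) ∨ Can red succ W y (w' y)) := by
    rintro x w (h | ⟨hs, Ξ, hr, w', hw, hy⟩)
    · exact Or.inl ⟨w, le_rfl, Or.inr h⟩
    · exact Or.inr ⟨hs, Ξ, hr, w', hw, fun y hy' => Or.inr (hy y hy')⟩
  rintro x w (h | h)
  · exact key x w h
  · rcases h.cases with ⟨w₀, hle, h0 | h0⟩ | ⟨hs, Ξ, hr, w', hw, hy⟩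
    · exact key x w (CanStep.mono_right (hW x w₀ h0) hle)
    · exact Or.inl ⟨w₀, hle, Or.inr h0⟩
    · exact Or.inr ⟨hs, Ξ, hr, w', hw, fun y hy' => Or.inr (hy y hy')⟩

-- Transport of prices between weighted families of states

variable {A B E L : Type*}

/-- `Weakly P src Φ c tgt Ω`: from the weighted family `Φ` of states `src a` one gets, in the
sense of `P`, to the weighted family `Ω` of states `tgt b`, at the additional price `c`. -/
def Weakly (P : (X → ℝ≥0∞ → Prop) → X → ℝ≥0∞ → Prop) (src : A → X) (Φ : A → ℝ≥0∞)
    (c : ℝ≥0∞) (tgt : B → X) (Ω : B → ℝ≥0∞) : Prop :=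
  ∃ (k : A → ℝ≥0∞) (κ : A → B → ℝ≥0∞), ∑' a, Φ a * k a ≤ c ∧
    (∀ b, ∑' a, Φ a * κ a b = Ω b) ∧
    ∀ a, Φ a ≠ 0 → ∀ (C : X → ℝ≥0∞ → Prop) (f : B → ℝ≥0∞),
      (∀ b, Ω b ≠ 0 → C (tgt b) (f b)) → P C (src a) (k a + ∑' b, κ a b * f b)

variable {P P₁ P₂ P₃ : (X → ℝ≥0∞ → Prop) → X → ℝ≥0∞ → Prop} {src : A → X} {Φ : A → ℝ≥0∞}
  {c c' : ℝ≥0∞} {tgt : B → X} {Ω : B → ℝ≥0∞}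

theorem Weakly.mono_price (h : Weakly P src Φ c tgt Ω) (hc : c ≤ c') :
    Weakly P src Φ c' tgt Ω := by
  obtain ⟨k, κ, h1, h2⟩ := h
  exact ⟨k, κ, h1.trans hc, h2⟩

theorem Weakly.comp {tgt' : E → X} {Ω' : E → ℝ≥0∞}
    (hP : ∀ C x w, P₁ (P₂ C) x w → P₃ C x w)
    (h₁ : Weakly P₁ src Φ c tgt Ω) (h₂ : Weakly P₂ tgt Ω c' tgt' Ω') :
    Weakly P₃ src Φ (c + c') tgt' Ω' := by
  obtain ⟨k₁, κ₁, hc₁, hΩ₁, hP₁⟩ := h₁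
  obtain ⟨k₂, κ₂, hc₂, hΩ₂, hP₂⟩ := h₂
  have hbind : ∀ g : B → ℝ≥0∞, ∑' a, Φ a * ∑' b, κ₁ a b * g b = ∑' b, Ω b * g b := by
    intro g
    simp_rw [← ENNReal.tsum_mul_left]
    rw [ENNReal.tsum_comm]
    simp_rw [← mul_assoc, ENNReal.tsum_mul_right, hΩ₁]
  refine ⟨fun a => k₁ a + ∑' b, κ₁ a b * k₂ b, fun a e => ∑' b, κ₁ a b * κ₂ b e, ?_, ?_, ?_⟩
  · simp_rw [mul_add, ENNReal.tsum_add]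
    rw [hbind]
    exact add_le_add hc₁ hc₂
  · intro e
    rw [hbind, hΩ₂]
  · intro a ha C f hf
    have := hP C _ _ (hP₁ a ha (P₂ C) (fun b => k₂ b + ∑' e, κ₂ b e * f e)
      fun b hb => hP₂ b hb C f hf)
    convert this using 1
    rw [add_assoc]
    congr 1
    simp_rw [mul_add, ENNReal.tsum_add, ← ENNReal.tsum_mul_right, ← ENNReal.tsum_mul_left]
    rw [ENNReal.tsum_comm]
    simp_rw [mul_assoc]

theorem Weakly.scale (h : Weakly P src Φ c tgt Ω) (q : ℝ≥0∞) :
    Weakly P src (fun a => q * Φ a) (q * c) tgt (fun b => q * Ω b) := by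
  obtain ⟨k, κ, hc, hΩ, hP⟩ := h
  refine ⟨k, κ, ?_, fun b => ?_, fun a ha C f hf => ?_⟩
  · simp_rw [mul_assoc, ENNReal.tsum_mul_left]
    exact mul_le_mul_right hc q
  · simp_rw [mul_assoc, ENNReal.tsum_mul_left, hΩ]
  · have hq := left_ne_zero_of_mul ha
    exact hP a (right_ne_zero_of_mul ha) C f fun b hb => hf b (mul_ne_zero hq hb)

/-- A state occurring in several summands can follow only one of their strategies. The combined
kernel is the weighted average, and for given exit prices some summand is no dearer than the
average; monotonicity of `P` in the price then closes the gap. -/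
theorem Weakly.sum (hP : ∀ C x w w', P C x w → w ≤ w' → P C x w') {Ψ : L → A → ℝ≥0∞}
    {cs : L → ℝ≥0∞} {Ωs : L → B → ℝ≥0∞} (h : ∀ l, Weakly P src (Ψ l) (cs l) tgt (Ωs l))
    (hΦ : ∀ a, ∑' l, Ψ l a ≠ ⊤) :
    Weakly P src (fun a => ∑' l, Ψ l a) (∑' l, cs l) tgt (fun b => ∑' l, Ωs l b) := by
  choose k κ hc hΩ hP' using h
  have hmul : ∀ a (g : L → ℝ≥0∞),
      (∑' l, Ψ l a) * ((∑' l, Ψ l a * g l) / ∑' l, Ψ l a) = ∑' l, Ψ l a * g l := by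
    intro a g
    by_cases h0 : ∑' l, Ψ l a = 0
    · have h0' := ENNReal.tsum_eq_zero.1 h0
      simp [h0']
    · exact ENNReal.mul_div_cancel h0 (hΦ a)
  refine ⟨fun a => (∑' l, Ψ l a * k l a) / ∑' l, Ψ l a,
    fun a b => (∑' l, Ψ l a * κ l a b) / ∑' l, Ψ l a, ?_, fun b => ?_, fun a ha C f hf => ?_⟩
  · simp_rw [hmul]
    rw [ENNReal.tsum_comm]
    exact ENNReal.tsum_le_tsum hc
  · simp_rw [hmul]
    rw [ENNReal.tsum_comm]
    exact tsum_congr fun l => hΩ l b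
  · obtain ⟨l, hl, hle⟩ := exists_le_average (fun l => Ψ l a)
      (fun l => k l a + ∑' b, κ l a b * f b) ha (hΦ a)
    refine hP _ _ _ _ (hP' l a hl C f fun b hb => hf b fun h0 =>
      hb (ENNReal.tsum_eq_zero.1 h0 l)) ?_
    refine ((ENNReal.le_div_iff_mul_le (Or.inl ha) (Or.inl (hΦ a))).2 hle).trans (le_of_eq ?_)
    simp_rw [mul_add, ENNReal.tsum_add, ENNReal.add_div, div_eq_mul_inv]
    congr 1
    simp_rw [mul_right_comm _ (∑' l, Ψ l a)⁻¹, ENNReal.tsum_mul_right]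
    congr 1
    simp_rw [← ENNReal.tsum_mul_right, ← ENNReal.tsum_mul_left]
    rw [ENNReal.tsum_comm]
    simp_rw [mul_assoc]

/-- Unlike in `Weakly.sum`, the index remains part of the source, so each member keeps its own
strategy and nothing is averaged. -/
theorem Weakly.family {srcs : L → A → X} {Ψ : L → A → ℝ≥0∞} {cs : L → ℝ≥0∞}
    {Ωs : L → B → ℝ≥0∞} (h : ∀ l, Weakly P (srcs l) (Ψ l) (cs l) tgt (Ωs l)) :
    Weakly P (fun p : L × A => srcs p.1 p.2) (fun p => Ψ p.1 p.2) (∑' l, cs l) tgt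
      (fun b => ∑' l, Ωs l b) := by
  choose k κ hc hΩ hP' using h
  refine ⟨fun p => k p.1 p.2, fun p b => κ p.1 p.2 b, ?_, fun b => ?_, fun p hp C f hf => ?_⟩
  · rw [ENNReal.tsum_prod']
    exact ENNReal.tsum_le_tsum hc
  · rw [ENNReal.tsum_prod']
    exact tsum_congr fun l => hΩ l b
  · exact hP' p.1 p.2 hp C f fun b hb => hf b fun h0 => hb (ENNReal.tsum_eq_zero.1 h0 p.1)

open Classical in
theorem Weakly.push {tgt' : E → X} (g : B → E) (hg : ∀ b, tgt' (g b) = tgt b)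
    (h : Weakly P src Φ c tgt Ω) :
    Weakly P src Φ c tgt' (fun e => ∑' b, if g b = e then Ω b else 0) := by
  obtain ⟨k, κ, hc, hΩ, hP⟩ := h
  refine ⟨k, fun a e => ∑' b, if g b = e then κ a b else 0, hc, fun e => ?_,
    fun a ha C f hf => ?_⟩
  · simp_rw [← ENNReal.tsum_mul_left]
    rw [ENNReal.tsum_comm]
    refine tsum_congr fun b => ?_
    split_ifs
    · exact hΩ b
    · simp
  · have := hP a ha C (fun b => f (g b)) fun b hb => hg b ▸ hf (g b) fun h0 => hb (by
      have := ENNReal.tsum_eq_zero.1 h0 b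
      simpa using this)
    convert this using 2
    simp_rw [← ENNReal.tsum_mul_right]
    rw [ENNReal.tsum_comm]
    refine tsum_congr fun b => ?_
    simp_rw [ite_mul, zero_mul, eq_comm (a := g b), tsum_ite_eq]

theorem Weakly.congr {Φ' : A → ℝ≥0∞} {Ω' : B → ℝ≥0∞} (h : Weakly P src Φ c tgt Ω)
    (hΦ : ∀ a, Φ a = Φ' a) (hΩ : ∀ b, Ω b = Ω' b) : Weakly P src Φ' c tgt Ω' := by
  rwa [← funext hΦ, ← funext hΩ]

theorem Weakly.pay (hP : ∀ C x w, Payable red succ x w → P C x w) :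
    Weakly P src Φ (∑' a, Φ a) tgt (fun _ : B => 0) :=
  ⟨fun _ => 1, fun _ _ => 0, by simp, by simp, fun a _ C f _ => hP _ _ _ (Or.inl (by simp))⟩

theorem Weakly.dead (hP : ∀ C x w, Payable red succ x w → P C x w)
    (h : ∀ a, Φ a ≠ 0 → ¬ succ (src a) ∧ ¬ ∃ Ξ, red (src a) Ξ) :
    Weakly P src Φ 0 tgt (fun _ : B => 0) :=
  ⟨fun _ => 0, fun _ _ => 0, by simp, by simp, fun a ha C f _ => hP _ _ _ (Or.inr (h a ha))⟩

/-! ### Obligations -/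

/-- From the family `Φ` one gets to multiples of the families `oΦ o`, so that `w` pays for
everything, if the family `oΦ o` costs `op o`. -/
def Reduces {O : Type*} (osrc : O → A → X) (oΦ : O → A → ℝ≥0∞) (op : O → ℝ≥0∞)
    (P : (X → ℝ≥0∞ → Prop) → X → ℝ≥0∞ → Prop) (src : B → X) (Φ : B → ℝ≥0∞) (w : ℝ≥0∞) : Prop :=
  ∃ (c : ℝ≥0∞) (Q : O → ℝ≥0∞),
    Weakly P src Φ c (fun b : O × A => osrc b.1 b.2) (fun b => Q b.1 * oΦ b.1 b.2) ∧
    c + ∑' o, Q o * op o ≤ w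

section Reduces

variable {O : Type*} {osrc : O → A → X} {oΦ : O → A → ℝ≥0∞} {op : O → ℝ≥0∞}

theorem Reduces.of_weakly_zero {src : B → X} {Φ : B → ℝ≥0∞}
    (h : ∀ tgt : O × A → X, Weakly P src Φ w tgt (fun _ => 0)) :
    Reduces osrc oΦ op P src Φ w :=
  ⟨w, fun _ => 0, by simpa using h _, by simp⟩

theorem Reduces.base (o : O) : Reduces osrc oΦ op (Can red succ) (osrc o) (oΦ o) (op o) := by
  classical
  refine ⟨0, fun o' => if o' = o then 1 else 0,
    ⟨fun _ => 0, fun a b => if b = (o, a) then 1 else 0, by simp, ?_, ?_⟩, ?_⟩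
  · rintro ⟨o', a'⟩
    by_cases h : o' = o
    · subst h
      simp [Prod.ext_iff, mul_ite]
    · simp [Prod.ext_iff, h]
  · intro a ha C f hf
    simp only [ite_mul, one_mul, zero_mul, tsum_ite_eq, zero_add]
    exact Can.of_mem (hf (o, a) (by simpa using ha))
  · rw [tsum_ite_mul, zero_add]

theorem Reduces.scale {src : B → X} {Φ : B → ℝ≥0∞} (h : Reduces osrc oΦ op P src Φ w)
    (q : ℝ≥0∞) : Reduces osrc oΦ op P src (fun b => q * Φ b) (q * w) := by
  obtain ⟨c, Q, h1, h2⟩ := h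
  refine ⟨q * c, fun o => q * Q o, (h1.scale q).congr (fun _ => rfl) fun b => by rw [mul_assoc],
    ?_⟩
  simp_rw [mul_assoc, ENNReal.tsum_mul_left, ← mul_add]
  exact mul_le_mul_right h2 q

theorem Reduces.sum (hP : ∀ C x w w', P C x w → w ≤ w' → P C x w') {src : B → X}
    {Ψ : L → B → ℝ≥0∞} {Φ : B → ℝ≥0∞} {ws : L → ℝ≥0∞}
    (h : ∀ l, Reduces osrc oΦ op P src (Ψ l) (ws l)) (hΦ : ∀ b, Φ b = ∑' l, Ψ l b)
    (hΦt : ∀ b, Φ b ≠ ⊤) (hw : ∑' l, ws l ≤ w) : Reduces osrc oΦ op P src Φ w := by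
  choose c Q h1 h2 using h
  refine ⟨∑' l, c l, fun o => ∑' l, Q l o,
    (Weakly.sum hP h1 fun b => hΦ b ▸ hΦt b).congr (fun b => (hΦ b).symm) fun b => ?_, ?_⟩
  · rw [ENNReal.tsum_mul_right]
  · refine le_trans (le_of_eq ?_) ((ENNReal.tsum_le_tsum h2).trans hw)
    rw [ENNReal.tsum_add]
    congr 1
    simp_rw [← ENNReal.tsum_mul_right]
    rw [ENNReal.tsum_comm]

theorem Reduces.comp (hP : ∀ C x w, P₁ (P₂ C) x w → P₃ C x w) {src : B → X}
    {Φ : B → ℝ≥0∞} {srcs : L → E → X} {Ω : L → E → ℝ≥0∞} {ws : L → ℝ≥0∞}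
    (h₁ : Weakly P₁ src Φ c (fun p : L × E => srcs p.1 p.2) (fun p => Ω p.1 p.2))
    (h₂ : ∀ l, Reduces osrc oΦ op P₂ (srcs l) (Ω l) (ws l)) (hw : c + ∑' l, ws l ≤ w) :
    Reduces osrc oΦ op P₃ src Φ w := by
  choose c' Q h1 h2 using h₂
  refine ⟨c + ∑' l, c' l, fun o => ∑' l, Q l o,
    (Weakly.comp hP h₁ (Weakly.family h1)).congr (fun _ => rfl) fun b => ?_, ?_⟩
  · rw [ENNReal.tsum_mul_right]
  · refine le_trans ?_ hw
    rw [add_assoc]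
    refine add_le_add le_rfl (le_trans (le_of_eq ?_) (ENNReal.tsum_le_tsum h2))
    rw [ENNReal.tsum_add]
    congr 1
    simp_rw [← ENNReal.tsum_mul_right]
    rw [ENNReal.tsum_comm]

/-- If every obligation reduces to obligations by at least one step, all can be met. -/
theorem secures_of_reduces
    (h : ∀ o, Reduces osrc oΦ op (CanPlus red succ) (osrc o) (oΦ o) (op o)) (o : O) :
    ∃ W : A → ℝ≥0∞, ∑' a, oΦ o a * W a ≤ op o ∧
      ∀ a, oΦ o a ≠ 0 → Secures red succ (osrc o a) (W a) := by
  choose c Q h hle using h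
  choose k κ hk hκ hcan using h
  -- `t n o a` is the expected price paid in round `n`, counted from 0, when starting in `osrc o a`.
  -- The sum `W` over all rounds is the least solution of the equation `hW`.
  let t : ℕ → O → A → ℝ≥0∞ := fun n => Nat.rec k
    (fun _ tn o a => ∑' b : O × A, κ o a b * tn b.1 b.2) n
  have ht0 : ∀ o a, t 0 o a = k o a := fun _ _ => rfl
  have hts : ∀ n o a, t (n + 1) o a = ∑' b : O × A, κ o a b * t n b.1 b.2 := fun _ _ _ => rfl
  let W : O → A → ℝ≥0∞ := fun o a => ∑' n, t n o a
  have hW : ∀ o a, W o a = k o a + ∑' b : O × A, κ o a b * W b.1 b.2 := by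
    intro o a
    simp only [W]
    rw [tsum_eq_zero_add' ENNReal.summable]
    simp_rw [hts, ht0, ← ENNReal.tsum_mul_left]
    rw [ENNReal.tsum_comm]
  -- Induction on the number of rounds: the budget of `o` pays for the first round and provides the
  -- budgets of the obligations it leads to, which pay for the other rounds.
  have hbound : ∀ n o, ∑' a, oΦ o a * ∑ i ∈ Finset.range n, t i o a ≤ op o := by
    intro n
    induction n with
    | zero => simp
    | succ n ih =>
      intro o
      refine le_trans (le_of_eq ?_) ((add_le_add (hk o) (ENNReal.tsum_le_tsum fun o' =>
        mul_le_mul_right (ih o') (Q o o'))).trans (hle o))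
      have e : ∀ a, ∑ i ∈ Finset.range (n + 1), t i o a =
          k o a + ∑' b : O × A, κ o a b * ∑ i ∈ Finset.range n, t i b.1 b.2 := by
        intro a
        rw [Finset.sum_range_succ']
        simp_rw [hts, ht0, Finset.mul_sum]
        rw [add_comm, Summable.tsum_finsetSum (fun _ _ => ENNReal.summable)]
      simp_rw [e, mul_add, ENNReal.tsum_add]
      congr 1
      simp_rw [← ENNReal.tsum_mul_left]
      rw [ENNReal.tsum_comm]
      simp_rw [← mul_assoc, ENNReal.tsum_mul_right, hκ]
      rw [ENNReal.tsum_prod']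
  refine ⟨W o, ?_, fun a ha => ?_⟩
  · simp only [W, ← ENNReal.tsum_mul_left]
    rw [ENNReal.tsum_comm]
    refine ENNReal.tsum_le_of_sum_range_le fun n => ?_
    refine le_trans (le_of_eq ?_) (hbound n o)
    rw [← Summable.tsum_finsetSum (fun _ _ => ENNReal.summable)]
    simp_rw [Finset.mul_sum]
  · refine secures_of_le_canPlus
      (W := fun x w => ∃ o a, oΦ o a ≠ 0 ∧ x = osrc o a ∧ w = W o a) ?_ ⟨o, a, ha, rfl, rfl⟩
    rintro _ _ ⟨o, a, ha, rfl, rfl⟩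
    rw [hW]
    exact hcan o a ha _ _ fun b hb => ⟨b.1, b.2, right_ne_zero_of_mul hb, rfl, rfl⟩

end Reduces

end WeakSteps

/-! ## Success, syntactically -/

section Success

variable {S : Signature.{u}} {D : Defns S}

/-- The success clause is enabled in a state. -/
inductive State.Enabled (D : Defns S) : State S 0 → Prop
  | omega : Enabled D .omega
  | suml {s} (t) : Enabled D s → Enabled D (.sum s t)
  | sumr {t} (s) : Enabled D t → Enabled D (.sum s t)
  | iteTrue {b s} (t) : evalClosed b = true → Enabled D s → Enabled D (.ite b s t)
  | iteFalse {b t} (s) : evalClosed b = false → Enabled D t → Enabled D (.ite b s t)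
  | call {A args} : Enabled D (unfoldCall D A args) → Enabled D (.call A args)

theorem State.enabled_sum {s t : State S 0} :
    State.Enabled D (.sum s t) ↔ State.Enabled D s ∨ State.Enabled D t :=
  ⟨fun h => by cases h with
    | suml _ h => exact Or.inl h
    | sumr _ h => exact Or.inr h,
   fun h => h.elim (.suml t) (.sumr s)⟩

theorem State.not_enabled_nil : ¬ State.Enabled D .nil := fun h => nomatch h

/-- Success is defined up to structural congruence, which obscures where the success clause stands.
An invariant syntactic predicate makes success decompose along parallel composition
(`Sys.success_par`). -/
theorem StateEquiv.enabled_iff {s t : State S 0} (h : StateEquiv D s t) :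
    State.Enabled D s ↔ State.Enabled D t := by
  induction h with
  | refl => exact Iff.rfl
  | symm _ ih => exact ih.symm
  | trans _ _ ih₁ ih₂ => exact ih₁.trans ih₂
  | sum_congr _ _ ih₁ ih₂ => rw [State.enabled_sum, State.enabled_sum, ih₁, ih₂]
  | sum_comm => rw [State.enabled_sum, State.enabled_sum, or_comm]
  | sum_assoc => simp only [State.enabled_sum, or_assoc]
  | sum_nil => simp [State.enabled_sum, State.not_enabled_nil]
  | ite_true s t hb =>
    refine ⟨fun h => ?_, .iteTrue t hb⟩
    cases h with
    | iteTrue _ _ h => exact h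
    | iteFalse _ hb' _ => rw [hb] at hb'; cases hb'
  | ite_false s t hb =>
    refine ⟨fun h => ?_, .iteFalse s hb⟩
    cases h with
    | iteTrue _ hb' _ => rw [hb] at hb'; cases hb'
    | iteFalse _ _ h => exact h
  | call A args => exact ⟨fun h => by cases h with | call h => exact h, .call⟩

theorem State.Enabled.exists_equiv {s : State S 0} (h : State.Enabled D s) :
    ∃ s', StateEquiv D s (.sum .omega s') := by
  induction h with
  | omega => exact ⟨.nil, .symm (.sum_nil _)⟩
  | suml t _ ih =>
    obtain ⟨s', h⟩ := ih
    exact ⟨.sum s' t, .trans (.sum_congr h (.refl _)) (.sum_assoc _ _ _)⟩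
  | sumr s _ ih =>
    obtain ⟨s', h⟩ := ih
    exact ⟨.sum s' s, .trans (.sum_comm _ _) (.trans (.sum_congr h (.refl _)) (.sum_assoc _ _ _))⟩
  | iteTrue t hb _ ih =>
    obtain ⟨s', h⟩ := ih
    exact ⟨s', .trans (.ite_true _ _ hb) h⟩
  | iteFalse s hb _ ih =>
    obtain ⟨s', h⟩ := ih
    exact ⟨s', .trans (.ite_false _ _ hb) h⟩
  | call _ ih =>
    obtain ⟨s', h⟩ := ih
    exact ⟨s', .trans (.call _ _) h⟩

/-- The success clause is enabled at some node. -/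
def Sys.Enabled (D : Defns S) : Sys S → Prop
  | .node s _ => State.Enabled D s
  | .par M N => M.Enabled D ∨ N.Enabled D
  | .nil => False

theorem SysEquiv.enabled_iff {M N : Sys S} (h : SysEquiv D M N) :
    M.Enabled D ↔ N.Enabled D := by
  induction h with
  | refl => exact Iff.rfl
  | symm _ ih => exact ih.symm
  | trans _ _ ih₁ ih₂ => exact ih₁.trans ih₂
  | par_congr _ _ ih₁ ih₂ => exact or_congr ih₁ ih₂
  | par_comm => exact or_comm
  | par_assoc => exact or_assoc
  | par_nil => exact or_iff_left id
  | node n h => exact h.enabled_iff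

theorem Sys.success_iff {M : Sys S} : M.Success D ↔ M.Enabled D := by
  constructor
  · rintro ⟨M', s, n, h⟩
    exact h.enabled_iff.2 (Or.inr (.suml _ .omega))
  · intro h
    induction M with
    | node s n =>
      obtain ⟨s', hs⟩ := State.Enabled.exists_equiv h
      exact ⟨.nil, s', n, .trans (.node n hs) (.trans (.symm (.par_nil _)) (.par_comm _ _))⟩
    | par M N ihM ihN =>
      rcases h with h | h
      · obtain ⟨M', s, n, hM⟩ := ihM h
        exact ⟨.par M' N, s, n, .trans (.par_congr hM (.refl _)) (.trans (.par_assoc _ _ _)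
          (.trans (.par_congr (.refl _) (.par_comm _ _)) (.symm (.par_assoc _ _ _))))⟩
      · obtain ⟨N', s, n, hN⟩ := ihN h
        exact ⟨.par M N', s, n, .trans (.par_congr (.refl _) hN) (.symm (.par_assoc _ _ _))⟩
    | nil => exact h.elim

theorem Sys.success_par {M N : Sys S} : (Sys.par M N).Success D ↔ M.Success D ∨ N.Success D := by
  simp only [Sys.success_iff]
  exact Iff.rfl

end Success

/-! ## Properties of the intensional semantics -/

section Semantics

variable {S : Signature.{u}} {D : Defns S}

theorem Proc.interp_finite_mass : {n : ℕ} → (p : Proc S n) →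
    p.interp.support.Finite ∧ ∑' s, p.interp s = 1
  | _, .state s => ⟨SubDist.support_point_finite s, SubDist.tsum_point_mass s⟩
  | _, .choice w p q => by
    obtain ⟨hp, hp'⟩ := p.interp_finite_mass
    obtain ⟨hq, hq'⟩ := q.interp_finite_mass
    have hw : ENNReal.ofReal w + ENNReal.ofReal (1 - w) = 1 := by
      rw [← ENNReal.ofReal_add w.2.1 (by linarith [w.2.2])]
      simp
    have hsum : ∑ i, ![ENNReal.ofReal w, ENNReal.ofReal (1 - w)] i ≤ 1 := by
      simpa [Fin.sum_univ_two] using hw.le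
    constructor
    · change (SubDist.comb ![ENNReal.ofReal w, ENNReal.ofReal (1 - w)] hsum
        ![p.interp, q.interp]).support.Finite
      refine SubDist.support_comb_finite fun i => ?_
      fin_cases i
      exacts [hp, hq]
    · have := SubDist.tsum_comb ![ENNReal.ofReal w, ENNReal.ofReal (1 - w)] hsum
        ![p.interp, q.interp] fun _ => 1
      simp only [mul_one, Fin.sum_univ_two, Matrix.cons_val_zero, Matrix.cons_val_one, hp',
        hq', hw] at this
      exact this

theorem StateStep.finite_mass {s : State S 0} {α : StateAct S} {Δ : SubDist (State S 0)}
    (h : StateStep D s α Δ) : Δ.support.Finite ∧ ∑' s, Δ s = 1 := by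
  induction h <;> first | assumption | exact Proc.interp_finite_mass _

variable {G H : ConnGraph S} {M M' N : Sys S} {α : SysAct S} {Δ : SubDist (Sys S)}

/-- Finite support allows steps to be combined under `Lift`. Full mass ensures that success of the
test costs the simulated run as much as the simulating one. -/
theorem SysStep.finite_mass (h : SysStep D G M α Δ) : Δ.support.Finite ∧ ∑' s, Δ s = 1 := by
  have hp : ∀ M : Sys S, (SubDist.point M).support.Finite ∧ ∑' s, SubDist.point M s = 1 :=
    fun M => ⟨SubDist.support_point_finite M, SubDist.tsum_point_mass M⟩
  have hm : ∀ {s : State S 0} {α : StateAct S} {Δ : SubDist (State S 0)} (n : S.Node),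
      StateStep D s α Δ → (Δ.map fun t => Sys.node t n).support.Finite ∧
        ∑' s, (Δ.map fun t => Sys.node t n) s = 1 := fun n h =>
    ⟨SubDist.support_map_finite h.finite_mass.1, by
      rw [SubDist.tsum_map_mass]; exact h.finite_mass.2⟩
  have hpar : ∀ {Δ Θ : SubDist (Sys S)}, (Δ.support.Finite ∧ ∑' s, Δ s = 1) →
      (Θ.support.Finite ∧ ∑' s, Θ s = 1) →
      ((SubDist.map₂ Sys.par Δ Θ).support.Finite ∧ ∑' s, (SubDist.map₂ Sys.par Δ Θ) s = 1) :=
    fun h h' => ⟨SubDist.support_map₂_finite h.1 h'.1, by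
      rw [SubDist.tsum_map₂_mass, h.2, h'.2, one_mul]⟩
  induction h with
  | broad n h => exact hm n h
  | recv _ h => exact hm _ h
  | deaf => exact hp _
  | disc => exact hp _
  | nil => exact hp _
  | tau n h => exact hm n h
  | tau_left N _ ih => exact hpar ih (hp _)
  | tau_right M _ ih => exact hpar (hp _) ih
  | prop _ _ ih₁ ih₂ => exact hpar ih₁ ih₂
  | sync_left _ _ ih₁ ih₂ => exact hpar ih₁ ih₂
  | sync_right _ _ ih₁ ih₂ => exact hpar ih₁ ih₂

theorem SysStep.nodes_eq (h : SysStep D G M α Δ) (hM' : Δ M' ≠ 0) : M'.nodes = M.nodes := by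
  have hm : ∀ {s : State S 0} {Δ : SubDist (State S 0)} {n : S.Node} {M' : Sys S},
      (Δ.map fun t => Sys.node t n) M' ≠ 0 → M'.nodes = (Sys.node s n).nodes := fun h => by
    obtain ⟨t, -, rfl⟩ := SubDist.map_ne_zero.1 h
    rfl
  have hp : ∀ {M M' : Sys S}, (SubDist.point M) M' ≠ 0 → M'.nodes = M.nodes := fun h => by
    rw [SubDist.point_ne_zero.1 h]
  have hpar : ∀ {M N M' : Sys S} {Δ Θ : SubDist (Sys S)},
      (∀ {M'}, Δ M' ≠ 0 → M'.nodes = M.nodes) → (∀ {M'}, Θ M' ≠ 0 → M'.nodes = N.nodes) →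
      (SubDist.map₂ Sys.par Δ Θ) M' ≠ 0 → M'.nodes = (Sys.par M N).nodes := by
    intro M N M' Δ Θ h₁ h₂ h
    obtain ⟨a, b, ha, hb, rfl⟩ := SubDist.map₂_ne_zero.1 h
    exact congrArg₂ (· ∪ ·) (h₁ ha) (h₂ hb)
  induction h generalizing M' with
  | broad n h => exact hm hM'
  | recv _ h => exact hm hM'
  | deaf => exact hp hM'
  | disc => exact hp hM'
  | nil => exact hp hM'
  | tau n h => exact hm hM'
  | tau_left N _ ih => exact hpar ih hp hM'
  | tau_right M _ ih => exact hpar hp ih hM'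
  | prop _ _ ih₁ ih₂ => exact hpar ih₁ ih₂ hM'
  | sync_left _ _ ih₁ ih₂ => exact hpar ih₁ ih₂ hM'
  | sync_right _ _ ih₁ ih₂ => exact hpar ih₁ ih₂ hM'

/-- The broadcasting or internally moving node of an action. -/
def SysAct.actor : SysAct S → S.Node
  | .recv m _ _ => m
  | .send m _ _ => m
  | .tau m => m

/-- The actions `m.c!v` and `m.τ`. -/
def SysAct.Active : SysAct S → Prop
  | .recv _ _ _ => False
  | .send _ _ _ => True
  | .tau _ => True

theorem SysStep.actor_mem (h : SysStep D G M α Δ) (hα : α.Active) : α.actor ∈ M.nodes := by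
  induction h with
  | broad n h => exact rfl
  | recv _ h => exact hα.elim
  | deaf => exact hα.elim
  | disc => exact hα.elim
  | nil => exact hα.elim
  | tau n h => exact rfl
  | tau_left N _ ih => exact Or.inl (ih trivial)
  | tau_right M _ ih => exact Or.inr (ih trivial)
  | prop _ _ ih₁ ih₂ => exact hα.elim
  | sync_left _ _ ih₁ ih₂ => exact Or.inl (ih₁ trivial)
  | sync_right _ _ ih₁ ih₂ => exact Or.inr (ih₂ trivial)

/-- Only the connections from the actor and among the nodes of the system matter. -/
theorem SysStep.congr_graph (h : SysStep D G M α Δ)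
    (hGH : ∀ n ∈ M.nodes, G.E α.actor n ↔ H.E α.actor n) : SysStep D H M α Δ := by
  induction h with
  | broad n h => exact .broad n h
  | recv hE h => exact .recv ((hGH _ rfl).1 hE) h
  | deaf m n h => exact .deaf m n h
  | disc s c v hE => exact .disc s c v fun h => hE ((hGH _ rfl).2 h)
  | nil => exact .nil _ _ _
  | tau n h => exact .tau n h
  | tau_left N _ ih => exact .tau_left N (ih fun n hn => hGH n (Or.inl hn))
  | tau_right M _ ih => exact .tau_right M (ih fun n hn => hGH n (Or.inr hn))
  | prop _ _ ih₁ ih₂ =>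
    exact .prop (ih₁ fun n hn => hGH n (Or.inl hn)) (ih₂ fun n hn => hGH n (Or.inr hn))
  | sync_left _ _ ih₁ ih₂ =>
    exact .sync_left (ih₁ fun n hn => hGH n (Or.inl hn)) (ih₂ fun n hn => hGH n (Or.inr hn))
  | sync_right _ _ ih₁ ih₂ =>
    exact .sync_right (ih₁ fun n hn => hGH n (Or.inl hn)) (ih₂ fun n hn => hGH n (Or.inr hn))

theorem SysStep.recv_of_not_edge (D : Defns S) {m : S.Node} {c : S.Chan} {v : S.Val}
    (hE : ∀ n ∈ M.nodes, ¬ G.E m n) : SysStep D G M (.recv m c v) (SubDist.point M) := by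
  induction M with
  | node s n => exact .disc s c v (hE n rfl)
  | par M N ihM ihN =>
    have := SysStep.prop (ihM fun n hn => hE n (Or.inl hn)) (ihN fun n hn => hE n (Or.inr hn))
    rwa [SubDist.map₂_point_left, SubDist.map_point] at this
  | nil => exact .nil m c v

theorem SysStep.eq_point_of_not_edge {m : S.Node} {c : S.Chan} {v : S.Val}
    (h : SysStep D G M (.recv m c v) Δ) (hE : ∀ n ∈ M.nodes, ¬ G.E m n) :
    Δ = SubDist.point M := by
  generalize hα : SysAct.recv m c v = α at h
  induction h with
  | broad n h => cases hα
  | recv hE' h => cases hα; exact absurd hE' (hE _ rfl)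
  | deaf m n h => rfl
  | disc s c v hE => rfl
  | nil => rfl
  | tau n h => cases hα
  | tau_left N _ ih => cases hα
  | tau_right M _ ih => cases hα
  | prop _ _ ih₁ ih₂ =>
    rw [ih₁ (fun n hn => hE n (Or.inl hn)) hα, ih₂ (fun n hn => hE n (Or.inr hn)) hα,
      SubDist.map₂_point_left, SubDist.map_point]
  | sync_left _ _ ih₁ ih₂ => cases hα
  | sync_right _ _ ih₁ ih₂ => cases hα

/-- Nodes out of range or unable to receive stay as they are, so no broadcast is ever blocked by its
environment. -/
theorem SysStep.exists_recv (D : Defns S) (G : ConnGraph S) (M : Sys S) (m : S.Node) (c : S.Chan)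
    (v : S.Val) : ∃ Δ, SysStep D G M (.recv m c v) Δ := by
  induction M with
  | node s n =>
    by_cases hE : G.E m n
    · by_cases h : ∃ Δ, StateStep D s (.recv c v) Δ
      · obtain ⟨Δ, h⟩ := h
        exact ⟨_, .recv hE h⟩
      · exact ⟨_, .deaf m n h⟩
    · exact ⟨_, .disc s c v hE⟩
  | par M N ihM ihN =>
    obtain ⟨Δ, hΔ⟩ := ihM
    obtain ⟨Θ, hΘ⟩ := ihN
    exact ⟨_, .prop hΔ hΘ⟩
  | nil => exact ⟨_, .nil m c v⟩

/-! ### Reception by a set of nodes -/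

/-- The nodes in `η` that can receive `v` on `c` do so, all other nodes are unchanged. -/
inductive Hears (D : Defns S) (η : Set S.Node) (c : S.Chan) (v : S.Val) :
    Sys S → SubDist (Sys S) → Prop
  | recv {s Δ n} : n ∈ η → StateStep D s (.recv c v) Δ →
      Hears D η c v (.node s n) (Δ.map fun t => .node t n)
  | deaf {s} (n) : (¬ ∃ Δ, StateStep D s (.recv c v) Δ) →
      Hears D η c v (.node s n) (SubDist.point (.node s n))
  | disc {n} (s) : n ∉ η → Hears D η c v (.node s n) (SubDist.point (.node s n))
  | nil : Hears D η c v .nil (SubDist.point .nil)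
  | par {M N Δ Θ} : Hears D η c v M Δ → Hears D η c v N Θ →
      Hears D η c v (.par M N) (SubDist.map₂ .par Δ Θ)

/-- The sender enters a reception only through its set of listeners. This lets a broadcast be
answered by a broadcast from a different node with the same listeners outside. -/
theorem SysStep.hears {η : Set S.Node} {m : S.Node} {c : S.Chan} {v : S.Val}
    (h : SysStep D G M (.recv m c v) Δ) (hη : ∀ n ∈ M.nodes, G.E m n ↔ n ∈ η) :
    Hears D η c v M Δ := by
  generalize hα : SysAct.recv m c v = α at h
  induction h with
  | broad n h => cases hα
  | recv hE' h => cases hα; exact .recv ((hη _ rfl).1 hE') h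
  | deaf m n h => cases hα; exact .deaf _ h
  | disc s c v hE => cases hα; exact .disc _ fun h => hE ((hη _ rfl).2 h)
  | nil => exact .nil
  | tau n h => cases hα
  | tau_left N _ ih => cases hα
  | tau_right M _ ih => cases hα
  | prop _ _ ih₁ ih₂ =>
    exact .par (ih₁ (fun n hn => hη n (Or.inl hn)) hα) (ih₂ (fun n hn => hη n (Or.inr hn)) hα)
  | sync_left _ _ ih₁ ih₂ => cases hα
  | sync_right _ _ ih₁ ih₂ => cases hα

theorem Hears.sysStep {η : Set S.Node} {m : S.Node} {c : S.Chan} {v : S.Val}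
    (h : Hears D η c v M Δ) (hη : ∀ n ∈ M.nodes, G.E m n ↔ n ∈ η) :
    SysStep D G M (.recv m c v) Δ := by
  induction h with
  | recv hE h => exact .recv ((hη _ rfl).2 hE) h
  | deaf n h => exact .deaf m n h
  | disc s hE => exact .disc s c v fun h => hE ((hη _ rfl).1 h)
  | nil => exact .nil m c v
  | par _ _ ih₁ ih₂ =>
    exact .prop (ih₁ fun n hn => hη n (Or.inl hn)) (ih₂ fun n hn => hη n (Or.inr hn))

theorem Hears.nodes_eq {η : Set S.Node} {c : S.Chan} {v : S.Val} (h : Hears D η c v M Δ)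
    (hM' : Δ M' ≠ 0) : M'.nodes = M.nodes := by
  induction h generalizing M' with
  | recv =>
    obtain ⟨t, -, rfl⟩ := SubDist.map_ne_zero.1 hM'
    rfl
  | deaf => rw [SubDist.point_ne_zero.1 hM']
  | disc => rw [SubDist.point_ne_zero.1 hM']
  | nil => rw [SubDist.point_ne_zero.1 hM']
  | par _ _ ih₁ ih₂ =>
    obtain ⟨a, b, ha, hb, rfl⟩ := SubDist.map₂_ne_zero.1 hM'
    exact congrArg₂ (· ∪ ·) (ih₁ ha) (ih₂ hb)

theorem Hears.mass {η : Set S.Node} {c : S.Chan} {v : S.Val} (h : Hears D η c v M Δ) :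
    ∑' M', Δ M' = 1 := by
  induction h with
  | recv _ h => rw [SubDist.tsum_map_mass]; exact h.finite_mass.2
  | deaf => exact SubDist.tsum_point_mass _
  | disc => exact SubDist.tsum_point_mass _
  | nil => exact SubDist.tsum_point_mass _
  | par _ _ ih₁ ih₂ => rw [SubDist.tsum_map₂_mass, ih₁, ih₂, one_mul]

/-- Reception by two disjoint sets of nodes may be performed one after the other. -/
theorem Hears.split {η₁ η₂ : Set S.Node} {c : S.Chan} {v : S.Val} (hη : η₁ ∩ η₂ = ∅)
    (h : Hears D (η₁ ∪ η₂) c v M Δ) : ∃ (Δ₁ : SubDist (Sys S)) (Ξ : Sys S → SubDist (Sys S)),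
      Hears D η₁ c v M Δ₁ ∧ (∀ M', Δ₁ M' ≠ 0 → Hears D η₂ c v M' (Ξ M')) ∧ Δ = Δ₁.bind Ξ := by
  have hdisj : ∀ n, n ∈ η₁ → n ∉ η₂ := fun n h₁ h₂ =>
    Set.notMem_empty n (hη ▸ ⟨h₁, h₂⟩)
  have hbind : ∀ (M : Sys S) (Ξ : Sys S → SubDist (Sys S)), Ξ M = (SubDist.point M).bind Ξ :=
    fun M Ξ => SubDist.ext_tsum fun g => by
      rw [SubDist.tsum_bind, SubDist.tsum_point M fun x => ∑' y, Ξ x y * g y]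
  have hbind' : ∀ Δ : SubDist (Sys S), Δ = Δ.bind SubDist.point :=
    fun Δ => SubDist.ext_tsum fun g => by
      rw [SubDist.tsum_bind]; simp_rw [SubDist.tsum_point]
  induction h with
  | @recv s Δ n hn h =>
    by_cases h₁ : n ∈ η₁
    · refine ⟨_, SubDist.point, .recv h₁ h, fun M' hM' => ?_, hbind' _⟩
      obtain ⟨t, -, rfl⟩ := SubDist.map_ne_zero.1 hM'
      exact .disc t (hdisj n h₁)
    · refine ⟨_, fun _ => Δ.map fun t => .node t n, .disc s h₁, fun M' hM' => ?_,
        hbind (.node s n) fun _ => Δ.map fun t => .node t n⟩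
      rw [SubDist.point_ne_zero.1 hM']
      exact .recv (hn.resolve_left h₁) h
  | deaf n h =>
    refine ⟨_, SubDist.point, .deaf n h, fun M' hM' => ?_, hbind' _⟩
    rw [SubDist.point_ne_zero.1 hM']
    exact .deaf n h
  | disc s hn =>
    refine ⟨_, SubDist.point, .disc s fun h => hn (Or.inl h), fun M' hM' => ?_, hbind' _⟩
    rw [SubDist.point_ne_zero.1 hM']
    exact .disc s fun h => hn (Or.inr h)
  | nil =>
    refine ⟨_, SubDist.point, .nil, fun M' hM' => ?_, hbind' _⟩
    rw [SubDist.point_ne_zero.1 hM']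
    exact .nil
  | par _ _ ih₁ ih₂ =>
    obtain ⟨Δ₁, Ξ₁, h₁, h₁', rfl⟩ := ih₁
    obtain ⟨Δ₂, Ξ₂, h₂, h₂', rfl⟩ := ih₂
    -- Only parallel compositions occur after the first reception; the other values of `Ξ` are
    -- irrelevant.
    let Ξ : Sys S → SubDist (Sys S) := fun M => match M with
      | .par a b => SubDist.map₂ .par (Ξ₁ a) (Ξ₂ b)
      | M => SubDist.point M
    refine ⟨_, Ξ, .par h₁ h₂, fun M' hM' => ?_, SubDist.ext_tsum fun g => ?_⟩
    · obtain ⟨a, b, ha, hb, rfl⟩ := SubDist.map₂_ne_zero.1 hM'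
      exact .par (h₁' a ha) (h₂' b hb)
    · rw [SubDist.tsum_bind, SubDist.tsum_map₂, SubDist.tsum_map₂]
      simp only [Ξ, SubDist.tsum_map₂, mul_assoc, ENNReal.tsum_mul_left]
      rw [SubDist.tsum_bind]
      refine tsum_congr fun a => ?_
      congr 1
      have : ∀ x, Ξ₁ a x * ∑' y, (Δ₂.bind Ξ₂) y * g (x.par y) =
          ∑' b, Δ₂ b * (Ξ₁ a x * ∑' y, Ξ₂ b y * g (x.par y)) := by
        intro x
        rw [SubDist.tsum_bind, ← ENNReal.tsum_mul_left]
        exact tsum_congr fun b => mul_left_comm _ _ _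
      simp_rw [this]
      rw [ENNReal.tsum_comm]
      simp_rw [ENNReal.tsum_mul_left]

/-- A success brought about by a reception is not undone by a later reception by other nodes. -/
theorem Hears.success_of_success {η₁ η₂ : Set S.Node} {c : S.Chan} {v : S.Val} (hη : η₁ ∩ η₂ = ∅)
    {Δ₁ Δ₂ : SubDist (Sys S)} {M₁ M₂ : Sys S} (hM : ¬ M.Success D)
    (h₁ : Hears D η₁ c v M Δ₁) (hM₁ : Δ₁ M₁ ≠ 0) (hs : M₁.Success D)
    (h₂ : Hears D η₂ c v M₁ Δ₂) (hM₂ : Δ₂ M₂ ≠ 0) : M₂.Success D := by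
  induction h₁ generalizing M₁ M₂ Δ₂ with
  | @recv s Δ n hn h =>
    obtain ⟨t, -, rfl⟩ := SubDist.map_ne_zero.1 hM₁
    cases h₂ with
    | recv hn' _ => exact absurd (hη ▸ ⟨hn, hn'⟩ : n ∈ (∅ : Set S.Node)) (Set.notMem_empty n)
    | deaf => rwa [SubDist.point_ne_zero.1 hM₂]
    | disc => rwa [SubDist.point_ne_zero.1 hM₂]
  | deaf => rw [SubDist.point_ne_zero.1 hM₁] at hs; exact absurd hs hM
  | disc => rw [SubDist.point_ne_zero.1 hM₁] at hs; exact absurd hs hM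
  | nil => rw [SubDist.point_ne_zero.1 hM₁] at hs; exact absurd hs hM
  | par _ _ ih₁ ih₂ =>
    obtain ⟨a, b, ha, hb, rfl⟩ := SubDist.map₂_ne_zero.1 hM₁
    cases h₂ with
    | par h₁ h₂ =>
      obtain ⟨a', b', ha', hb', rfl⟩ := SubDist.map₂_ne_zero.1 hM₂
      rw [Sys.success_par] at hM hs ⊢
      push Not at hM
      exact hs.imp (fun h => ih₁ hM.1 ha h h₁ ha') fun h => ih₂ hM.2 hb h h₂ hb'

end Semantics

/-! ## Networks running with a test -/

namespace Network

variable {S : Signature.{u}} {D : Defns S}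

/-- The network `x` composed with the system `t` placed on the test graph `G`. -/
def run (G : ConnGraph S) (x : Network S) (t : Sys S) : Network S := x.compose ⟨G, t⟩

/-- `x` has the same graph and the same nodes as `M`. -/
def SameShape (M x : Network S) : Prop := x.graph = M.graph ∧ x.nodes = M.nodes

/-- The conditions under which the network `x` interacts with tests `t` on the graph `G` only
through its interface. -/
structure Interacts (G : ConnGraph S) (x : Network S) (t : Sys S) : Prop where
  edge : ∀ m n, x.graph.E m n → m ∈ x.nodes ∨ n ∈ x.nodes
  mem_graph : x.nodes ⊆ x.graph.V
  disjoint : x.nodes ∩ G.V = ∅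
  test_mem : t.nodes ⊆ G.V

variable {G : ConnGraph S} {x y M N : Network S} {t : Sys S}

theorem success_run : (run G x t).Success D ↔ x.Success D ∨ t.Success D :=
  Sys.success_par

theorem SameShape.trans (h : SameShape M x) (h' : SameShape x y) : SameShape M y :=
  ⟨h'.1.trans h.1, h'.2.trans h.2⟩

theorem Interacts.of_sameShape (h : Interacts G M t) (hx : SameShape M x) {t' : Sys S}
    (ht : t'.nodes = t.nodes) : Interacts G x t' where
  edge m n := by rw [hx.1, hx.2]; exact h.edge m n
  mem_graph := by rw [hx.1, hx.2]; exact h.mem_graph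
  disjoint := by rw [hx.2]; exact h.disjoint
  test_mem := by rw [ht]; exact h.test_mem

theorem Interacts.notMem_graph (h : Interacts G x t) {m : S.Node} (hm : m ∈ x.nodes) :
    m ∉ G.V := fun hm' => Set.notMem_empty m (h.disjoint ▸ ⟨hm, hm'⟩)

theorem Interacts.notMem_nodes (h : Interacts G x t) {m : S.Node} (hm : m ∈ t.nodes) :
    m ∉ x.nodes := fun hm' => h.notMem_graph hm' (h.test_mem hm)

theorem Interacts.union_edge_of_left_mem (h : Interacts G x t) {m : S.Node} (hm : m ∈ x.nodes)
    (n : S.Node) : (x.graph.union G).E m n ↔ x.graph.E m n :=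
  or_iff_left fun hE => h.notMem_graph hm (G.left_mem m n hE)

theorem Interacts.union_edge_of_right_mem (h : Interacts G x t) {n : S.Node} (hn : n ∈ x.nodes)
    (m : S.Node) : (x.graph.union G).E m n ↔ x.graph.E m n :=
  or_iff_left fun hE => h.notMem_graph hn (G.right_mem m n hE)

theorem Interacts.union_edge_of_test (h : Interacts G x t) {m n : S.Node} (hm : m ∈ t.nodes)
    (hn : n ∈ t.nodes) : (x.graph.union G).E m n ↔ G.E m n :=
  or_iff_right fun hE => (h.edge m n hE).elim (h.notMem_nodes hm) (h.notMem_nodes hn)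

theorem Interacts.mem_interface (h : Interacts G x t) {n : S.Node} (hn : n ∈ t.nodes)
    (hV : n ∈ x.graph.V) : n ∈ x.interface := ⟨hV, h.notMem_nodes hn⟩

theorem Interacts.mem_inputs (h : Interacts G x t) {m n : S.Node} (hm : m ∈ t.nodes)
    (hE : x.graph.E m n) : m ∈ x.inputs :=
  ⟨h.mem_interface hm (x.graph.left_mem m n hE), n, hE⟩

theorem Interacts.mem_outputs (h : Interacts G x t) {m n : S.Node} (hn : n ∈ t.nodes)
    (hE : x.graph.E m n) : n ∈ x.outputs :=
  ⟨h.mem_interface hn (x.graph.right_mem m n hE), m, hE⟩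

theorem place_map₂_par {Δ : SubDist (Sys S)} {Θ : SubDist (Sys S)} :
    (x.graph.union G).place (SubDist.map₂ .par Δ Θ) =
      SubDist.map₂ (run G) (x.graph.place Δ) Θ :=
  SubDist.ext_tsum fun g => by
    simp only [ConnGraph.place, SubDist.tsum_map, SubDist.tsum_map₂, mul_assoc,
      ENNReal.tsum_mul_left]
    rfl

theorem place_point (x : Network S) : x.graph.place (SubDist.point x.sys) = SubDist.point x :=
  SubDist.map_point _ _

/-- Strong extensional actions are intensional actions of unsuccessful networks. -/
theorem ExtStep.exists_sysStep {l : ExtAct S} {Ξ : SubDist (Network S)} (h : x.ExtStep D l Ξ) :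
    ¬ x.Success D ∧ ∃ α Δ₀, Ξ = x.graph.place Δ₀ ∧ SysStep D x.graph x.sys α Δ₀ := by
  cases l with
  | tau =>
    obtain ⟨hs, Δ₀, hΞ, ⟨m, h⟩ | ⟨n, c, v, h, -⟩⟩ := h
    exacts [⟨hs, _, Δ₀, hΞ, h⟩, ⟨hs, _, Δ₀, hΞ, h⟩]
  | input n c v =>
    obtain ⟨hs, Δ₀, hΞ, h, -⟩ := h
    exact ⟨hs, _, Δ₀, hΞ, h⟩
  | output c v η =>
    obtain ⟨hs, Δ₀, hΞ, m, h, -⟩ := h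
    exact ⟨hs, _, Δ₀, hΞ, h⟩

theorem ExtStep.sameShape {l : ExtAct S} {Ξ : SubDist (Network S)} (h : x.ExtStep D l Ξ)
    (hy : Ξ y ≠ 0) : SameShape x y := by
  obtain ⟨-, α, Δ₀, rfl, hs⟩ := h.exists_sysStep
  obtain ⟨M, hM, rfl⟩ := SubDist.map_ne_zero.1 hy
  exact ⟨rfl, hs.nodes_eq hM⟩

theorem ExtStep.mass {l : ExtAct S} {Ξ : SubDist (Network S)} (h : x.ExtStep D l Ξ) :
    ∑' y, Ξ y = 1 := by
  obtain ⟨-, α, Δ₀, rfl, hs⟩ := h.exists_sysStep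
  exact (SubDist.tsum_map_mass _ _).trans hs.finite_mass.2

theorem ExtStep.support_finite {l : ExtAct S} {Ξ : SubDist (Network S)} (h : x.ExtStep D l Ξ) :
    Ξ.support.Finite := by
  obtain ⟨-, α, Δ₀, rfl, hs⟩ := h.exists_sysStep
  exact SubDist.support_map_finite hs.finite_mass.1

theorem Red.support_finite {Ξ : SubDist (Network S)} (h : x.Red D Ξ) : Ξ.support.Finite := by
  obtain ⟨Δ₀, rfl, ⟨m, -, h⟩ | ⟨m, c, v, h⟩⟩ := h
  all_goals exact SubDist.support_map_finite h.finite_mass.1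

theorem Reachable.sameShape (h : M.Reachable D x) : SameShape M x := by
  induction h with
  | refl => exact ⟨rfl, rfl⟩
  | tail _ h ih =>
    obtain ⟨l, Δ, h, hy⟩ := h
    exact ih.trans (h.sameShape hy)

/-! ### Reductions of a network that runs with a test -/

/-- No vertex of the test graph is a node of `x`, so the union adds no edge into these nodes,
whoever the sender is. -/
theorem Interacts.sysStep_union (h : Interacts G x t) {α : SysAct S} {Δ₀ : SubDist (Sys S)} :
    SysStep D (x.graph.union G) x.sys α Δ₀ ↔ SysStep D x.graph x.sys α Δ₀ :=
  ⟨fun hs => hs.congr_graph fun _ hn => h.union_edge_of_right_mem hn _,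
   fun hs => hs.congr_graph fun _ hn => (h.union_edge_of_right_mem hn _).symm⟩

/-- The graph of `x` has no edge between two test nodes, as each of its edges touches a node of `x`.
The action must be active because receptions by the test may come from a sender inside `x`. -/
theorem Interacts.test_sysStep_union (h : Interacts G x t) {α : SysAct S} (hα : α.Active)
    {Δ₀ : SubDist (Sys S)} :
    SysStep D (x.graph.union G) t α Δ₀ ↔ SysStep D G t α Δ₀ :=
  ⟨fun hs => hs.congr_graph fun _ hn => h.union_edge_of_test (hs.actor_mem hα) hn,
   fun hs => hs.congr_graph fun _ hn => (h.union_edge_of_test (hs.actor_mem hα) hn).symm⟩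

theorem red_of_sync {m : S.Node} {c : S.Chan} {v : S.Val} {Δ₀ Θ : SubDist (Sys S)}
    (hx : SysStep D (x.graph.union G) x.sys (.send m c v) Δ₀)
    (ht : SysStep D (x.graph.union G) t (.recv m c v) Θ) :
    (run G x t).Red D (SubDist.map₂ (run G) (x.graph.place Δ₀) Θ) :=
  ⟨_, place_map₂_par.symm, Or.inr ⟨m, c, v, .sync_left hx ht⟩⟩

theorem red_of_sync_right {m : S.Node} {c : S.Chan} {v : S.Val} {Δ₀ Θ : SubDist (Sys S)}
    (hx : SysStep D (x.graph.union G) x.sys (.recv m c v) Δ₀)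
    (ht : SysStep D (x.graph.union G) t (.send m c v) Θ) :
    (run G x t).Red D (SubDist.map₂ (run G) (x.graph.place Δ₀) Θ) :=
  ⟨_, place_map₂_par.symm, Or.inr ⟨m, c, v, .sync_right hx ht⟩⟩

theorem ExtStep.red_tau (h : Interacts G x t) {Ξ : SubDist (Network S)}
    (hs : x.ExtStep D .tau Ξ) : (run G x t).Red D (Ξ.map (run G · t)) := by
  rw [← SubDist.map₂_point_right]
  obtain ⟨-, Δ₀, rfl, ⟨m, hs⟩ | ⟨m, c, v, hs, hE⟩⟩ := hs
  · exact ⟨_, place_map₂_par.symm, Or.inl ⟨m, Or.inl (hs.actor_mem trivial),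
      .tau_left _ (h.sysStep_union.2 hs)⟩⟩
  · refine red_of_sync (h.sysStep_union.2 hs) (.recv_of_not_edge D fun n hn hE' => ?_)
    rw [h.union_edge_of_left_mem (m := m) (hs.actor_mem trivial)] at hE'
    exact h.notMem_nodes hn (hE n hE')

theorem ExtStep.red_output (h : Interacts G x t) {c : S.Chan} {v : S.Val} {η : Set S.Node}
    {Ξ : SubDist (Network S)} {Θ : SubDist (Sys S)} (hs : x.ExtStep D (.output c v η) Ξ)
    (ht : Hears D η c v t Θ) : (run G x t).Red D (SubDist.map₂ (run G) Ξ Θ) := by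
  obtain ⟨-, Δ₀, rfl, m, hs, rfl, -⟩ := hs
  refine red_of_sync (h.sysStep_union.2 hs) (ht.sysStep fun n hn => ?_)
  rw [h.union_edge_of_left_mem (m := m) (hs.actor_mem trivial)]
  exact ⟨fun hE => ⟨h.mem_outputs hn hE, hE⟩, fun hE => hE.2⟩

theorem ExtStep.red_input (h : Interacts G x t) {m : S.Node} {c : S.Chan} {v : S.Val}
    {Ξ : SubDist (Network S)} {Θ : SubDist (Sys S)} (hs : x.ExtStep D (.input m c v) Ξ)
    (ht : SysStep D G t (.send m c v) Θ) : (run G x t).Red D (SubDist.map₂ (run G) Ξ Θ) := by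
  obtain ⟨-, Δ₀, rfl, hs, -⟩ := hs
  exact red_of_sync_right (h.sysStep_union.2 hs) ((h.test_sysStep_union (α := .send m c v) trivial).2 ht)

/-- Actions of the test that do not influence `x`. -/
def Unheard (x : Network S) : SysAct S → Prop
  | .recv _ _ _ => False
  | .send m _ _ => m ∉ x.inputs
  | .tau _ => True

theorem Unheard.active {α : SysAct S} (h : Unheard x α) : α.Active := by
  cases α with
  | recv => exact h.elim
  | send => trivial
  | tau => trivial

theorem Interacts.red_test (h : Interacts G x t) {α : SysAct S} (hα : Unheard x α)
    {Θ : SubDist (Sys S)} (ht : SysStep D G t α Θ) :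
    (run G x t).Red D (SubDist.map₂ (run G) (SubDist.point x) Θ) := by
  have ht' := (h.test_sysStep_union (Unheard.active hα)).2 ht
  rw [← place_point x]
  cases α with
  | recv => exact hα.elim
  | send m c v =>
    refine red_of_sync_right (.recv_of_not_edge D fun n hn hE => ?_) ht'
    rw [h.union_edge_of_right_mem hn] at hE
    exact hα (h.mem_inputs (ht.actor_mem trivial) hE)
  | tau m =>
    exact ⟨_, place_map₂_par.symm, Or.inl ⟨m, Or.inr (ht.actor_mem trivial), .tau_right _ ht'⟩⟩

/-- The reductions of `x` running with `t`, in terms of extensional actions of `x`. -/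
theorem Interacts.red_cases (h : Interacts G x t) (hsucc : ¬ x.Success D)
    {Ξ : SubDist (Network S)} (hr : (run G x t).Red D Ξ) :
    (∃ Δ, x.ExtStep D .tau Δ ∧ Ξ = Δ.map (run G · t)) ∨
    (∃ c v η Δ Θ, x.ExtStep D (.output c v η) Δ ∧ Hears D η c v t Θ ∧
      Ξ = SubDist.map₂ (run G) Δ Θ) ∨
    (∃ m c v Δ Θ, x.ExtStep D (.input m c v) Δ ∧ SysStep D G t (.send m c v) Θ ∧
      Ξ = SubDist.map₂ (run G) Δ Θ) ∨
    ∃ α Θ, Unheard x α ∧ SysStep D G t α Θ ∧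
      Ξ = SubDist.map₂ (run G) (SubDist.point x) Θ := by
  obtain ⟨Δ₀, rfl, ⟨m, -, hs⟩ | ⟨m, c, v, hs⟩⟩ := hr
  · generalize hα : SysAct.tau m = α at hs
    cases hs with
    | tau_left _ hs =>
      left
      refine ⟨_, ⟨hsucc, _, rfl, Or.inl ⟨_, h.sysStep_union.1 hs⟩⟩, ?_⟩
      rw [← SubDist.map₂_point_right]
      exact place_map₂_par
    | tau_right _ hs =>
      right; right; right
      refine ⟨.tau _, _, ?_, (h.test_sysStep_union (α := .tau _) trivial).1 hs, ?_⟩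
      · trivial
      · rw [← place_point x]
        exact place_map₂_par
    | prop => cases hα
    | sync_left => cases hα
    | sync_right => cases hα
  · generalize hα : SysAct.send m c v = α at hs
    cases hs with
    | tau_left => cases hα
    | tau_right => cases hα
    | prop => cases hα
    | @sync_left _ _ _ _ _ Δ Θ hs ht =>
      cases hα
      have hm : m ∈ x.nodes := hs.actor_mem trivial
      have hs' := h.sysStep_union.1 hs
      by_cases hE : ∀ n, x.graph.E m n → n ∈ x.nodes
      · left
        refine ⟨_, ⟨hsucc, _, rfl, Or.inr ⟨m, c, v, hs', hE⟩⟩, ?_⟩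
        rw [ht.eq_point_of_not_edge fun n hn hE' => h.notMem_nodes hn
          (hE n ((h.union_edge_of_left_mem hm n).1 hE')), ← SubDist.map₂_point_right]
        exact place_map₂_par
      · right; left
        push Not at hE
        obtain ⟨n, hE, hn⟩ := hE
        refine ⟨c, v, {o | o ∈ x.outputs ∧ x.graph.E m o}, _, Θ,
          ⟨hsucc, _, rfl, m, hs', rfl, n, ⟨⟨x.graph.right_mem m n hE, hn⟩, m, hE⟩, hE⟩,
          ht.hears fun n hn => ?_, place_map₂_par⟩
        change (x.graph.union G).E m n ↔ _
        rw [h.union_edge_of_left_mem hm]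
        exact ⟨fun hE => ⟨h.mem_outputs hn hE, hE⟩, fun hE => hE.2⟩
    | @sync_right _ _ _ _ _ Δ Θ hs ht =>
      cases hα
      have hm : m ∈ t.nodes := ht.actor_mem trivial
      have ht' := (h.test_sysStep_union (α := .send m c v) trivial).1 ht
      have hs' := h.sysStep_union.1 hs
      right; right
      by_cases hin : m ∈ x.inputs
      · exact Or.inl ⟨m, c, v, _, Θ, ⟨hsucc, _, rfl, hs', hin⟩, ht', place_map₂_par⟩
      · refine Or.inr ⟨.send m c v, Θ, hin, ht', ?_⟩
        rw [hs'.eq_point_of_not_edge fun n _ hE => hin (h.mem_inputs hm hE), ← place_point x]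
        exact place_map₂_par

theorem Interacts.exists_red_of_test (h : Interacts G x t) {α : SysAct S} (hα : α.Active)
    {Θ : SubDist (Sys S)} (ht : SysStep D G t α Θ) : ∃ Ξ, (run G x t).Red D Ξ := by
  cases α with
  | recv => exact hα.elim
  | send m c v =>
    obtain ⟨Δ, hΔ⟩ := SysStep.exists_recv D (x.graph.union G) x.sys m c v
    exact ⟨_, red_of_sync_right hΔ ((h.test_sysStep_union (α := .send m c v) trivial).2 ht)⟩
  | tau m => exact ⟨_, h.red_test (α := .tau m) trivial ht⟩

/-- An internal move or output of `x` is always a reduction of the composition, as the test cannot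
block it. Together with `exists_red_of_test`, this splits a stuck composition into a deadlocked
network and a test without active steps, and the latter condition no longer mentions `x`. -/
theorem Interacts.deadlocked_of_not_red (h : Interacts G x t) (hsucc : ¬ x.Success D)
    (hr : ¬ ∃ Ξ, (run G x t).Red D Ξ) : x.Deadlocked D := by
  refine ⟨hsucc, fun ⟨Δ, hΔ⟩ => hr ⟨_, hΔ.red_tau h⟩, fun c v η ⟨Δ, hΔ⟩ => hr ?_⟩
  obtain ⟨-, Δ₀, -, m, hs, -⟩ := hΔ
  obtain ⟨Θ, hΘ⟩ := SysStep.exists_recv D (x.graph.union G) t m c v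
  exact ⟨_, red_of_sync (h.sysStep_union.2 hs) hΘ⟩

theorem Interacts.not_red_of_deadlocked (h : Interacts G x t) (hx : x.Deadlocked D)
    (ht : ∀ α Θ, α.Active → ¬ SysStep D G t α Θ) : ¬ ∃ Ξ, (run G x t).Red D Ξ := by
  rintro ⟨Ξ, hr⟩
  rcases h.red_cases hx.1 hr with ⟨Δ, hΔ, -⟩ | ⟨c, v, η, Δ, Θ, hΔ, -⟩ |
    ⟨m, c, v, Δ, Θ, -, hΘ, -⟩ | ⟨α, Θ, hα, hΘ, -⟩
  · exact hx.2.1 ⟨Δ, hΔ⟩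
  · exact hx.2.2 c v η ⟨Δ, hΔ⟩
  · exact ht (.send m c v) Θ trivial hΘ
  · exact ht α Θ (Unheard.active hα) hΘ

end Network

/-! ## Weak extensional actions of a network that runs with a test -/

namespace Network

variable {S : Signature.{u}} {D : Defns S} {G : ConnGraph S} {M x y : Network S} {t : Sys S}

theorem SameShape.refl (M : Network S) : SameShape M M := ⟨rfl, rfl⟩

/-- The test and the network of a composition, for networks on the graph of `M`. -/
def unrun (M z : Network S) : Sys S × Network S :=
  match z.sys with
  | .par a b => (b, ⟨M.graph, a⟩)
  | s => (s, z)

theorem unrun_run (hy : SameShape M y) : unrun M (run G y t) = (t, y) := by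
  obtain ⟨g, s⟩ := y
  obtain ⟨rfl, -⟩ := hy
  rfl

/-- `Can`, for the reductions of networks. -/
abbrev RunCan (D : Defns S) := Can (Red D) (Success D)

/-- `CanStep`, for the reductions of networks. -/
abbrev RunStep (D : Defns S) := CanStep (Red D) (Success D)

/-- `CanPlus`, for the reductions of networks. -/
abbrev RunPlus (D : Defns S) := CanPlus (Red D) (Success D)

/-- Prices are given on pairs of test and network, but a reduction needs them on composed states. On
networks with the graph of `M`, `unrun` recovers the pair. -/
theorem runStep_of_map₂ {C : Network S → ℝ≥0∞ → Prop} (hns : ¬ (run G x t).Success D)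
    {Ξ : SubDist (Network S)} {Θ : SubDist (Sys S)}
    (hr : (run G x t).Red D (SubDist.map₂ (run G) Ξ Θ))
    (hΞ : ∀ y, Ξ y ≠ 0 → SameShape M y) {f : Sys S × Network S → ℝ≥0∞} {w : ℝ≥0∞}
    (hf : ∀ y t', Ξ y ≠ 0 → Θ t' ≠ 0 → C (run G y t') (f (t', y)))
    (hw : ∑' y, Ξ y * ∑' t', Θ t' * f (t', y) ≤ w) : RunStep D C (run G x t) w := by
  refine Or.inr ⟨hns, _, hr, fun z => f (unrun M z), le_trans (le_of_eq ?_) hw, fun z hz => ?_⟩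
  · rw [SubDist.tsum_map₂]
    refine tsum_congr fun y => ?_
    simp_rw [mul_assoc, ENNReal.tsum_mul_left]
    by_cases hy : Ξ y = 0
    · simp [hy]
    · simp_rw [unrun_run (hΞ y hy)]
  · obtain ⟨y, t', hy, ht', rfl⟩ := SubDist.map₂_ne_zero.1 hz
    simp only [unrun_run (hΞ y hy)]
    exact hf y t' hy ht'

/-- Internal moves of the network are reductions of the composition with the test standing still.
The test must be unsuccessful, since successful states may not move on. -/
theorem runCan_of_attains {C : Network S → ℝ≥0∞ → Prop} (hI : Interacts G M t)
    (ht : ¬ t.Success D) {C' : Network S → ℝ≥0∞ → Prop}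
    (hC : ∀ y w, C' y w → SameShape M y ∧ C (run G y t) w) (hx : SameShape M x) {w : ℝ≥0∞}
    (h : Attains (fun M Δ => M.ExtStep D .tau Δ) (Success D) C' x w) :
    RunCan D C (run G x t) w := by
  refine ⟨fun z w => ∃ x, SameShape M x ∧ z = run G x t ∧
    Attains (fun M Δ => M.ExtStep D .tau Δ) (Success D) C' x w, ⟨x, hx, rfl, h⟩, ?_⟩
  rintro _ w ⟨x, hx, rfl, h⟩
  rcases h.cases with ⟨w₀, hle, h0⟩ | ⟨hs, Ξ, hr, w', hw, hy⟩
  · exact Or.inl ⟨w₀, hle, Or.inl (hC x w₀ h0).2⟩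
  · have hΞ : ∀ y, Ξ y ≠ 0 → SameShape M y := fun y hy => hx.trans (hr.sameShape hy)
    have hred := hr.red_tau (hI.of_sameShape hx rfl)
    refine Or.inr ⟨fun h => (success_run.1 h).elim hs ht, _, hred,
      fun z => w' (unrun M z).2, le_trans (le_of_eq ?_) hw, fun z hz => ?_⟩
    · rw [SubDist.tsum_map]
      refine tsum_congr fun y => ?_
      by_cases hy : Ξ y = 0
      · simp [hy]
      · rw [unrun_run (hΞ y hy)]
    · obtain ⟨y, hy', rfl⟩ := SubDist.map_ne_zero.1 hz
      simp only [unrun_run (hΞ y hy')]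
      exact ⟨y, hΞ y hy', rfl, hy y hy'⟩

theorem ExtHyper.sameShape {Φ Φ' : SubDist (Network S)} (h : ExtHyper D Φ Φ')
    (hΦ : ∀ x, Φ x ≠ 0 → SameShape M x) : ∀ x, Φ' x ≠ 0 → SameShape M x :=
  HyperDer.support_subset (fun _ _ hx hr _ hy => hx.trans (hr.sameShape hy)) h hΦ

/-- Weak internal moves of the network, while the test does nothing. -/
theorem ExtHyper.weakly (hI : Interacts G M t) (ht : ¬ t.Success D) {Φ Φ' : SubDist (Network S)}
    (h : ExtHyper D Φ Φ') (hΦ : ∀ x, Φ x ≠ 0 → SameShape M x) :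
    Weakly (RunCan D) (run G · t) Φ 0 (run G · t) Φ' := by
  obtain ⟨κ, hκ, hatt⟩ := HyperDer.exists_kernel h
  refine ⟨fun _ => 0, κ, by simp, hκ, fun x hx C f hf => ?_⟩
  rw [zero_add]
  exact runCan_of_attains hI ht (fun _ _ h => h) (hΦ x hx)
    (hatt x hx (fun y w => SameShape M y ∧ C (run G y t) w) f fun y hy =>
      ⟨ExtHyper.sameShape h hΦ y hy, hf y hy⟩)

/-- The step of each `x` is selected for prices already averaged over the test's move `Θ`, so that
one selection serves all outcomes of the test. -/
theorem _root_.Lift.runStep_weakly {l : ExtAct S} (ht : ¬ t.Success D)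
    {Δ₁ Δ₂ : SubDist (Network S)} (h : Lift (fun M Θ => M.ExtStep D l Θ) Δ₁ Δ₂)
    (hΔ : ∀ x, Δ₁ x ≠ 0 → SameShape M x) {Θ : SubDist (Sys S)}
    (hred : ∀ x Ξ, SameShape M x → x.ExtStep D l Ξ →
      (run G x t).Red D (SubDist.map₂ (run G) Ξ Θ)) :
    Weakly (RunStep D) (run G · t) Δ₁ 0 (fun p : Sys S × Network S => run G p.2 p.1)
      (fun p => Δ₂ p.2 * Θ p.1) := by
  obtain ⟨k, hk, hbest⟩ := h.exists_kernel
  refine ⟨fun _ => 0, fun x p => k x p.2 * Θ p.1, by simp, fun p => ?_, fun x hx C f hf => ?_⟩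
  · simp_rw [← mul_assoc, ENNReal.tsum_mul_right, ← hk]
  · obtain ⟨Ξ, hr, hsupp, hle⟩ := hbest x hx fun y => ∑' t', Θ t' * f (t', y)
    refine runStep_of_map₂ (M := M) (fun h => (success_run.1 h).elim hr.exists_sysStep.1 ht)
      (hred x Ξ (hΔ x hx) hr) (fun y hy => (hΔ x hx).trans (hr.sameShape hy))
      (fun y t' hy ht' => hf (t', y) (mul_ne_zero (hsupp hy) ht')) (hle.trans (le_of_eq ?_))
    rw [zero_add, ENNReal.tsum_prod', ENNReal.tsum_comm]
    simp_rw [mul_assoc, ENNReal.tsum_mul_left]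

/-- A step of the test alone. -/
theorem weakly_of_test (hI : Interacts G M t) (ht : ¬ t.Success D) {α : SysAct S}
    {Θ : SubDist (Sys S)} (hα : Unheard M α) (hs : SysStep D G t α Θ) {Φ : SubDist (Network S)}
    (hΦ : ∀ x, Φ x ≠ 0 → SameShape M x ∧ ¬ x.Success D) :
    Weakly (RunStep D) (run G · t) Φ 0 (fun p : Sys S × Network S => run G p.2 p.1)
      (fun p => Φ p.2 * Θ p.1) := by
  classical
  refine ⟨fun _ => 0, fun x p => (if p.2 = x then 1 else 0) * Θ p.1, by simp, fun p => ?_,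
    fun x hx C f hf => ?_⟩
  · rw [tsum_eq_single p.2 fun x hx => by simp [hx.symm]]
    simp
  · obtain ⟨hxM, hxs⟩ := hΦ x hx
    have hα' : Unheard x α := by
      cases α with
      | recv => exact hα
      | tau => exact hα
      | send m c v =>
        change m ∉ x.inputs
        have : x.inputs = M.inputs := by
          unfold inputs interface
          rw [hxM.1, hxM.2]
        rw [this]
        exact hα
    refine runStep_of_map₂ (M := M) (f := f) (fun h => (success_run.1 h).elim hxs ht)
      ((hI.of_sameShape hxM rfl).red_test hα' hs) (fun y hy => ?_) (fun y t' hy ht' => ?_) ?_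
    · rw [SubDist.point_ne_zero.1 hy]; exact hxM
    · rw [SubDist.point_ne_zero.1 hy]
      exact hf (t', x) (mul_ne_zero hx ht')
    · rw [SubDist.tsum_point, zero_add, ENNReal.tsum_prod', ENNReal.tsum_comm]
      rw [tsum_eq_single x fun y hy => by simp [hy]]
      simp

open Classical in
/-- The probability of a successful test. -/
def testSuccess (D : Defns S) (Θ : SubDist (Sys S)) : ℝ≥0∞ :=
  ∑' t, if t.Success D then Θ t else 0

open Classical in
/-- The part of the product of `Φ` and `Θ` where the test is not successful. -/
def openPart (D : Defns S) (Φ : SubDist (Network S)) (Θ : SubDist (Sys S))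
    (p : Sys S × Network S) : ℝ≥0∞ :=
  if p.1.Success D then 0 else Φ p.2 * Θ p.1

-- Sequencing of possibly empty and of nonempty runs

theorem _root_.Can.trans_self {C : Network S → ℝ≥0∞ → Prop} {w : ℝ≥0∞}
    (h : RunCan D (RunCan D C) x w) : RunCan D C x w :=
  Can.trans h fun _ _ h => h

theorem _root_.CanPlus.trans_can {C : Network S → ℝ≥0∞ → Prop} {w : ℝ≥0∞}
    (h : RunPlus D (RunCan D C) x w) : RunPlus D C x w :=
  CanStep.mono h fun _ _ h => Can.trans_self h

theorem _root_.Can.trans_canPlus {C : Network S → ℝ≥0∞ → Prop} {w : ℝ≥0∞}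
    (h : RunCan D (RunPlus D C) x w) : RunPlus D C x w :=
  CanPlus.trans_can (Can.canPlus h)

theorem _root_.CanPlus.trans_canPlus {C : Network S → ℝ≥0∞ → Prop} {w : ℝ≥0∞}
    (h : RunPlus D (RunPlus D C) x w) : RunPlus D C x w :=
  CanStep.mono h fun _ _ h => Can.trans h fun _ _ => CanStep.can

end Network

/-- A pair of lifted sub-distributions, as a weighted family of related pairs. -/
structure LiftFamily {X : Type u} (R : X → SubDist X → Prop) (Δ Θ : SubDist X) where
  ι : Type u
  p : ι → ℝ≥0∞
  x : ι → X
  Ξ : ι → SubDist X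
  rel : ∀ i, R (x i) (Ξ i)
  left_ne : ∀ i, Δ (x i) ≠ 0
  right_ne : ∀ i y, Ξ i y ≠ 0 → Θ y ≠ 0
  tsum_le : ∑' i, p i ≤ 1
  tsum_left : ∀ g : X → ℝ≥0∞, ∑' a, Δ a * g a = ∑' i, p i * g (x i)
  left_eq : ∀ a, Δ a = ∑' i, p i * SubDist.point (x i) a
  right_eq : ∀ a, Θ a = ∑' i, p i * Ξ i a

theorem Lift.exists_family {X : Type u} {R : X → SubDist X → Prop} {Δ Θ : SubDist X}
    (h : Lift R Δ Θ) : Nonempty (LiftFamily R Δ Θ) := by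
  classical
  obtain ⟨ι, p, x, Ξ, hp, hR, hΔ, hΘ⟩ := h.flatten
  have hl : ∀ a, Δ a = ∑' i, p i * SubDist.point (x i) a := fun a => by
    rw [← tsum_single_right Δ a, hΔ]
    refine tsum_congr fun i => ?_
    change _ = p i * (if a = x i then 1 else 0)
    simp only [eq_comm]
  have hr : ∀ a, Θ a = ∑' i, p i * Ξ i a := fun a => by
    rw [← tsum_single_right Θ a, hΘ]
    exact tsum_congr fun i => by rw [tsum_single_right]
  refine ⟨⟨ι, p, x, Ξ, hR, fun i h => ?_, fun i y hy h => ?_, ?_, hΔ, hl, hr⟩⟩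
  · rw [hl] at h
    exact mul_ne_zero (hp i) (SubDist.point_ne_zero.2 rfl) (ENNReal.tsum_eq_zero.1 h i)
  · rw [hr] at h
    exact mul_ne_zero (hp i) hy (ENNReal.tsum_eq_zero.1 h i)
  · have := hΔ fun _ => 1
    simp only [mul_one] at this
    rw [← this]
    exact Δ.2

-- Weak inputs and outputs performed together with the test

namespace Network

variable {S : Signature.{u}} {D : Defns S} {G : ConnGraph S} {M x y : Network S} {t : Sys S}

theorem Interacts.of_nodes (h : Interacts G M t) {t' : Sys S} (ht : t'.nodes = t.nodes) :
    Interacts G M t' := h.of_sameShape (SameShape.refl M) ht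

theorem ExtAround.sameShape {l : ExtAct S} {Φ Φ' : SubDist (Network S)}
    (h : ExtAround D l Φ Φ') (hΦ : ∀ x, Φ x ≠ 0 → SameShape M x) :
    ∀ x, Φ' x ≠ 0 → SameShape M x := by
  obtain ⟨Δ₁, Δ₂, h₁, h₂, h₃⟩ := h
  refine h₃.sameShape fun y hy => ?_
  obtain ⟨x, Ξ, hx, hr, hy⟩ := h₂.mem_support_left hy
  exact (h₁.sameShape hΦ x hx).trans (hr.sameShape hy)

/-- A weak extensional action of the network, performed together with the test. -/
theorem ExtAround.weakly (hI : Interacts G M t) (ht : ¬ t.Success D) {l : ExtAct S}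
    {Φ Φ' : SubDist (Network S)} (h : ExtAround D l Φ Φ') (hΦ : ∀ x, Φ x ≠ 0 → SameShape M x)
    {Θ : SubDist (Sys S)} (hΘ : ∀ t', Θ t' ≠ 0 → t'.nodes = t.nodes)
    (hred : ∀ x Ξ, SameShape M x → x.ExtStep D l Ξ →
      (run G x t).Red D (SubDist.map₂ (run G) Ξ Θ)) :
    Weakly (RunPlus D) (run G · t) Φ (testSuccess D Θ)
      (fun p : Sys S × Network S => run G p.2 p.1) (openPart D Φ' Θ) := by
  classical
  obtain ⟨Δ₁, Δ₂, h₁, h₂, h₃⟩ := h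
  have hΔ₁ := h₁.sameShape hΦ
  have hΔ₂ : ∀ y, Δ₂ y ≠ 0 → SameShape M y := fun y hy => by
    obtain ⟨x, Ξ, hx, hr, hy⟩ := h₂.mem_support_left hy
    exact (hΔ₁ x hx).trans (hr.sameShape hy)
  have w₁₂ : Weakly (RunPlus D) (run G · t) Φ (0 + 0)
      (fun p : Sys S × Network S => run G p.2 p.1) (fun p => Δ₂ p.2 * Θ p.1) :=
    Weakly.comp (fun _ _ _ h => Can.canPlus h) (h₁.weakly hI ht hΦ)
      (h₂.runStep_weakly ht hΔ₁ hred)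
  -- The network's internal moves after the common step are made separately for each outcome `t'` of
  -- the test. A successful `t'` forbids them, and its share is paid at price 1; altogether this is
  -- `testSuccess`.
  have fam : ∀ t', Weakly (RunCan D) (fun y => run G y t') (fun y => Δ₂ y * Θ t')
      (if t'.Success D then Θ t' else 0) (fun p : Sys S × Network S => run G p.2 p.1)
      (fun p => if p.1 = t' ∧ ¬ t'.Success D then Φ' p.2 * Θ t' else 0) := by
    intro t'
    by_cases hs : t'.Success D ∨ Θ t' = 0
    · refine ((Weakly.pay fun _ _ _ h => Can.of_payable h).mono_price ?_).congr (fun _ => rfl)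
        fun p => ?_
      · rw [ENNReal.tsum_mul_right]
        rcases hs with hs | hs
        · rw [if_pos hs]
          exact mul_le_of_le_one_left' Δ₂.2
        · simp [hs]
      · rcases hs with hs | hs <;> simp [hs]
    · push Not at hs
      refine ((((h₃.weakly (hI.of_nodes (hΘ t' hs.2)) hs.1 hΔ₂).scale (Θ t')).push
        (tgt' := fun p : Sys S × Network S => run G p.2 p.1) (fun y => (t', y))
        fun _ => rfl).mono_price (by simp)).congr (fun y => mul_comm _ _) ?_
      rintro ⟨t'', y⟩
      by_cases h : t'' = t'
      · subst h
        simp [hs.1, tsum_ite_eq, mul_comm]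
      · simp [h, Ne.symm h]
  refine ((Weakly.comp (fun _ _ _ h => CanPlus.trans_can h) w₁₂ (Weakly.family fam)).congr
    (fun _ => rfl) fun p => ?_).mono_price (by simp [testSuccess])
  rw [tsum_eq_single p.1 fun t' h => by simp [h.symm]]
  by_cases hs : p.1.Success D <;> simp [openPart, hs]

/-- Runs of weak outputs together with the test. -/
def OutputRuns (D : Defns S) (G : ConnGraph S) (M : Network S) (c : S.Chan) (v : S.Val)
    (η : Set S.Node) (x : Network S) (Δ : SubDist (Network S)) : Prop :=
  SameShape M x → (∀ y, Δ y ≠ 0 → SameShape M y) ∧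
    ∀ (t : Sys S) (Θ : SubDist (Sys S)), Interacts G M t → ¬ t.Success D → Hears D η c v t Θ →
      Weakly (RunPlus D) (run G · t) (SubDist.point x) (testSuccess D Θ)
        (fun p : Sys S × Network S => run G p.2 p.1) (openPart D Δ Θ)

theorem outputRuns_lift {c : S.Chan} {v : S.Val} {η : Set S.Node} {Φ Φ' : SubDist (Network S)}
    (h : Lift (OutputRuns D G M c v η) Φ Φ') (hΦ : ∀ x, Φ x ≠ 0 → SameShape M x) :
    (∀ y, Φ' y ≠ 0 → SameShape M y) ∧
    ∀ (t : Sys S) (Θ : SubDist (Sys S)), Interacts G M t → ¬ t.Success D → Hears D η c v t Θ →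
      Weakly (RunPlus D) (run G · t) Φ (testSuccess D Θ)
        (fun p : Sys S × Network S => run G p.2 p.1) (openPart D Φ' Θ) := by
  refine ⟨fun y hy => ?_, fun t Θ hI ht hΘ => ?_⟩
  · obtain ⟨x, Ξ, hx, hr, hy⟩ := h.mem_support_left hy
    exact (hr (hΦ x hx)).1 y hy
  · obtain ⟨F⟩ := h.exists_family
    refine ((Weakly.sum (P := RunPlus D) (fun _ _ _ _ h hw => CanStep.mono_right h hw)
      (fun i => (((F.rel i) (hΦ _ (F.left_ne i))).2 t Θ hI ht hΘ).scale (F.p i)) ?_).congr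
      (fun a => (F.left_eq a).symm) fun p => ?_).mono_price ?_
    · intro a
      rw [← F.left_eq]
      exact Φ.ne_top a
    · by_cases hs : p.1.Success D
      · simp [openPart, hs]
      · simp only [openPart, hs, if_false, F.right_eq, ← ENNReal.tsum_mul_right, mul_assoc]
    · rw [ENNReal.tsum_mul_right]
      exact mul_le_of_le_one_left' F.tsum_le

/-- `WeakOutput` is the least family closed under two rules, so it suffices that `OutputRuns` is
closed under them. For a compound output the reception by the test is split along the two sets of
targets. -/
theorem WeakOutput.outputRuns {c : S.Chan} {v : S.Val} {η : Set S.Node}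
    {Δ : SubDist (Network S)} (h : WeakOutput D c v η x Δ) : OutputRuns D G M c v η x Δ := by
  classical
  refine h (OutputRuns D G M c v) (fun η x Δ h hx => ?_) (fun η₁ η₂ x Δ' Δ h₁ h₂ hη hx => ?_)
  · have hpt : ∀ y, SubDist.point x y ≠ 0 → SameShape M y := fun y hy => by
      rwa [SubDist.point_ne_zero.1 hy]
    exact ⟨h.sameShape hpt, fun t Θ hI ht hΘ => h.weakly hI ht hpt (fun t' => hΘ.nodes_eq)
      fun x Ξ hx hs => hs.red_output (hI.of_sameShape hx rfl) hΘ⟩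
  · obtain ⟨hΔ', hw₁⟩ := h₁ hx
    obtain ⟨hΔ, hw₂⟩ := outputRuns_lift h₂ hΔ'
    refine ⟨hΔ, fun t Θ hI ht hΘ => ?_⟩
    obtain ⟨Θ₁, Ξ, hΘ₁, hΞ, rfl⟩ := hΘ.split hη
    -- The second instalment, for each intermediate test. Where `t₁` is already successful it
    -- carries no mass in `openPart`, having been paid for by the first instalment.
    have fam : ∀ t₁, Weakly (RunPlus D) (fun y => run G y t₁) (fun y => openPart D Δ' Θ₁ (t₁, y))
        (if t₁.Success D then 0 else Θ₁ t₁ * testSuccess D (Ξ t₁))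
        (fun p : Sys S × Network S => run G p.2 p.1)
        (fun p => if t₁.Success D then 0 else Θ₁ t₁ * openPart D Δ (Ξ t₁) p) := by
      intro t₁
      by_cases hs : t₁.Success D ∨ Θ₁ t₁ = 0
      · refine ((Weakly.pay (B := Sys S × Network S) (Φ := fun y => openPart D Δ' Θ₁ (t₁, y))
          fun _ _ _ h => Or.inl h).mono_price ?_).congr (fun _ => rfl) fun p => ?_
        · rcases hs with hs | hs <;> simp [openPart, hs]
        · rcases hs with hs | hs <;> simp [hs]
      · push Not at hs
        simp only [hs.1, if_false]
        refine ((hw₂ t₁ (Ξ t₁) (hI.of_nodes (hΘ₁.nodes_eq hs.2)) hs.1 (hΞ t₁ hs.2)).scale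
          (Θ₁ t₁)).congr (fun y => ?_) fun _ => rfl
        simp [openPart, hs.1, mul_comm]
    refine ((Weakly.comp (fun _ _ _ h => CanPlus.trans_canPlus h) (hw₁ t Θ₁ hI ht hΘ₁)
      (Weakly.family fam)).congr (fun _ => rfl) fun p => ?_).mono_price ?_
    · by_cases hp : p.1.Success D
      · simp [openPart, hp]
      · simp only [openPart, hp, if_false, SubDist.bind_apply, ← ENNReal.tsum_mul_left]
        refine tsum_congr fun t₁ => ?_
        split_ifs with hs
        -- A successful `t₁` was stopped, whereas the unsplit reception continues from it. The
        -- latter contributes nothing either, because all its continuations are successful and `p.1`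
        -- is not.
        · symm
          by_cases h1 : Θ₁ t₁ = 0
          · simp [h1]
          · by_cases h2 : Ξ t₁ p.1 = 0
            · simp [h2]
            · exact absurd (hΘ₁.success_of_success hη ht h1 hs (hΞ t₁ h1) h2) hp
        · exact mul_left_comm _ _ _
    · have e : testSuccess D (Θ₁.bind Ξ) = ∑' t₁, Θ₁ t₁ * testSuccess D (Ξ t₁) := by
        have := SubDist.tsum_bind Θ₁ Ξ fun t => if t.Success D then 1 else 0
        unfold testSuccess
        simpa only [mul_ite, mul_one, mul_zero] using this
      rw [e]
      unfold testSuccess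
      rw [← ENNReal.tsum_add]
      refine ENNReal.tsum_le_tsum fun t₁ => ?_
      -- Stopping at a successful `t₁` costs its whole mass. The reception from `t₁` has mass 1 and
      -- only successful outcomes, so the unsplit reception costs the same.
      split_ifs with hs
      · rw [add_zero]
        by_cases h1 : Θ₁ t₁ = 0
        · simp [h1]
        · refine le_mul_of_one_le_right' ((hΞ t₁ h1).mass.symm.le.trans ?_)
          refine ENNReal.tsum_le_tsum fun t₂ => ?_
          by_cases h2 : Ξ t₁ t₂ = 0
          · simp [h2]
          · rw [if_pos (hΘ₁.success_of_success hη ht h1 hs (hΞ t₁ h1) h2)]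
      · rw [zero_add]

end Network

-- The simulation argument

namespace Network

variable {S : Signature.{u}} {D : Defns S} {G : ConnGraph S} {M N x y n : Network S} {t : Sys S}

theorem SameShape.inputs_eq (h : SameShape M x) : x.inputs = M.inputs := by
  unfold inputs interface
  rw [h.1, h.2]

theorem Unheard.congr {α : SysAct S} (h : Unheard x α) (hxy : x.inputs = y.inputs) :
    Unheard y α := by
  cases α with
  | recv => exact h
  | send m c v =>
    change m ∉ y.inputs
    rw [← hxy]
    exact h
  | tau => exact h

/-! ### Reachability of weak derivatives -/

theorem Reachable.tail_extStep {l : ExtAct S} {Ξ : SubDist (Network S)} (h : M.Reachable D x)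
    (hs : x.ExtStep D l Ξ) (hy : Ξ y ≠ 0) : M.Reachable D y :=
  Relation.ReflTransGen.tail h ⟨l, Ξ, hs, hy⟩

theorem ExtHyper.reachable {Φ Φ' : SubDist (Network S)} (h : ExtHyper D Φ Φ')
    (hΦ : ∀ x, Φ x ≠ 0 → M.Reachable D x) : ∀ x, Φ' x ≠ 0 → M.Reachable D x :=
  HyperDer.support_subset (fun _ _ hx hr _ hy => Reachable.tail_extStep hx hr hy) h hΦ

theorem ExtAround.reachable {l : ExtAct S} {Φ Φ' : SubDist (Network S)}
    (h : ExtAround D l Φ Φ') (hΦ : ∀ x, Φ x ≠ 0 → M.Reachable D x) :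
    ∀ x, Φ' x ≠ 0 → M.Reachable D x := by
  obtain ⟨Δ₁, Δ₂, h₁, h₂, h₃⟩ := h
  refine h₃.reachable fun y hy => ?_
  obtain ⟨x, Ξ, hx, hr, hy⟩ := h₂.mem_support_left hy
  exact (h₁.reachable hΦ x hx).tail_extStep hr hy

theorem WeakOutput.reachable {c : S.Chan} {v : S.Val} {η : Set S.Node}
    {Δ : SubDist (Network S)} (h : WeakOutput D c v η x Δ) :
    M.Reachable D x → ∀ y, Δ y ≠ 0 → M.Reachable D y := by
  refine h (fun _ x Δ => M.Reachable D x → ∀ y, Δ y ≠ 0 → M.Reachable D y)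
    (fun η x Δ h hx => h.reachable fun y hy => ?_) (fun η₁ η₂ x Δ' Δ h₁ h₂ _ hx y hy => ?_)
  · rwa [SubDist.point_ne_zero.1 hy]
  · obtain ⟨z, Ξ, hz, hr, hy⟩ := h₂.mem_support_left hy
    exact hr (h₁ hx z hz) y hy

/-! ### Decomposition of the runs of the simulated network -/

/-- Reductions of `y` running with `t` in which the test takes part. -/
inductive LoudStep (D : Defns S) (G : ConnGraph S) (y : Network S) (t : Sys S) :
    SubDist (Network S) → SubDist (Sys S) → Prop
  | output {c v η Δ Θ} : y.ExtStep D (.output c v η) Δ → Hears D η c v t Θ → LoudStep D G y t Δ Θ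
  | input {m c v Δ Θ} : y.ExtStep D (.input m c v) Δ → SysStep D G t (.send m c v) Θ →
      LoudStep D G y t Δ Θ
  | test {α Θ} : Unheard y α → SysStep D G t α Θ → LoudStep D G y t (SubDist.point y) Θ

/-- The ways in which a sequence of internal moves of the network alone ends. -/
def SilentExit (D : Defns S) (G : ConnGraph S) (t : Sys S) (y : Network S) (w : ℝ≥0∞) : Prop :=
  Payable (Red D) (Success D) (run G y t) w ∨
    ∃ Δ Θ, LoudStep D G y t Δ Θ ∧ ∃ f : Network S → ℝ≥0∞,
      ∑' y, ∑' t', Δ y * Θ t' * f (run G y t') ≤ w ∧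
      ∀ y t', Δ y ≠ 0 → Θ t' ≠ 0 → Secures (Red D) (Success D) (run G y t') (f (run G y t'))

/-- Stopping a secured run just before the test first takes part leaves extensional internal moves
of the network alone, and clause (ii) applies to these as a whole. Matching them singly would not
do: a weak internal move may be empty, and the coinduction would lose its guard. -/
theorem exists_silent_hyperDer (hI : Interacts G N t) (hn : SameShape N n)
    {w : ℝ≥0∞} (h : Secures (Red D) (Success D) (run G n t) w) :
    ∃ (Δ : SubDist (Network S)) (v : Network S → ℝ≥0∞), ExtHyper D (SubDist.point n) Δ ∧
      (∀ y, Δ y ≠ 0 → SameShape N y ∧ SilentExit D G t y (v y)) ∧ ∑' y, Δ y * v y ≤ w := by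
  refine Attains.exists_hyperDer (fun x Ξ h => ExtStep.support_finite h)
    (C := fun y w => SameShape N y ∧ SilentExit D G t y w)
    ⟨fun y w => SameShape N y ∧ Secures (Red D) (Success D) (run G y t) w, ⟨hn, h⟩, ?_⟩
  rintro y w ⟨hy, h⟩
  rcases Attains.cases h with ⟨w₀, hle, h0 | h0⟩ | ⟨hs, Ξ, hr, w', hw, hsec⟩
  · exact h0.elim
  · exact Or.inl ⟨w₀, hle, hy, Or.inl h0⟩
  · have hys : ¬ y.Success D := fun h => hs (success_run.2 (Or.inl h))
    have loud : ∀ {Δ Θ}, LoudStep D G y t Δ Θ → Ξ = SubDist.map₂ (run G) Δ Θ →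
        SilentExit D G t y w := by
      rintro Δ Θ hl rfl
      refine Or.inr ⟨Δ, Θ, hl, w', by rwa [← SubDist.tsum_map₂], fun y t' hy ht' => ?_⟩
      exact hsec _ (SubDist.map₂_ne_zero.2 ⟨y, t', hy, ht', rfl⟩)
    rcases (hI.of_sameShape hy rfl).red_cases hys hr with ⟨Δ, hΔ, rfl⟩ |
      ⟨c, v, η, Δ, Θ, hΔ, hΘ, rfl⟩ | ⟨m, c, v, Δ, Θ, hΔ, hΘ, rfl⟩ | ⟨α, Θ, hα, hΘ, rfl⟩
    · refine Or.inr ⟨hys, Δ, hΔ, fun z => w' (run G z t), by rwa [← SubDist.tsum_map (run G · t)],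
        fun z hz => ⟨hy.trans (hΔ.sameShape hz), ?_⟩⟩
      exact hsec _ (SubDist.map_ne_zero.2 ⟨z, hz, rfl⟩)
    · exact Or.inl ⟨w, le_rfl, hy, loud (.output hΔ hΘ) rfl⟩
    · exact Or.inl ⟨w, le_rfl, hy, loud (.input hΔ hΘ) rfl⟩
    · exact Or.inl ⟨w, le_rfl, hy, loud (.test hα hΘ) rfl⟩

/-- A successful state can neither move on nor end for free. -/
theorem one_le_of_secures (hs : x.Success D) {w : ℝ≥0∞}
    (h : Secures (Red D) (Success D) x w) : 1 ≤ w := by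
  rcases Attains.cases h with ⟨w₀, hle, h0 | h0 | h0⟩ | ⟨hs', -⟩
  · exact h0.elim
  · exact h0.trans hle
  · exact absurd hs h0.1
  · exact absurd hs hs'

/-! ### Matching the runs -/

/-- A state `n`, `t` of a run of the simulated network with a test, and a sub-distribution `Θ`
that simulates `n` and has to run with `t` at the price `w`. -/
structure Obligation (D : Defns S) (G : ConnGraph S) (M N : Network S)
    (R : Network S → SubDist (Network S) → Prop) (nodes : Set S.Node) : Type u where
  n : Network S
  t : Sys S
  Θ : SubDist (Network S)
  w : ℝ≥0∞
  rel : R n Θ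
  shape : SameShape N n
  test : t.nodes = nodes
  reach : ∀ x, Θ x ≠ 0 → M.Reachable D x
  secures : Secures (Red D) (Success D) (run G n t) w

variable {R : Network S → SubDist (Network S) → Prop} {nodes : Set S.Node}

/-- `Θ` running with `t` reduces to obligations at the price `w`. -/
abbrev RunReduces (D : Defns S) (G : ConnGraph S) (M N : Network S)
    (R : Network S → SubDist (Network S) → Prop) (nodes : Set S.Node)
    (P : (Network S → ℝ≥0∞ → Prop) → Network S → ℝ≥0∞ → Prop) (Θ : Network S → ℝ≥0∞)
    (t : Sys S) (w : ℝ≥0∞) : Prop :=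
  Reduces (fun (o : Obligation D G M N R nodes) x => run G x o.t) (fun o => o.Θ) (fun o => o.w)
    P (run G · t) Θ w

theorem RunReduces.of_lift {P : (Network S → ℝ≥0∞ → Prop) → Network S → ℝ≥0∞ → Prop}
    (hP : ∀ C x w w', P C x w → w ≤ w' → P C x w') {Δ Θ : SubDist (Network S)}
    (hL : Lift R Δ Θ) {f : Network S → ℝ≥0∞}
    (h : ∀ y Ξ, R y Ξ → Δ y ≠ 0 → (∀ z, Ξ z ≠ 0 → Θ z ≠ 0) →
      RunReduces D G M N R nodes P Ξ t (f y)) :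
    RunReduces D G M N R nodes P Θ t (∑' y, Δ y * f y) := by
  obtain ⟨F⟩ := hL.exists_family
  exact Reduces.sum hP
    (fun i => (h _ _ (F.rel i) (F.left_ne i) (F.right_ne i)).scale (F.p i)) F.right_eq Θ.ne_top
    (F.tsum_left f).symm.le

theorem RunReduces.of_lift_secures {Δ Θ : SubDist (Network S)} (hL : Lift R Δ Θ)
    {f : Network S → ℝ≥0∞} (ht : t.nodes = nodes) (hΔ : ∀ y, Δ y ≠ 0 → SameShape N y)
    (hΘ : ∀ x, Θ x ≠ 0 → M.Reachable D x)
    (hf : ∀ y, Δ y ≠ 0 → Secures (Red D) (Success D) (run G y t) (f y)) :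
    RunReduces D G M N R nodes (RunCan D) Θ t (∑' y, Δ y * f y) :=
  RunReduces.of_lift (P := RunCan D) (fun _ _ _ _ h hw => Can.mono_right h hw) hL fun y Ξ hR hy hΞ =>
    Reduces.base (O := Obligation D G M N R nodes)
      ⟨y, t, Ξ, f y, hR, hΔ y hy, ht, fun x hx => hΘ x (hΞ x hx), hf y hy⟩

theorem RunReduces.of_zero {P : (Network S → ℝ≥0∞ → Prop) → Network S → ℝ≥0∞ → Prop}
    (hP : ∀ C x w, Payable (Red D) (Success D) x w → P C x w) {Θ : Network S → ℝ≥0∞}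
    {w : ℝ≥0∞} (h : ∑' x, Θ x ≤ w) : RunReduces D G M N R nodes P Θ t w :=
  Reduces.of_weakly_zero fun _ => (Weakly.pay hP).mono_price h

/-- The accounts of a step shared with the test. An unsuccessful outcome `t'` leaves new obligations
with the budgets given by `f`. A successful one costs its probability; in the simulated run all
prices at `t'` are at least 1 and `Δ` has mass 1, so that `w` already contains this amount. -/
theorem RunReduces.of_weakly_openPart {Θ Θ' Δ : SubDist (Network S)} {Ξ : SubDist (Sys S)}
    (hw : Weakly (RunPlus D) (run G · t) Θ (testSuccess D Ξ)
      (fun p : Sys S × Network S => run G p.2 p.1) (openPart D Θ' Ξ))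
    (hL : Lift R Δ Θ') (hΔ₁ : ∑' y, Δ y = 1) (hΞ : ∀ t', Ξ t' ≠ 0 → t'.nodes = nodes)
    (hΔ : ∀ y, Δ y ≠ 0 → SameShape N y) (hΘ' : ∀ x, Θ' x ≠ 0 → M.Reachable D x)
    {f : Network S → ℝ≥0∞} {w : ℝ≥0∞} (hle : ∑' y, ∑' t', Δ y * Ξ t' * f (run G y t') ≤ w)
    (hf : ∀ y t', Δ y ≠ 0 → Ξ t' ≠ 0 →
      Secures (Red D) (Success D) (run G y t') (f (run G y t'))) :
    RunReduces D G M N R nodes (RunPlus D) Θ t w := by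
  classical
  refine Reduces.comp (fun _ _ _ h => CanPlus.trans_can h) hw
    (srcs := fun t' x => run G x t') (Ω := fun t' y => openPart D Θ' Ξ (t', y))
    (ws := fun t' => if t'.Success D ∨ Ξ t' = 0 then 0 else
      Ξ t' * ∑' y, Δ y * f (run G y t')) (fun t' => ?_) (le_trans ?_ hle)
  · by_cases hs : t'.Success D ∨ Ξ t' = 0
    · rw [if_pos hs]
      refine RunReduces.of_zero (fun _ _ _ h => Can.of_payable h) (le_of_eq ?_)
      rcases hs with hs | hs <;> simp [openPart, hs]
    · rw [if_neg hs]
      push Not at hs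
      have := (RunReduces.of_lift_secures (G := G) hL (hΞ t' hs.2) hΔ hΘ'
        fun y hy => hf y t' hy hs.2).scale (Ξ t')
      convert this using 2
      simp [openPart, hs.1, mul_comm]
  · have e : ∑' y, ∑' t', Δ y * Ξ t' * f (run G y t') =
        ∑' t', Ξ t' * ∑' y, Δ y * f (run G y t') := by
      rw [ENNReal.tsum_comm]
      simp_rw [← ENNReal.tsum_mul_left]
      exact tsum_congr fun t' => tsum_congr fun y => by ring
    rw [e]
    unfold testSuccess
    rw [← ENNReal.tsum_add]
    refine ENNReal.tsum_le_tsum fun t' => ?_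
    by_cases h0 : Ξ t' = 0
    · simp [h0]
    by_cases hs : t'.Success D
    · simp only [hs, true_or, if_true, add_zero]
      refine le_mul_of_one_le_right' ?_
      calc (1 : ℝ≥0∞) = ∑' y, Δ y * 1 := by simp [hΔ₁]
        _ ≤ _ := ENNReal.tsum_le_tsum fun y => by
          by_cases hy : Δ y = 0
          · simp [hy]
          · exact mul_le_mul_right (one_le_of_secures (success_run.2 (Or.inr hs))
              (hf y t' hy h0)) _
    · simp [hs, h0]

/-- The simulating sub-distribution matches the ends of the silent runs. -/
theorem RunReduces.of_silentExit (hR : IsDeadlockSim D R) (hIM : Interacts G M t)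
    (hIN : Interacts G N t) (hin : M.inputs = N.inputs) (hMs : M.NeverSuccessful D)
    (ht : ¬ t.Success D) (htn : t.nodes = nodes) (hn : SameShape N n)
    {Θ : SubDist (Network S)} (hRn : R n Θ) (hΘ : ∀ x, Θ x ≠ 0 → M.Reachable D x) {w : ℝ≥0∞}
    (h : SilentExit D G t n w) : RunReduces D G M N R nodes (RunPlus D) Θ t w := by
  have hIn := hIN.of_sameShape hn rfl
  have hΘM : ∀ x, Θ x ≠ 0 → SameShape M x := fun x hx => (hΘ x hx).sameShape
  obtain ⟨-, hdead, hweak⟩ := hR n Θ hRn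
  rcases h with (h | ⟨hs, hr⟩) | ⟨Δ, Ξ, hl, f, hle, hf⟩
  · exact RunReduces.of_zero (fun _ _ _ h => Or.inl h) (Θ.2.trans h)
  -- The composition with `n` is stuck: `n` is deadlocked and the test has no active step. By clause
  -- (i) `Θ` reaches deadlocked networks only, which are stuck with this test as well and end at
  -- price 0.
  · have hns : ¬ n.Success D := fun h => hs (success_run.2 (Or.inl h))
    obtain ⟨Θ', hΘ', hd⟩ := hdead (hIn.deadlocked_of_not_red hns hr)
    refine Reduces.of_weakly_zero fun tgt => Weakly.mono_price (c := 0 + 0) ?_ (by simp)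
    refine Weakly.comp (fun _ _ _ h => Can.trans_canPlus h) (ExtHyper.weakly hIM ht hΘ' hΘM)
      (Weakly.dead (fun _ _ _ h => Or.inl h) fun x hx => ⟨fun h => ?_, ?_⟩)
    · exact (success_run.1 h).elim (hd x hx).1 ht
    · exact (hIM.of_sameShape (ExtHyper.sameShape hΘ' hΘM x hx) rfl).not_red_of_deadlocked
        (hd x hx) fun α Ξ hα hs => hr (hIn.exists_red_of_test hα hs)
  · cases hl with
    | @output c v η _ _ hΔ hΞ =>
      -- A strong action is a weak one with trivial internal moves before and after it.
      obtain ⟨Θ', hw, hL⟩ := hweak (.output c v η) Δ fun W h₁ _ => h₁ η n Δ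
        ⟨_, _, HyperDer.refl _ _ _, .point hΔ, HyperDer.refl _ _ _⟩
      have hw' := outputRuns_lift (G := G) (M := M) (Lift.rec (motive := fun Φ Φ' _ =>
        Lift (OutputRuns D G M c v η) Φ Φ') (fun h => .point (WeakOutput.outputRuns h))
        (fun p hp _ _ _ ih => .sum p hp _ _ ih) hw) hΘM
      refine RunReduces.of_weakly_openPart (hw'.2 t Ξ hIM ht hΞ) hL hΔ.mass
        (fun t' h => (hΞ.nodes_eq h).trans htn) (fun y hy => hn.trans (hΔ.sameShape hy))
        (fun x hx => ?_) hle hf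
      obtain ⟨z, Ξ', hz, hr, hx⟩ := Lift.mem_support_left hw hx
      exact WeakOutput.reachable hr (hΘ z hz) x hx
    | @input m c v _ _ hΔ hΞ =>
      obtain ⟨Θ', hw, hL⟩ := hweak (.input m c v) Δ
        ⟨_, _, HyperDer.refl _ _ _, .point hΔ, HyperDer.refl _ _ _⟩
      refine RunReduces.of_weakly_openPart (ExtAround.weakly hIM ht hw hΘM
        (fun t' => hΞ.nodes_eq) fun x Ξ' hx hs => hs.red_input (hIM.of_sameShape hx rfl) hΞ) hL
        hΔ.mass (fun t' h => (hΞ.nodes_eq h).trans htn)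
        (fun y hy => hn.trans (hΔ.sameShape hy)) (ExtAround.reachable hw hΘ) hle hf
    | @test α _ hα hΞ =>
      -- Equality of the inputs makes the move of the test unheard by the networks in `Θ` as well.
      -- They stay as they are, and being reachable from `M` they are unsuccessful, so that the
      -- composition may move on.
      have hα' : Unheard M α := hα.congr (hn.inputs_eq.trans hin.symm)
      refine Reduces.comp (P₁ := RunStep D) (P₂ := RunCan D) (fun _ _ _ h => h)
        (weakly_of_test hIM ht hα' hΞ fun x hx => ⟨hΘM x hx, hMs x (hΘ x hx)⟩)
        (srcs := fun t' x => run G x t') (Ω := fun t' y => Θ y * Ξ t')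
        (ws := fun t' => Ξ t' * f (run G n t')) (fun t' => ?_) (le_trans (le_of_eq ?_) hle)
      · by_cases h0 : Ξ t' = 0
        · exact RunReduces.of_zero (fun _ _ _ h => Can.of_payable h) (by simp [h0])
        · have := (Reduces.base (red := Red D) (succ := Success D)
            (osrc := fun (o : Obligation D G M N R nodes) x => run G x o.t)
            (oΦ := fun o => o.Θ) (op := fun o => o.w)
            ⟨n, t', Θ, f (run G n t'), hRn, hn, (hΞ.nodes_eq h0).trans htn, hΘ,
              hf n t' (SubDist.point_ne_zero.2 rfl) h0⟩).scale (Ξ t')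
          convert this using 2
          exact mul_comm _ _
      · simp_rw [mul_assoc, ENNReal.tsum_mul_left]
        rw [SubDist.tsum_point n fun y => ∑' t', Ξ t' * f (run G y t'), zero_add]

/-- One round: the silent part is matched by one weak internal move, then every exit is matched by
itself. If the test is successful at the outset, the budget is at least 1 and pays for all of `Θ`.
-/
theorem Obligation.reduces (hR : IsDeadlockSim D R) (hIM : Interacts G M t)
    (hIN : Interacts G N t) (hin : M.inputs = N.inputs) (hMs : M.NeverSuccessful D)
    (o : Obligation D G M N R t.nodes) :
    RunReduces D G M N R t.nodes (RunPlus D) o.Θ o.t o.w := by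
  by_cases ht : o.t.Success D
  · exact RunReduces.of_zero (fun _ _ _ h => Or.inl h)
      (o.Θ.2.trans (one_le_of_secures (success_run.2 (Or.inr ht)) o.secures))
  · have hIM' := hIM.of_nodes o.test
    have hIN' := hIN.of_nodes o.test
    obtain ⟨Δ, v, hΔ, hexit, hle⟩ := exists_silent_hyperDer hIN' o.shape o.secures
    obtain ⟨Θ', hΘ', hL⟩ := (hR o.n o.Θ o.rel).2.2 .tau Δ hΔ
    have hreach := ExtHyper.reachable hΘ' o.reach
    have h₂ := RunReduces.of_lift (D := D) (G := G) (M := M) (N := N) (nodes := t.nodes) (t := o.t)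
      (P := RunPlus D) (fun _ _ _ _ h hw => CanStep.mono_right h hw) hL (f := v)
      fun y Ξ hy hy0 hΞ => RunReduces.of_silentExit hR hIM' hIN' hin hMs ht o.test
        (hexit y hy0).1 hy (fun x hx => hreach x (hΞ x hx)) (hexit y hy0).2
    obtain ⟨c, Q, h₂, hc⟩ := h₂
    refine ⟨0 + c, Q, Weakly.comp (fun _ _ _ h => Can.trans_canPlus h)
      (ExtHyper.weakly hIM' ht hΘ' fun x hx => (o.reach x hx).sameShape) h₂, ?_⟩
    rw [zero_add]
    exact hc.trans hle

/-! ### Results and secured prices -/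

/-- Charge 1 at successful end states and 0 at the others; the latter is payable because an extreme
derivation ends at unsuccessful states only if they cannot reduce. The start is a point, so the
kernel's row at `x` is the end distribution and the expected price is the result. -/
theorem secures_of_mem_outcomes {w : ℝ≥0∞} (h : w ∈ x.outcomes D) :
    Secures (Red D) (Success D) x w := by
  classical
  obtain ⟨Δ', ⟨hd, hext⟩, rfl⟩ := h
  obtain ⟨κ, hκ, hatt⟩ := hd.exists_kernel
  have hx : SubDist.point x x ≠ 0 := SubDist.point_ne_zero.2 rfl
  have hκ' : ∀ y, κ x y = Δ' y := fun y => by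
    rw [← hκ y]
    exact (SubDist.tsum_point x fun z => κ z y).symm
  have := hatt x hx (fun y w => Payable (Red D) (Success D) y w)
    (fun y => if y.Success D then 1 else 0) fun y hy => by
      by_cases hs : y.Success D
      · exact Or.inl (by simp [hs])
      · exact Or.inr ⟨hs, fun hr => hs (hext y hy hr)⟩
  have e : val (Success D) Δ' = ∑' y, κ x y * if y.Success D then 1 else 0 := by
    simp only [val, hκ', mul_ite, mul_one, mul_zero]
  rw [e]
  exact this.mono fun y v h => Or.inr h

/-- Paying 1 at an unsuccessful state that can reduce does not end an extreme derivation. Such a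
state is made to run on by arbitrary reductions, with budget 1 kept throughout; this suffices
because every reduction has mass at most 1. -/
theorem exists_outcome_le_of_secures {w : ℝ≥0∞} (h : Secures (Red D) (Success D) x w) :
    ∃ p ∈ x.outcomes D, p ≤ w := by
  classical
  have h' : Attains (Red D) (Success D)
      (fun y v => (y.Success D ∧ 1 ≤ v) ∨ (¬ y.Success D ∧ ¬ ∃ Ξ, y.Red D Ξ)) x w := by
    refine ⟨fun y v => Secures (Red D) (Success D) y v ∨ 1 ≤ v, Or.inl h, fun y v h => ?_⟩
    have one : ∀ v : ℝ≥0∞, 1 ≤ v → (∃ w₀ ≤ v, (y.Success D ∧ 1 ≤ w₀) ∨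
        (¬ y.Success D ∧ ¬ ∃ Ξ, y.Red D Ξ)) ∨ (¬ y.Success D ∧ ∃ Ξ, y.Red D Ξ ∧
          ∃ w' : Network S → ℝ≥0∞, ∑' z, Ξ z * w' z ≤ v ∧
            ∀ z ∈ Ξ.support, Secures (Red D) (Success D) z (w' z) ∨ 1 ≤ w' z) := by
      intro v hv
      by_cases hs : y.Success D
      · exact Or.inl ⟨v, le_rfl, Or.inl ⟨hs, hv⟩⟩
      · by_cases hr : ∃ Ξ, y.Red D Ξ
        · obtain ⟨Ξ, hr⟩ := hr
          exact Or.inr ⟨hs, Ξ, hr, fun _ => 1, by simpa using Ξ.2.trans hv,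
            fun _ _ => Or.inr le_rfl⟩
        · exact Or.inl ⟨v, le_rfl, Or.inr ⟨hs, hr⟩⟩
    rcases h with h | h
    · rcases Attains.cases h with ⟨w₀, hle, h0 | h0 | h0⟩ | ⟨hs, Ξ, hr, w', hw, hz⟩
      · exact h0.elim
      · exact one v (h0.trans hle)
      · exact Or.inl ⟨w₀, hle, Or.inr h0⟩
      · exact Or.inr ⟨hs, Ξ, hr, w', hw, fun z hz' => Or.inl (hz z hz')⟩
    · exact one v h
  obtain ⟨Δ', v, hd, hexit, hle⟩ := h'.exists_hyperDer fun _ _ h => Red.support_finite h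
  refine ⟨val (Success D) Δ', ⟨Δ', ⟨hd, fun y hy hr => ?_⟩, rfl⟩, le_trans ?_ hle⟩
  · exact (hexit y hy).elim (fun h => h.1) fun h => absurd hr h.2
  · refine ENNReal.tsum_le_tsum fun y => ?_
    by_cases hy : Δ' y = 0
    · simp [hy]
    · split_ifs with hs
      · exact le_mul_of_one_le_right' ((hexit y hy).elim (fun h => h.2) fun h => absurd hs h.1)
      · simp

theorem WellFormed.interacts {T : Network S} (hM : M.WellFormed) (hT : T.WellFormed)
    (hc : M.Composable T) : Interacts T.graph M T.sys where
  edge := hM.2.2.1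
  mem_graph := hM.2.1
  disjoint := hc
  test_mem := hT.2.1

end Network

end

theorem theorem6p9 {S : Signature.{u}} (D : Defns S) (M N : Network S)
    (hM : M.WellFormed) (hN : N.WellFormed)
    (hMfin : M.Finitary D) (hNfin : N.Finitary D)
    (hin : M.inputs = N.inputs) (hout : M.outputs = N.outputs)
    (hMsucc : M.NeverSuccessful D)
    (hsim : N.DeadlockSim D (SubDist.point M)) :
    M.MustLe D N := by
  obtain ⟨R, hR, hRNM⟩ := hsim
  refine ⟨hin, hout, fun T hT hMT hNT p hp => ?_⟩
  have hIM := hM.interacts hT hMT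
  have hIN := hN.interacts hT hNT
  -- The initial obligation, whose budget is the given result of the simulated network.
  let o : Network.Obligation D T.graph M N R T.sys.nodes :=
    { n := N
      t := T.sys
      Θ := SubDist.point M
      w := p
      rel := hRNM
      shape := Network.SameShape.refl N
      test := rfl
      reach := fun x hx => by rw [SubDist.point_ne_zero.1 hx]; exact Relation.ReflTransGen.refl
      secures := Network.secures_of_mem_outcomes hp }
  obtain ⟨W, hW, hsec⟩ := secures_of_reduces
    (fun o => Network.Obligation.reduces hR hIM hIN hin hMsucc o) o
  have hle : W M ≤ p := (SubDist.tsum_point M W).symm.le.trans hW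
  exact Network.exists_outcome_le_of_secures
    (Can.mono_right (hsec M (SubDist.point_ne_zero.2 rfl)) hle)
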